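/- Let $M$ be a path connected topological space (for example a connected manifold) with base point $m_0$, and suppose that $\pi_1(M)=\pi_1(M,m_0)$ has no element of order $2$ or $3$. Write $\pi_1(M)$ multiplicatively, $\pi_2(M)=\pi_2(M,m_0)$ additively, and consider $\pi_2(M)$ as a $\pi_1(M)$-module. **Definitions.** A $\Delta$-group based at a group $G$ is a family of sets $T(g,h)$, $g,h\in G$, with operations $m:T(g,h^{-1})\times T(h,k^{-1})\times T(h^{-1}g,k^{-1}h)\to T(g,k^{-1})$, $P:T(g,h)\to T(h,g^{-1}h^{-1})$, $Q:T(g,h)\to T(g^{-1},hg)$ such that $P^3=\mathrm{id}$, $Q^2=\mathrm{id}$, $P^2Q=QP$, $P(m(a,b,c))=m(P(b),P(c),P(a))$, $Q(m(a,b,c))=m(Q(a),Q(c),Q(b))$, $m(m(a,b,c),d,e)=m(a,m(b,d,f),m(c,Q(f),e))$ and $m(m(f,a,b),P^2Q(a),PQ(b))=f$ whenever these are defined. Isomorphisms of $\Delta$-groups based at $G$ are families of bijections that commute with $m$, $P$, $Q$. For a $G$-module $A$ and $\alpha:G^3\to A$, $T(G,A,\alpha)$ has $T(g,h)=A$ for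 all $g,h$, and for $a\in T(g,h^{-1})$, $b\in T(h,k^{-1})$, $c\in T(h^{-1}g,k^{-1}h)$: $m(a,b,c)=a+(g^{-1}h)b+c+\alpha(g^{-1}h,h^{-1}k,k^{-1})$, $P(a)=ga$, $Q(a)=-ga$. Let $CS^2(G,A)$ be the set of $\sigma:G^2\to A$ with $\sigma(x,y)=-x\sigma(x^{-1},xy)=-\sigma(xy,y^{-1})$, and $CS^3(G,A)$ the set of $\alpha:G^3\to A$ with $\alpha(x,y,z)=-x\alpha(x^{-1},xy,z)=-\alpha(xy,y^{-1},yz)=-\alpha(x,yz,z^{-1})$. With the usual differential $\partial$ of group cochains, $ZS^3(G,A)=CS^3(G,A)\cap\ker\partial$, $BS^3(G,A)=\partial(CS^2(G,A))$ and $HS^3(G,A)=ZS^3(G,A)/BS^3(G,A)$. Let $s$ assign to each $g\in\pi_1(M)$ a loop $s(g)$ in the class $g$ such that $s(g^{-1})$ is the reverse of $s(g)$ and $s(1)$ is constant. $\Gamma(g,h)$ is the set of homotopy classes, relative to the boundary, of maps of the triangle $\Delta_2=[0,1,2]$ to $M$ whose edges $[0,1]$, $[1,2]$, $[0,2]$ (from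 the first to the second vertex) are $s(g)$, $s(h)$, $s(hg)$, where $hg$ is the class of $s(g)$ followed by $s(h)$. $P$ and $Q$ are composition with the affine maps of $\Delta_2$ that send the vertices $([0],[1],[2])$ to $([1],[2],[0])$ and $([1],[0],[2])$, respectively, and $m(a,b,c)$ is the class of $\omega|_{[1,2,3]}$ for a map $\omega:\Delta_3\to M$ with $\omega|_{[1,2,0]}$, $\omega|_{[0,2,3]}$, $\omega|_{[1,0,3]}$ in the classes $a,b,c$. This is $\Gamma(M)$. For $a\in\pi_2(M)$ and $x\in\Gamma(g,h)$ let $a\triangleright x\in\Gamma(g,h)$ be obtained by gluing $a$ to $x$ at the corner $[0]$. Base elements are elements $x(g,h)\in\Gamma(g,h)$ for all $g,h$ with $P(x(g,h))=x(h,g^{-1}h^{-1})$ and $Q(x(g,h))=x(g^{-1},hg)$. **Statement.** Such $s$ exist; for every such $s$, $\Gamma(M)$ is a well-defined $\Delta$-group based at $\pi_1(M)$, and base elements exist. For every choice of $s$ and of base elements $x$ there is a unique $\alpha:\pi_1(M)^3\to\pi_2(M)$ with $$m\bigl(x(g,h^{-1}),x(h,k^{-1}),x(h^{-1}g,k^{-1}h)\bigr)=\alpha(g^{-1}h,h^{-1}k,k^{-1})\triangleright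 x(g,k^{-1})\quad\text{for all } g,h,k\in\pi_1(M);$$ moreover $\alpha\in ZS^3(\pi_1(M),\pi_2(M))$, $T(\pi_1(M),\pi_2(M),\alpha)$ is a $\Delta$-group, and the maps $a\mapsto a\triangleright x(g,h)$ form an isomorphism of $\Delta$-groups $T(\pi_1(M),\pi_2(M),\alpha)\to\Gamma(M)$. The class $[\alpha]\in HS^3(\pi_1(M),\pi_2(M))$ is an invariant of the space $M$: it does not depend on the choices of $s$ and $x$, and if $f:M\to N$ is a homeomorphism, $n_0\in N$ and $\gamma$ is a path in $N$ from $f(m_0)$ to $n_0$, then the isomorphism $HS^3(\pi_1(M,m_0),\pi_2(M,m_0))\cong HS^3(\pi_1(N,n_0),\pi_2(N,n_0))$ induced by $f$ and $\gamma$ sends the class of $M$ to the class of $N$. -/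

import Mathlib

open scoped unitInterval Topology Topology.Homotopy

noncomputable section

namespace DeltaGrp

universe u v w

/-! ### Δ-groups -/

/-- The operations of a Δ-group based at `G`. The tri-product
`m : T(g, h⁻¹) × T(h, k⁻¹) × T(h⁻¹g, k⁻¹h) → T(g, k⁻¹)` is stated with the index conditions as
arguments (`h' = h⁻¹`, `k' = k⁻¹`), so that it applies without casts. -/
structure DeltaData (G : Type u) [Group G] where
  T : G → G → Type v
  m : ∀ {g h' h k' p q : G}, h' = h⁻¹ → p = h⁻¹ * g → q = k' * h →
    T g h' → T h k' → T p q → T g k'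
  P : ∀ {g h : G}, T g h → T h (g⁻¹ * h⁻¹)
  Q : ∀ {g h : G}, T g h → T g⁻¹ (h * g)

namespace DeltaData

variable {G : Type u} [Group G]

/-- The axioms of a Δ-group. The indices of the two sides of each equation agree in `G`;
heterogeneous equality is used where they agree only after a computation in `G`. -/
structure IsDeltaGroup (D : DeltaData.{u, v} G) : Prop where
  P_P_P : ∀ {g h : G} (a : D.T g h), D.P (D.P (D.P a)) ≍ a
  Q_Q : ∀ {g h : G} (a : D.T g h), D.Q (D.Q a) ≍ a
  P_P_Q : ∀ {g h : G} (a : D.T g h), D.P (D.P (D.Q a)) ≍ D.Q (D.P a)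
  P_m : ∀ {g h' h k' p q : G} (e₁ : h' = h⁻¹) (e₂ : p = h⁻¹ * g) (e₃ : q = k' * h)
    (a : D.T g h') (b : D.T h k') (c : D.T p q),
    D.P (D.m e₁ e₂ e₃ a b c) ≍
      D.m (by rw [e₃]; group) (by rw [e₁, e₃]; group) (by rw [e₁, e₂]; group)
        (D.P b) (D.P c) (D.P a)
  Q_m : ∀ {g h' h k' p q : G} (e₁ : h' = h⁻¹) (e₂ : p = h⁻¹ * g) (e₃ : q = k' * h)
    (a : D.T g h') (b : D.T h k') (c : D.T p q),
    D.Q (D.m e₁ e₂ e₃ a b c) ≍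
      D.m (by rw [e₁, e₂]; group) (by rw [e₂]; group) (by rw [e₃]; group)
        (D.Q a) (D.Q c) (D.Q b)
  m_m : ∀ {g h' h k' k l' p q r s : G} (e₁ : h' = h⁻¹) (e₂ : p = h⁻¹ * g) (e₃ : q = k' * h)
    (e₄ : k' = k⁻¹) (e₅ : r = k⁻¹ * g) (e₆ : s = l' * k)
    (a : D.T g h') (b : D.T h k') (c : D.T p q) (d : D.T k l') (e : D.T r s)
    (f : D.T (k⁻¹ * h) (l' * k)),
    D.m e₄ e₅ e₆ (D.m e₁ e₂ e₃ a b c) d e =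
      D.m e₁ e₂ (by group) a (D.m e₄ rfl rfl b d f)
        (D.m (by rw [e₃, e₄]; group) (by rw [e₅, e₂]; group) (by rw [e₆]; group)
          c (D.Q f) e)
  m_m_cancel : ∀ {g h' h k' p q : G} (e₁ : h' = h⁻¹) (e₂ : p = h⁻¹ * g) (e₃ : q = k' * h)
    (f : D.T g h') (a : D.T h k') (b : D.T p q),
    D.m (by group) (by rw [e₂, e₃]; group) (by rw [e₂, e₃]; group)
      (D.m e₁ e₂ e₃ f a b) (D.P (D.P (D.Q a))) (D.P (D.Q b)) ≍ f

/-- An isomorphism of Δ-groups based at `G` (over the identity of `G`). -/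
structure Iso (D : DeltaData.{u, v} G) (E : DeltaData.{u, w} G) where
  toEquiv : ∀ g h : G, D.T g h ≃ E.T g h
  map_m : ∀ {g h' h k' p q : G} (e₁ : h' = h⁻¹) (e₂ : p = h⁻¹ * g) (e₃ : q = k' * h)
    (a : D.T g h') (b : D.T h k') (c : D.T p q),
    toEquiv g k' (D.m e₁ e₂ e₃ a b c) =
      E.m e₁ e₂ e₃ (toEquiv g h' a) (toEquiv h k' b) (toEquiv p q c)
  map_P : ∀ {g h : G} (a : D.T g h), toEquiv h (g⁻¹ * h⁻¹) (D.P a) = E.P (toEquiv g h a)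
  map_Q : ∀ {g h : G} (a : D.T g h), toEquiv g⁻¹ (h * g) (D.Q a) = E.Q (toEquiv g h a)

end DeltaData

section Algebra

variable (G : Type u) [Group G] (A : Type v) [AddCommGroup A] [DistribMulAction G A]

/-- The operations of `T(G, A, α)`; the element `(a, (g, h))` of `T(g, h)` is written `a`. -/
def twisted (α : G → G → G → A) : DeltaData.{u, v} G where
  T _ _ := A
  m {g _ h k' _ _} _ _ _ a b c :=
    a + (g⁻¹ * h) • b + c + α (g⁻¹ * h) (h⁻¹ * k'⁻¹) k'
  P {g _} a := g • a
  Q {g _} a := -(g • a)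

/-! ### Symmetric cohomology in degree three -/

/-- The differential `∂ : C²(G, A) → C³(G, A)`. -/
def d₂ : (G → G → A) →+ (G → G → G → A) where
  toFun c x y z := x • c y z - c (x * y) z + c x (y * z) - c x y
  map_zero' := by ext; simp
  map_add' c e := by ext; simp only [Pi.add_apply, smul_add]; abel

/-- The differential `∂ : C³(G, A) → C⁴(G, A)`. -/
def d₃ : (G → G → G → A) →+ (G → G → G → G → A) where
  toFun α x y z t :=
    x • α y z t - α (x * y) z t + α x (y * z) t - α x y (z * t) + α x y z
  map_zero' := by ext; simp
  map_add' α β := by ext; simp only [Pi.add_apply, smul_add]; abel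

/-- `CS²(G, A)`: the 2-cochains invariant under the transpositions `(1,2)`, `(2,3)`, hence under
`Σ₃`. -/
def CS₂ : AddSubgroup (G → G → A) where
  carrier := {c | (∀ x y, -(x • c x⁻¹ (x * y)) = c x y) ∧ ∀ x y, -c (x * y) y⁻¹ = c x y}
  zero_mem' := by simp
  add_mem' {c e} hc he := by
    refine ⟨fun x y => ?_, fun x y => ?_⟩
    · rw [Pi.add_apply, Pi.add_apply, Pi.add_apply, Pi.add_apply, smul_add, neg_add, hc.1, he.1]
    · rw [Pi.add_apply, Pi.add_apply, Pi.add_apply, Pi.add_apply, neg_add, hc.2, he.2]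
  neg_mem' {c} hc := by
    refine ⟨fun x y => ?_, fun x y => ?_⟩
    · rw [Pi.neg_apply, Pi.neg_apply, Pi.neg_apply, Pi.neg_apply, smul_neg, hc.1]
    · rw [Pi.neg_apply, Pi.neg_apply, Pi.neg_apply, Pi.neg_apply, hc.2]

/-- `CS³(G, A)`: the 3-cochains invariant under the transpositions `(1,2)`, `(2,3)`, `(3,4)`, hence
under `Σ₄`. -/
def CS₃ : AddSubgroup (G → G → G → A) where
  carrier := {α | (∀ x y z, -(x • α x⁻¹ (x * y) z) = α x y z) ∧
    (∀ x y z, -α (x * y) y⁻¹ (y * z) = α x y z) ∧ ∀ x y z, -α x (y * z) z⁻¹ = α x y z}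
  zero_mem' := by simp
  add_mem' {α β} hα hβ := by
    refine ⟨fun x y z => ?_, fun x y z => ?_, fun x y z => ?_⟩
    · simp only [Pi.add_apply, smul_add, neg_add, hα.1, hβ.1]
    · simp only [Pi.add_apply, neg_add, hα.2.1, hβ.2.1]
    · simp only [Pi.add_apply, neg_add, hα.2.2, hβ.2.2]
  neg_mem' {α} hα := by
    refine ⟨fun x y z => ?_, fun x y z => ?_, fun x y z => ?_⟩
    · simp only [Pi.neg_apply, smul_neg, hα.1]
    · simp only [Pi.neg_apply, hα.2.1]
    · simp only [Pi.neg_apply, hα.2.2]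

/-- The symmetric 3-cocycles `ZS³(G, A)`. -/
def ZS₃ : AddSubgroup (G → G → G → A) := CS₃ G A ⊓ (d₃ G A).ker

/-- The symmetric 3-coboundaries `BS³(G, A) = ∂ CS²(G, A)`. -/
def BS₃ : AddSubgroup (G → G → G → A) := (CS₂ G A).map (d₂ G A)

theorem BS₃_le_ZS₃ : BS₃ G A ≤ ZS₃ G A := by
  rintro _ ⟨c, ⟨h₁, h₂⟩, rfl⟩
  have h₁' : ∀ x y, x • c x⁻¹ (x * y) = -c x y := fun x y => by rw [← h₁ x y, neg_neg]
  have h₂' : ∀ x y, c (x * y) y⁻¹ = -c x y := fun x y => by rw [← h₂ x y, neg_neg]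
  have e1 : ∀ x y z : G, x • c x⁻¹ (x * y * z) = -c x (y * z) := fun x y z => by
    rw [mul_assoc, h₁']
  have e2 : ∀ x y z : G, c (x * (y * z)) z⁻¹ = -c (x * y) z := fun x y z => by
    rw [← mul_assoc, h₂']
  refine ⟨⟨fun x y z => ?_, fun x y z => ?_, fun x y z => ?_⟩, ?_⟩
  · have := h₁' x y
    have h3 := e1 x y z
    simp only [d₂, AddMonoidHom.coe_mk, ZeroHom.coe_mk, smul_add, smul_sub, smul_inv_smul,
      inv_mul_cancel, one_mul, ← mul_assoc] at *
    rw [this, h3]; abel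
  · have := h₂' x y
    have h3 := h₁' y z
    have h4 : (x * y) • c y⁻¹ (y * z) = - (x • c y z) := by rw [mul_smul, h3, smul_neg]
    simp only [d₂, AddMonoidHom.coe_mk, ZeroHom.coe_mk, mul_inv_cancel_right,
      inv_mul_cancel_left] at *
    rw [this, h4]; abel
  · have := h₂' y z
    have h3 := e2 x y z
    simp only [d₂, AddMonoidHom.coe_mk, ZeroHom.coe_mk, mul_inv_cancel_right] at *
    rw [this, h3, smul_neg]; abel
  · change d₃ G A _ = 0
    ext x y z t
    simp only [d₂, d₃, AddMonoidHom.coe_mk, ZeroHom.coe_mk, smul_add, smul_sub, mul_smul,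
      mul_assoc, Pi.zero_apply]
    abel

/-- The symmetric cohomology group `HS³(G, A) = ZS³(G, A) / BS³(G, A)`. -/
abbrev HS₃ : Type (max u v) := ZS₃ G A ⧸ (BS₃ G A).addSubgroupOf (ZS₃ G A)

end Algebra

section AlgebraMap

variable {G : Type u} [Group G] {A : Type v} [AddCommGroup A] [DistribMulAction G A]
variable {G' : Type*} [Group G'] {A' : Type*} [AddCommGroup A'] [DistribMulAction G' A']

/-- The class of a symmetric 3-cocycle. -/
def HS₃.mk (α : G → G → G → A) (hα : α ∈ ZS₃ G A) : HS₃ G A :=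
  QuotientAddGroup.mk ⟨α, hα⟩

/-- Transport of 3-cochains along isomorphisms `φ : G ≃ G'` and `ψ : A ≃ A'`. -/
def cochainCongr (φ : G ≃* G') (ψ : A ≃+ A') : (G → G → G → A) ≃+ (G' → G' → G' → A') where
  toFun α x y z := ψ (α (φ.symm x) (φ.symm y) (φ.symm z))
  invFun β x y z := ψ.symm (β (φ x) (φ y) (φ z))
  left_inv α := by ext; simp
  right_inv β := by ext; simp
  map_add' α β := by ext; simp

theorem cochainCongr_mem_ZS₃ (φ : G ≃* G') (ψ : A ≃+ A') (hψ : ∀ g a, ψ (g • a) = φ g • ψ a)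
    {α : G → G → G → A} (hα : α ∈ ZS₃ G A) : cochainCongr φ ψ α ∈ ZS₃ G' A' := by
  obtain ⟨⟨h1, h2, h3⟩, h4⟩ := hα
  have hψ' : ∀ (x : G') (a : A), x • ψ a = ψ (φ.symm x • a) := fun x a => by simp [hψ]
  refine ⟨⟨fun x y z => ?_, fun x y z => ?_, fun x y z => ?_⟩, ?_⟩
  · simp only [cochainCongr, AddEquiv.coe_mk, Equiv.coe_fn_mk, hψ', ← map_neg, map_mul, map_inv, h1]
  · simp only [cochainCongr, AddEquiv.coe_mk, Equiv.coe_fn_mk, ← map_neg, map_mul, map_inv, h2]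
  · simp only [cochainCongr, AddEquiv.coe_mk, Equiv.coe_fn_mk, ← map_neg, map_mul, map_inv, h3]
  · replace h4 : d₃ G A α = 0 := h4
    change d₃ G' A' _ = 0
    ext x y z t
    have := congrFun (congrFun (congrFun (congrFun h4 (φ.symm x)) (φ.symm y)) (φ.symm z)) (φ.symm t)
    simp only [d₃, AddMonoidHom.coe_mk, ZeroHom.coe_mk, Pi.zero_apply] at this
    simp only [d₃, AddMonoidHom.coe_mk, ZeroHom.coe_mk, cochainCongr, AddEquiv.coe_mk,
      Equiv.coe_fn_mk, hψ', map_mul, ← map_add, ← map_sub, this, map_zero, Pi.zero_apply]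

theorem cochainCongr_mem_BS₃ (φ : G ≃* G') (ψ : A ≃+ A') (hψ : ∀ g a, ψ (g • a) = φ g • ψ a)
    {α : G → G → G → A} (hα : α ∈ BS₃ G A) : cochainCongr φ ψ α ∈ BS₃ G' A' := by
  obtain ⟨c, ⟨h1, h2⟩, rfl⟩ := hα
  have hψ' : ∀ (x : G') (a : A), x • ψ a = ψ (φ.symm x • a) := fun x a => by simp [hψ]
  refine ⟨fun x y => ψ (c (φ.symm x) (φ.symm y)), ⟨fun x y => ?_, fun x y => ?_⟩, ?_⟩
  · simp only [hψ', ← map_neg, map_mul, map_inv, h1]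
  · simp only [← map_neg, map_mul, map_inv, h2]
  · ext x y z
    simp only [d₂, AddMonoidHom.coe_mk, ZeroHom.coe_mk, cochainCongr, AddEquiv.coe_mk,
      Equiv.coe_fn_mk, hψ', map_mul, map_add, map_sub]

theorem equivariant_symm (φ : G ≃* G') (ψ : A ≃+ A') (hψ : ∀ g a, ψ (g • a) = φ g • ψ a)
    (g : G') (a : A') : ψ.symm (g • a) = φ.symm g • ψ.symm a := by
  rw [AddEquiv.symm_apply_eq, hψ]; simp

/-- The isomorphism `HS³(G, A) ≃ HS³(G', A')` induced by an isomorphism `φ : G ≃ G'` and a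
`φ`-equivariant isomorphism `ψ : A ≃ A'`; it sends `[α]` to `[ψ ∘ α ∘ (φ⁻¹ × φ⁻¹ × φ⁻¹)]`. -/
def HS₃.congr (φ : G ≃* G') (ψ : A ≃+ A') (hψ : ∀ g a, ψ (g • a) = φ g • ψ a) :
    HS₃ G A ≃+ HS₃ G' A' :=
  QuotientAddGroup.congr _ _
    { toFun := fun α => ⟨cochainCongr φ ψ α, cochainCongr_mem_ZS₃ φ ψ hψ α.2⟩
      invFun := fun β => ⟨(cochainCongr φ ψ).symm β,
        cochainCongr_mem_ZS₃ φ.symm ψ.symm (equivariant_symm φ ψ hψ) β.2⟩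
      left_inv := fun α => by simp
      right_inv := fun β => by simp
      map_add' := fun α β => by ext; simp }
    (by
      ext ⟨β, hβ⟩
      simp only [AddSubgroup.mem_map, AddSubgroup.mem_addSubgroupOf]
      constructor
      · rintro ⟨α, hα, h⟩
        have h' := congrArg Subtype.val h
        change _ = β at h'
        rw [← h']
        exact cochainCongr_mem_BS₃ φ ψ hψ hα
      · intro h
        refine ⟨⟨(cochainCongr φ ψ).symm β,
          cochainCongr_mem_ZS₃ φ.symm ψ.symm (equivariant_symm φ ψ hψ) hβ⟩, ?_, ?_⟩
        · exact cochainCongr_mem_BS₃ φ.symm ψ.symm (equivariant_symm φ ψ hψ) h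
        · apply Subtype.ext
          exact (cochainCongr φ ψ).apply_symm_apply β)

end AlgebraMap

/-! ### The second homotopy group as a module over the fundamental group -/

section PiTwo

variable {X : Type u} [TopologicalSpace X] {Y : Type v} [TopologicalSpace Y]

/-- The second homotopy group, written additively. -/
def PiTwo (X : Type u) [TopologicalSpace X] (x : X) : Type u := Additive (π_ 2 X x)

instance (x : X) : AddCommGroup (PiTwo X x) := inferInstanceAs (AddCommGroup (Additive (π_ 2 X x)))

/-- The class of a map of the square that sends the boundary to `x`. -/
def PiTwo.mk {x : X} (a : Ω^ (Fin 2) X x) : PiTwo X x :=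
  Additive.ofMul (Quotient.mk (GenLoop.Homotopic.setoid (Fin 2) x) a)

theorem PiTwo.mk_surjective {x : X} (a : PiTwo X x) : ∃ f, PiTwo.mk f = a :=
  Quotient.exists_rep (s := GenLoop.Homotopic.setoid (Fin 2) x) a

theorem PiTwo.mk_eq {x : X} {a b : Ω^ (Fin 2) X x} :
    PiTwo.mk a = PiTwo.mk b ↔ GenLoop.Homotopic a b :=
  Quotient.eq (r := GenLoop.Homotopic.setoid (Fin 2) x)

theorem PiTwo.mk_add {x : X} (a b : Ω^ (Fin 2) X x) :
    PiTwo.mk a + PiTwo.mk b = PiTwo.mk (GenLoop.transAt 0 b a) :=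
  congrArg Additive.ofMul (HomotopyGroup.mul_spec (i := (0 : Fin 2)) (p := a) (q := b))

/-- The truncation `ℝ → [0, 1]`. -/
abbrev trunc (r : ℝ) : I := Set.projIcc 0 1 zero_le_one r

theorem trunc_of_le {r : ℝ} (h : r ≤ 0) : trunc r = 0 := Set.projIcc_of_le_left _ h
theorem trunc_of_ge {r : ℝ} (h : 1 ≤ r) : trunc r = 1 := Set.projIcc_of_right_le _ h
theorem trunc_coe (t : I) : trunc t = t := Set.projIcc_val _ t

/-- The sup-norm distance of a point of the square to the boundary. -/
def bdist (z : Fin 2 → I) : ℝ := min (min (z 0 : ℝ) (1 - z 0)) (min (z 1 : ℝ) (1 - z 1))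

theorem continuous_bdist : Continuous bdist := by unfold bdist; fun_prop

theorem bdist_nonneg (z : Fin 2 → I) : 0 ≤ bdist z := by
  have h0 := (z 0).2; have h1 := (z 1).2
  simp only [bdist, le_min_iff]
  exact ⟨⟨h0.1, by linarith [h0.2]⟩, ⟨h1.1, by linarith [h1.2]⟩⟩

theorem bdist_eq_zero {z : Fin 2 → I} (hz : z ∈ Cube.boundary (Fin 2)) : bdist z = 0 := by
  refine le_antisymm ?_ (bdist_nonneg z)
  obtain ⟨i, hi⟩ := hz
  fin_cases i <;> rcases hi with hi | hi <;> simp only [Fin.zero_eta, Fin.mk_one] at hi <;>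
    simp [bdist, hi]

theorem bdist_cases {z : Fin 2 → I} {r : ℝ} (h : bdist z ≤ r) :
    ∃ i, (z i : ℝ) ≤ r ∨ 1 - r ≤ z i := by
  simp only [bdist, min_le_iff] at h
  rcases h with (h | h) | (h | h)
  · exact ⟨0, .inl h⟩
  · exact ⟨0, .inr (by linarith)⟩
  · exact ⟨1, .inl h⟩
  · exact ⟨1, .inr (by linarith)⟩

/-- The map of the square that expands by the factor `1 + t` about the centre and truncates. -/
def expand (t : ℝ) (z : Fin 2 → I) : Fin 2 → I := fun i => trunc ((1 + t) * z i - t / 2)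

theorem expand_mem_boundary {t r : ℝ} {z : Fin 2 → I} (h : bdist z ≤ r) (ht : 0 ≤ 1 + t)
    (hr : (1 + t) * r ≤ t / 2) : expand t z ∈ Cube.boundary (Fin 2) := by
  obtain ⟨i, hi | hi⟩ := bdist_cases h
  · exact ⟨i, .inl (trunc_of_le (by nlinarith))⟩
  · exact ⟨i, .inr (trunc_of_ge (by nlinarith))⟩

theorem expand_zero (z : Fin 2 → I) : expand 0 z = z := by
  ext i; simp [expand]

@[fun_prop]
theorem continuous_expand {Z : Type*} [TopologicalSpace Z] {f : Z → ℝ} {g : Z → Fin 2 → I}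
    (hf : Continuous f) (hg : Continuous g) : Continuous fun w => expand (f w) (g w) := by
  unfold expand; fun_prop

/-- Free homotopies: `b` is obtained from `a` by a homotopy of maps of the square under which the
whole boundary travels along the path `γ`. -/
def FreeHomotopic {x y : X} (γ : Path x y) (a : Ω^ (Fin 2) X x) (b : Ω^ (Fin 2) X y) : Prop :=
  ∃ H : C(I × (Fin 2 → I), X), (∀ z, H (0, z) = a z) ∧ (∀ z, H (1, z) = b z) ∧
    ∀ t, ∀ z ∈ Cube.boundary (Fin 2), H (t, z) = γ t

/-- Transport of a map of the square along a path `γ` from `x` to `y`: the map is shrunk to the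
inner square and the collar is filled with `γ`, traversed from the inner boundary outwards. -/
def transportLoop {x y : X} (γ : Path x y) (a : Ω^ (Fin 2) X x) : Ω^ (Fin 2) X y :=
  ⟨⟨fun z => if bdist z ≤ 1 / 4 then γ (trunc (1 - 4 * bdist z)) else a (expand 1 z), by
      have := continuous_bdist
      refine Continuous.if_le (by fun_prop) ?_ this continuous_const fun z hz => ?_
      · exact a.1.continuous.comp (by fun_prop)
      · rw [hz, trunc_of_le (by norm_num), γ.source,
          GenLoop.boundary a _ (expand_mem_boundary hz.le (by norm_num) (by norm_num))]⟩,
    fun z hz => by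
      change (if bdist z ≤ 1 / 4 then γ (trunc (1 - 4 * bdist z)) else a (expand 1 z)) = y
      rw [bdist_eq_zero hz, if_pos (by norm_num), trunc_of_ge (by norm_num), γ.target]⟩

theorem transportLoop_apply {x y : X} (γ : Path x y) (a : Ω^ (Fin 2) X x) (z : Fin 2 → I) :
    transportLoop γ a z =
      if bdist z ≤ 1 / 4 then γ (trunc (1 - 4 * bdist z)) else a (expand 1 z) := rfl

theorem freeHomotopic_transportLoop {x y : X} (γ : Path x y) (a : Ω^ (Fin 2) X x) :
    FreeHomotopic γ a (transportLoop γ a) := by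
  have hc := continuous_bdist
  refine ⟨⟨fun w => if bdist w.2 ≤ w.1 / 4 then γ (trunc (w.1 - 4 * bdist w.2))
    else a (expand w.1 w.2), ?_⟩, fun z => ?_, fun z => ?_, fun t z hz => ?_⟩
  · refine Continuous.if_le (by fun_prop) ?_ (by fun_prop) (by fun_prop) fun w hw => ?_
    · exact a.1.continuous.comp (by fun_prop)
    · rw [hw, trunc_of_le (by linarith), γ.source,
        GenLoop.boundary a _ (expand_mem_boundary hw.le (by linarith [w.1.2.1])
          (by nlinarith [w.1.2.1, w.1.2.2]))]
  · simp only [ContinuousMap.coe_mk, Set.Icc.coe_zero, zero_div, expand_zero]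
    split_ifs with h
    · have h0 := bdist_nonneg z
      have h' := expand_mem_boundary h (t := 0) (by norm_num) (by norm_num)
      rw [expand_zero] at h'
      rw [trunc_of_le (by linarith), γ.source, GenLoop.boundary a z h']
    · rfl
  · simp [transportLoop_apply]
  · simp only [ContinuousMap.coe_mk]
    rw [bdist_eq_zero hz, if_pos (by linarith [t.2.1])]
    congr 1
    rw [mul_zero, sub_zero, trunc_coe]

theorem FreeHomotopic.homotopic {x y : X} {γ : Path x y} {a : Ω^ (Fin 2) X x}
    {b : Ω^ (Fin 2) X y} (h : FreeHomotopic γ a b) : GenLoop.Homotopic b (transportLoop γ a) := by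
  have hc := continuous_bdist
  obtain ⟨H, h0, h1, hb⟩ := h
  have e1 : b.1.HomotopicRel (b.1.comp ⟨expand 1, by fun_prop⟩) (Cube.boundary (Fin 2)) := by
    refine ⟨⟨⟨⟨fun w => b (expand w.1 w.2), ?_⟩, fun z => ?_, fun z => ?_⟩, fun t z hz => ?_⟩⟩
    · exact b.1.continuous.comp (by fun_prop)
    · simp [expand_zero]
    · simp
    · simp only [ContinuousMap.coe_mk]
      rw [GenLoop.boundary b _ (expand_mem_boundary (bdist_eq_zero hz).le (by linarith [t.2.1])
        (by linarith [t.2.1])), b.2 z hz]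
  refine e1.trans ⟨⟨⟨⟨fun w => if bdist w.2 ≤ 1 / 4 then γ (trunc (1 - 4 * bdist w.2 * w.1))
    else H (unitInterval.symm w.1, expand 1 w.2), ?_⟩, fun z => ?_, fun z => ?_⟩,
      fun t z hz => ?_⟩⟩
  · refine Continuous.if_le (by fun_prop) (by fun_prop) (by fun_prop) (by fun_prop) fun w hw => ?_
    rw [hb _ _ (expand_mem_boundary hw.le (by norm_num) (by norm_num)), hw]
    congr 1
    rw [← trunc_coe (unitInterval.symm w.1)]
    congr 1
    simp
  · simp only [ContinuousMap.coe_mk, Set.Icc.coe_zero, mul_zero, sub_zero, unitInterval.symm_zero,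
      h1, ContinuousMap.comp_apply]
    split_ifs with h
    · rw [trunc_of_ge le_rfl, γ.target, b.2 _ (expand_mem_boundary h (by norm_num) (by norm_num))]
    · rfl
  · simp only [Set.Icc.coe_one, mul_one, unitInterval.symm_one, h0]
    rfl
  · simp only [ContinuousMap.coe_mk, ContinuousMap.comp_apply]
    rw [bdist_eq_zero hz, if_pos (by norm_num), mul_zero, zero_mul, sub_zero, trunc_of_ge le_rfl,
      γ.target, b.2 _ (expand_mem_boundary (bdist_eq_zero hz).le (by norm_num) (by norm_num))]

theorem transportLoop_homotopic {x y : X} {γ δ : Path x y} {a b : Ω^ (Fin 2) X x}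
    (hγ : γ.Homotopic δ) (hab : GenLoop.Homotopic a b) :
    GenLoop.Homotopic (transportLoop γ a) (transportLoop δ b) := by
  have hc := continuous_bdist
  obtain ⟨K⟩ := hγ
  obtain ⟨H⟩ := hab
  have hH : ∀ t, ∀ z ∈ Cube.boundary (Fin 2), H (t, z) = x := fun t z hz => by
    rw [H.eq_fst t hz]; exact a.2 z hz
  refine ⟨⟨⟨⟨fun w => if bdist w.2 ≤ 1 / 4 then K (w.1, trunc (1 - 4 * bdist w.2))
    else H (w.1, expand 1 w.2), ?_⟩, fun z => ?_, fun z => ?_⟩, fun t z hz => ?_⟩⟩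
  · refine Continuous.if_le (by fun_prop) (by fun_prop) (by fun_prop) (by fun_prop) fun w hw => ?_
    rw [hH _ _ (expand_mem_boundary hw.le (by norm_num) (by norm_num)), hw,
      trunc_of_le (by norm_num), K.source]
  · simp only [K.apply_zero, H.apply_zero]
    rfl
  · simp only [K.apply_one, H.apply_one]
    rfl
  · simp only [ContinuousMap.coe_mk]
    rw [bdist_eq_zero hz, if_pos (by norm_num), trunc_of_ge (by norm_num), K.target]
    exact ((transportLoop γ a).2 z hz).symm

theorem FreeHomotopic.refl {x : X} (a : Ω^ (Fin 2) X x) : FreeHomotopic (Path.refl x) a a :=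
  ⟨⟨fun w => a w.2, a.1.continuous.comp continuous_snd⟩, fun _ => rfl, fun _ => rfl,
    fun _ z hz => a.2 z hz⟩

theorem FreeHomotopic.trans {x y z : X} {γ : Path x y} {δ : Path y z} {a : Ω^ (Fin 2) X x}
    {b : Ω^ (Fin 2) X y} {c : Ω^ (Fin 2) X z} (h : FreeHomotopic γ a b)
    (h' : FreeHomotopic δ b c) : FreeHomotopic (γ.trans δ) a c := by
  obtain ⟨H, h0, h1, hb⟩ := h
  obtain ⟨K, k0, k1, kb⟩ := h'
  refine ⟨⟨fun w => if (w.1 : ℝ) ≤ 1 / 2 then H (trunc (2 * w.1), w.2)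
    else K (trunc (2 * w.1 - 1), w.2), ?_⟩, fun w => ?_, fun w => ?_, fun t w hw => ?_⟩
  · refine Continuous.if_le (by fun_prop) (by fun_prop) (by fun_prop) (by fun_prop) fun w hw => ?_
    rw [hw, trunc_of_ge (by norm_num), trunc_of_le (by norm_num), h1, k0]
  · simp [h0]
  · simp only [ContinuousMap.coe_mk, Set.Icc.coe_one]
    rw [if_neg (by norm_num), trunc_of_ge (by norm_num), k1]
  · simp only [ContinuousMap.coe_mk, hb _ _ hw, kb _ _ hw, Path.trans_apply]
    split_ifs with ht
    · congr 1
      exact (trunc_coe ⟨2 * (t : ℝ), _⟩)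
    · congr 1
      exact (trunc_coe ⟨2 * (t : ℝ) - 1, _⟩)

theorem FreeHomotopic.transAt {x y : X} {γ : Path x y} {a a' : Ω^ (Fin 2) X x}
    {b b' : Ω^ (Fin 2) X y} (h : FreeHomotopic γ a b) (h' : FreeHomotopic γ a' b') :
    FreeHomotopic γ (GenLoop.transAt 0 a a') (GenLoop.transAt 0 b b') := by
  obtain ⟨H, h0, h1, hb⟩ := h
  obtain ⟨K, k0, k1, kb⟩ := h'
  have hu : ∀ (z : Fin 2 → I) (r : I), (r = 0 ∨ r = 1) →
      Function.update z 0 r ∈ Cube.boundary (Fin 2) := fun z r hr => ⟨0, by simpa using hr⟩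
  have hu' : ∀ (z : Fin 2 → I) (r : I), (z 1 = 0 ∨ z 1 = 1) →
      Function.update z 0 r ∈ Cube.boundary (Fin 2) := fun z r hr => ⟨1, by simpa using hr⟩
  refine ⟨⟨fun w => if (w.2 0 : ℝ) ≤ 1 / 2 then H (w.1, Function.update w.2 0 (trunc (2 * w.2 0)))
    else K (w.1, Function.update w.2 0 (trunc (2 * w.2 0 - 1))), ?_⟩, fun w => ?_, fun w => ?_,
      fun t w hw => ?_⟩
  · refine Continuous.if_le (by fun_prop) (by fun_prop) (by fun_prop) (by fun_prop) fun w hw => ?_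
    rw [hb _ _ (hu _ _ (.inr (trunc_of_ge (by rw [hw]; norm_num)))),
      kb _ _ (hu _ _ (.inl (trunc_of_le (by rw [hw]; norm_num))))]
  · simp only [ContinuousMap.coe_mk, h0, k0]
    rfl
  · simp only [ContinuousMap.coe_mk, h1, k1]
    rfl
  · simp only [ContinuousMap.coe_mk]
    obtain ⟨i, hi⟩ := hw
    fin_cases i
    · simp only [Fin.zero_eta] at hi
      rcases hi with hi | hi
      · rw [if_pos (by simp [hi]), hb _ _ (hu _ _ (.inl (trunc_of_le (by simp [hi]))))]
      · rw [if_neg (by simp [hi]; norm_num),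
          kb _ _ (hu _ _ (.inr (trunc_of_ge (by simp [hi]; norm_num))))]
    · simp only [Fin.mk_one] at hi
      rw [hb _ _ (hu' _ _ hi), kb _ _ (hu' _ _ hi), ite_self]

/-- The composite of a map of the square with a continuous map `f`. -/
def mapLoop (f : C(X, Y)) {x : X} (a : Ω^ (Fin 2) X x) : Ω^ (Fin 2) Y (f x) :=
  ⟨f.comp a.1, fun z hz => congrArg f (a.2 z hz)⟩

theorem FreeHomotopic.map (f : C(X, Y)) {x y : X} {γ : Path x y} {a : Ω^ (Fin 2) X x}
    {b : Ω^ (Fin 2) X y} (h : FreeHomotopic γ a b) :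
    FreeHomotopic (γ.map f.continuous) (mapLoop f a) (mapLoop f b) := by
  obtain ⟨H, h0, h1, hb⟩ := h
  exact ⟨f.comp H, fun z => congrArg f (h0 z), fun z => congrArg f (h1 z),
    fun t z hz => congrArg f (hb t z hz)⟩

/-- Transport `π₂(X, x) → π₂(X, y)` along a homotopy class of paths from `x` to `y`. -/
def transport {x y : X} (p : Path.Homotopic.Quotient x y) (a : PiTwo X x) : PiTwo X y :=
  Quotient.map₂ (sa := Path.Homotopic.setoid x y) (sb := GenLoop.Homotopic.setoid (Fin 2) x)
    (sc := GenLoop.Homotopic.setoid (Fin 2) y) transportLoop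
    (fun _ _ hγ _ _ hab => transportLoop_homotopic hγ hab) p a

theorem transport_mk {x y : X} (γ : Path x y) (a : Ω^ (Fin 2) X x) :
    transport (Path.Homotopic.Quotient.mk γ) (PiTwo.mk a) = PiTwo.mk (transportLoop γ a) := rfl

theorem FreeHomotopic.transport_eq {x y : X} {γ : Path x y} {a : Ω^ (Fin 2) X x}
    {b : Ω^ (Fin 2) X y} (h : FreeHomotopic γ a b) :
    transport (Path.Homotopic.Quotient.mk γ) (PiTwo.mk a) = PiTwo.mk b :=
  (PiTwo.mk_eq.2 h.homotopic).symm

theorem transport_refl {x : X} (a : PiTwo X x) :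
    transport (Path.Homotopic.Quotient.refl x) a = a := by
  obtain ⟨a, rfl⟩ := PiTwo.mk_surjective a
  exact (FreeHomotopic.refl a).transport_eq

theorem transport_trans {x y z : X} (p : Path.Homotopic.Quotient x y)
    (q : Path.Homotopic.Quotient y z) (a : PiTwo X x) :
    transport (p.trans q) a = transport q (transport p a) := by
  obtain ⟨a, rfl⟩ := PiTwo.mk_surjective a
  obtain ⟨γ, rfl⟩ := Path.Homotopic.Quotient.mk_surjective p
  obtain ⟨δ, rfl⟩ := Path.Homotopic.Quotient.mk_surjective q
  exact ((freeHomotopic_transportLoop γ a).trans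
    (freeHomotopic_transportLoop δ (transportLoop γ a))).transport_eq

theorem transport_add {x y : X} (p : Path.Homotopic.Quotient x y) (a b : PiTwo X x) :
    transport p (a + b) = transport p a + transport p b := by
  obtain ⟨a, rfl⟩ := PiTwo.mk_surjective a
  obtain ⟨b, rfl⟩ := PiTwo.mk_surjective b
  obtain ⟨γ, rfl⟩ := Path.Homotopic.Quotient.mk_surjective p
  rw [PiTwo.mk_add, transport_mk γ a, transport_mk γ b, PiTwo.mk_add]
  exact ((freeHomotopic_transportLoop γ b).transAt
    (freeHomotopic_transportLoop γ a)).transport_eq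

/-- The action of `π₁(X, x)` on `π₂(X, x)`. In `FundamentalGroup` the product `g * h` is the class
of a loop in `h` followed by a loop in `g`, so that transport along loops is a left action. -/
instance (x : X) : DistribMulAction (FundamentalGroup X x) (PiTwo X x) where
  smul g a := transport g.toPath a
  one_smul a := transport_refl a
  mul_smul g h a := transport_trans h.toPath g.toPath a
  smul_add g a b := transport_add g.toPath a b
  smul_zero g := by
    have h := transport_add g.toPath (0 : PiTwo X x) 0
    rw [add_zero] at h
    exact left_eq_add.1 h

theorem smul_def {x : X} (g : FundamentalGroup X x) (a : PiTwo X x) :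
    g • a = transport g.toPath a := rfl

/-- Transport along a path is an isomorphism of second homotopy groups. -/
def transportEquiv {x y : X} (γ : Path x y) : PiTwo X x ≃+ PiTwo X y where
  toFun := transport (Path.Homotopic.Quotient.mk γ)
  invFun := transport (Path.Homotopic.Quotient.mk γ).symm
  left_inv a := by
    rw [← transport_trans, Path.Homotopic.Quotient.trans_symm, transport_refl]
  right_inv a := by
    rw [← transport_trans, Path.Homotopic.Quotient.symm_trans, transport_refl]
  map_add' := transport_add _

/-- The map induced by `f` on second homotopy groups. -/
def mapPiTwo (f : C(X, Y)) (x : X) (a : PiTwo X x) : PiTwo Y (f x) :=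
  Quotient.map (sa := GenLoop.Homotopic.setoid (Fin 2) x)
    (sb := GenLoop.Homotopic.setoid (Fin 2) (f x)) (mapLoop f)
    (fun _ _ h => ContinuousMap.HomotopicRel.comp_continuousMap h f) a

theorem mapPiTwo_mk (f : C(X, Y)) {x : X} (a : Ω^ (Fin 2) X x) :
    mapPiTwo f x (PiTwo.mk a) = PiTwo.mk (mapLoop f a) := rfl

theorem mapPiTwo_add (f : C(X, Y)) {x : X} (a b : PiTwo X x) :
    mapPiTwo f x (a + b) = mapPiTwo f x a + mapPiTwo f x b := by
  obtain ⟨a, rfl⟩ := PiTwo.mk_surjective a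
  obtain ⟨b, rfl⟩ := PiTwo.mk_surjective b
  rw [PiTwo.mk_add, mapPiTwo_mk, mapPiTwo_mk, mapPiTwo_mk, PiTwo.mk_add]
  congr 1
  ext z
  change f (GenLoop.transAt 0 b a z) = _
  simp only [GenLoop.transAt, GenLoop.coe_copy]
  split_ifs <;> rfl

theorem mapPiTwo_transport (f : C(X, Y)) {x y : X} (p : Path.Homotopic.Quotient x y)
    (a : PiTwo X x) : mapPiTwo f y (transport p a) = transport (p.map f) (mapPiTwo f x a) := by
  obtain ⟨a, rfl⟩ := PiTwo.mk_surjective a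
  obtain ⟨γ, rfl⟩ := Path.Homotopic.Quotient.mk_surjective p
  exact ((freeHomotopic_transportLoop γ a).map f).transport_eq.symm

/-- The isomorphism `π₂(X, x) ≃ π₂(Y, f x)` induced by a homeomorphism `f`. -/
def mapPiTwoEquiv (f : X ≃ₜ Y) (x : X) : PiTwo X x ≃+ PiTwo Y (f x) :=
  AddEquiv.ofBijective
    (AddMonoidHom.mk' (mapPiTwo (f : C(X, Y)) x) (mapPiTwo_add (f : C(X, Y)))) (by
      constructor
      · intro a b h
        obtain ⟨a, rfl⟩ := PiTwo.mk_surjective a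
        obtain ⟨b, rfl⟩ := PiTwo.mk_surjective b
        have h' := PiTwo.mk_eq.1 h
        have h'' := ContinuousMap.HomotopicRel.comp_continuousMap h' (f.symm : C(Y, X))
        have e : ∀ c : Ω^ (Fin 2) X x, (f.symm : C(Y, X)).comp (mapLoop (f : C(X, Y)) c).1 = c.1 :=
          fun c => ContinuousMap.ext fun z => f.symm_apply_apply _
        rw [e, e] at h''
        exact PiTwo.mk_eq.2 h''
      · intro b
        obtain ⟨b, rfl⟩ := PiTwo.mk_surjective b
        refine ⟨PiTwo.mk ⟨(f.symm : C(Y, X)).comp b.1, fun z hz => ?_⟩, ?_⟩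
        · exact (congrArg f.symm (b.2 z hz)).trans (f.symm_apply_apply x)
        · refine congrArg PiTwo.mk (GenLoop.ext _ _ fun z => ?_)
          exact f.apply_symm_apply _)

/-- The isomorphism `π₁(X, x) ≃ π₁(Y, f x)` induced by a homeomorphism `f`. -/
def mapPiOneEquiv (f : X ≃ₜ Y) (x : X) : FundamentalGroup X x ≃* FundamentalGroup Y (f x) :=
  MulEquiv.ofBijective (FundamentalGroup.map (f : C(X, Y)) x) (by
    constructor
    · intro p q h
      obtain ⟨p, rfl⟩ := Path.Homotopic.Quotient.mk_surjective p
      obtain ⟨q, rfl⟩ := Path.Homotopic.Quotient.mk_surjective q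
      have h' := (Path.Homotopic.Quotient.eq (p := p.map f.continuous) (q := q.map f.continuous)).1 h
      obtain ⟨H⟩ := h'.map (f.symm : C(Y, X))
      refine Path.Homotopic.Quotient.eq.2 ⟨⟨⟨H.toContinuousMap, fun t => ?_, fun t => ?_⟩,
        fun t s hs => ?_⟩⟩
      · exact (H.apply_zero t).trans (f.symm_apply_apply _)
      · exact (H.apply_one t).trans (f.symm_apply_apply _)
      · exact (H.eq_fst t hs).trans (f.symm_apply_apply _)
    · intro q
      obtain ⟨q, rfl⟩ := Path.Homotopic.Quotient.mk_surjective q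
      refine ⟨Path.Homotopic.Quotient.mk ((q.map f.symm.continuous).cast
        (f.symm_apply_apply x).symm (f.symm_apply_apply x).symm), ?_⟩
      refine congrArg Path.Homotopic.Quotient.mk (Path.ext (funext fun t => ?_))
      exact f.apply_symm_apply _)

/-- The isomorphism `π₁(X, x) ≃ π₁(Y, y)` induced by a homeomorphism `f : X ≃ Y` and a path `γ`
from `f x` to `y`. -/
def piOneCongr (f : X ≃ₜ Y) {x : X} {y : Y} (γ : Path (f x) y) :
    FundamentalGroup X x ≃* FundamentalGroup Y y :=
  (mapPiOneEquiv f x).trans (FundamentalGroup.fundamentalGroupMulEquivOfPath γ)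

/-- The isomorphism `π₂(X, x) ≃ π₂(Y, y)` induced by a homeomorphism `f : X ≃ Y` and a path `γ`
from `f x` to `y`. -/
def piTwoCongr (f : X ≃ₜ Y) {x : X} {y : Y} (γ : Path (f x) y) : PiTwo X x ≃+ PiTwo Y y :=
  (mapPiTwoEquiv f x).trans (transportEquiv γ)

theorem piTwoCongr_smul (f : X ≃ₜ Y) {x : X} {y : Y} (γ : Path (f x) y)
    (g : FundamentalGroup X x) (a : PiTwo X x) :
    piTwoCongr f γ (g • a) = piOneCongr f γ g • piTwoCongr f γ a := by
  have h1 : piTwoCongr f γ (g • a) = transport (Path.Homotopic.Quotient.mk γ)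
      (mapPiTwo (f : C(X, Y)) x (transport g.toPath a)) := rfl
  have h2 : piTwoCongr f γ a = transport (Path.Homotopic.Quotient.mk γ)
      (mapPiTwo (f : C(X, Y)) x a) := rfl
  have h3 : (piOneCongr f γ g).toPath = (Path.Homotopic.Quotient.mk γ).symm.trans
      ((Path.Homotopic.Quotient.map g.toPath (f : C(X, Y))).trans
        (Path.Homotopic.Quotient.mk γ)) := rfl
  rw [h1, h2, smul_def, h3, mapPiTwo_transport, transport_trans, transport_trans,
    ← transport_trans (Path.Homotopic.Quotient.mk γ), Path.Homotopic.Quotient.trans_symm,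
    transport_refl]

end PiTwo

/-! ### The Δ-group of a pointed space -/

section Gamma

variable {M : Type u} [TopologicalSpace M] {m₀ : M}

/-- The standard 2-simplex. -/
abbrev Δ₂ : Type := stdSimplex ℝ (Fin 3)

/-- The standard 3-simplex. -/
abbrev Δ₃ : Type := stdSimplex ℝ (Fin 4)

/-- A barycentric coordinate as an element of the unit interval. -/
def coord {n : ℕ} (p : stdSimplex ℝ (Fin n)) (i : Fin n) : I :=
  ⟨p i, stdSimplex.zero_le p i, stdSimplex.le_one p i⟩

/-- The affine map from the 2-simplex that sends the vertices `[0]`, `[1]`, `[2]` to the vertices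
`[f 0]`, `[f 1]`, `[f 2]`. -/
def face {n : ℕ} (f : Fin 3 → Fin n) : C(Δ₂, stdSimplex ℝ (Fin n)) :=
  ⟨stdSimplex.map f, stdSimplex.continuous_map f⟩

/-- The boundary of the 2-simplex. -/
def bdry : Set Δ₂ := {p | ∃ i, p i = 0}

/-- A section `s : π₁(M, m₀) → Ω(M, m₀)` with `s(g⁻¹)` the reverse of `s(g)` and `s(1)`
constant. -/
structure LoopSection (M : Type u) [TopologicalSpace M] (m₀ : M) where
  loop : FundamentalGroup M m₀ → Path m₀ m₀
  class_loop : ∀ g, Path.Homotopic.Quotient.mk (loop g) = g.toPath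
  loop_inv : ∀ g, loop g⁻¹ = (loop g).symm
  loop_one : loop 1 = Path.refl m₀

/-- The singular 2-simplices whose edges are the chosen loops: `[0] → [1]` is mapped by the loop of
`g`, `[1] → [2]` by the loop of `h`, and `[0] → [2]` by the loop of `h * g` (the class of the loop
of `g` followed by the loop of `h`). -/
def Triangle (s : LoopSection M m₀) (g h : FundamentalGroup M m₀) : Type u :=
  {a : C(Δ₂, M) // (∀ p, p 2 = 0 → a p = s.loop g (coord p 1)) ∧
    (∀ p, p 0 = 0 → a p = s.loop h (coord p 2)) ∧
    ∀ p, p 1 = 0 → a p = s.loop (h * g) (coord p 2)}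

/-- Homotopy relative to the boundary. -/
instance triangleSetoid (s : LoopSection M m₀) (g h : FundamentalGroup M m₀) :
    Setoid (Triangle s g h) where
  r a b := a.1.HomotopicRel b.1 bdry
  iseqv := ⟨fun a => .refl a.1, fun h => h.symm, fun h h' => h.trans h'⟩

/-- The set `Γ(g, h)` of homotopy classes of singular 2-simplices with prescribed boundary. -/
def Gamma (s : LoopSection M m₀) (g h : FundamentalGroup M m₀) : Type u :=
  Quotient (triangleSetoid s g h)

/-- The class of a singular 2-simplex. -/
def Gamma.mk {s : LoopSection M m₀} {g h : FundamentalGroup M m₀} (a : Triangle s g h) :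
    Gamma s g h :=
  Quotient.mk _ a

theorem loop_inv_apply (s : LoopSection M m₀) (g : FundamentalGroup M m₀) {t t' : I}
    (h : (t : ℝ) + t' = 1) : s.loop g⁻¹ t = s.loop g t' := by
  rw [s.loop_inv, Path.symm_apply]
  refine congrArg (s.loop g) (Subtype.ext ?_)
  rw [unitInterval.coe_symm_eq]
  linarith

theorem coord_congr {m n : ℕ} {p : stdSimplex ℝ (Fin m)} {q : stdSimplex ℝ (Fin n)} {i : Fin m}
    {j : Fin n} (h : p i = q j) : coord p i = coord q j := Subtype.ext h

theorem Δ₂.sum (p : Δ₂) : p 0 + p 1 + p 2 = 1 := by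
  rw [← Fin.sum_univ_three]; exact stdSimplex.sum_eq_one p

theorem Δ₃.sum (p : Δ₃) : p 0 + p 1 + p 2 + p 3 = 1 := by
  rw [← Fin.sum_univ_four]; exact stdSimplex.sum_eq_one p

theorem face_apply {n : ℕ} (f : Fin 3 → Fin n) (p : Δ₂) (j : Fin n) :
    face f p j = (if f 0 = j then p 0 else 0) + (if f 1 = j then p 1 else 0) +
      (if f 2 = j then p 2 else 0) := by
  simp [face, FunOnFinite.linearMap_apply_apply, Finset.sum_filter, Fin.sum_univ_three]

/-- The rotation of the 2-simplex. -/
def Triangle.P {s : LoopSection M m₀} {g h : FundamentalGroup M m₀} (a : Triangle s g h) :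
    Triangle s h (g⁻¹ * h⁻¹) :=
  ⟨a.1.comp (face ![1, 2, 0]), by
    obtain ⟨a, h01, h12, h02⟩ := a
    have e0 : ∀ p, face ![(1 : Fin 3), 2, 0] p 0 = p 2 := fun p => by simp [face_apply]
    have e1 : ∀ p, face ![(1 : Fin 3), 2, 0] p 1 = p 0 := fun p => by simp [face_apply]
    have e2 : ∀ p, face ![(1 : Fin 3), 2, 0] p 2 = p 1 := fun p => by simp [face_apply]
    refine ⟨fun p hp => ?_, fun p hp => ?_, fun p hp => ?_⟩
    · rw [ContinuousMap.comp_apply, h12 _ ((e0 p).trans hp), coord_congr (e2 p)]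
    · rw [ContinuousMap.comp_apply, h02 _ ((e1 p).trans hp), coord_congr (e2 p), ← mul_inv_rev,
        loop_inv_apply]
      simp only [coord]; linarith [Δ₂.sum p]
    · rw [ContinuousMap.comp_apply, h01 _ ((e2 p).trans hp), coord_congr (e1 p),
        inv_mul_cancel_right, loop_inv_apply]
      simp only [coord]; linarith [Δ₂.sum p]⟩

/-- The reflection of the 2-simplex. -/
def Triangle.Q {s : LoopSection M m₀} {g h : FundamentalGroup M m₀} (a : Triangle s g h) :
    Triangle s g⁻¹ (h * g) :=
  ⟨a.1.comp (face ![1, 0, 2]), by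
    obtain ⟨a, h01, h12, h02⟩ := a
    have e0 : ∀ p, face ![(1 : Fin 3), 0, 2] p 0 = p 1 := fun p => by simp [face_apply]
    have e1 : ∀ p, face ![(1 : Fin 3), 0, 2] p 1 = p 0 := fun p => by simp [face_apply]
    have e2 : ∀ p, face ![(1 : Fin 3), 0, 2] p 2 = p 2 := fun p => by simp [face_apply]
    refine ⟨fun p hp => ?_, fun p hp => ?_, fun p hp => ?_⟩
    · rw [ContinuousMap.comp_apply, h01 _ ((e2 p).trans hp), coord_congr (e1 p), loop_inv_apply]
      simp only [coord]; linarith [Δ₂.sum p]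
    · rw [ContinuousMap.comp_apply, h02 _ ((e1 p).trans hp), coord_congr (e2 p)]
    · rw [ContinuousMap.comp_apply, h12 _ ((e0 p).trans hp), coord_congr (e2 p),
        mul_inv_cancel_right]⟩

theorem homotopicRel_comp_face {a b : C(Δ₂, M)} (h : a.HomotopicRel b bdry)
    {f : Fin 3 → Fin 3} (hf : ∀ p ∈ bdry, face f p ∈ bdry) :
    (a.comp (face f)).HomotopicRel (b.comp (face f)) bdry := by
  obtain ⟨H⟩ := h
  exact ⟨⟨⟨H.toContinuousMap.comp ((ContinuousMap.id I).prodMap (face f)),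
    fun p => H.apply_zero _, fun p => H.apply_one _⟩, fun t p hp => H.eq_fst t (hf p hp)⟩⟩

theorem face_mem_bdry {f : Fin 3 → Fin 3} (hf : Function.Injective f) (p : Δ₂) (hp : p ∈ bdry) :
    face f p ∈ bdry := by
  obtain ⟨i, hi⟩ := hp
  refine ⟨f i, ?_⟩
  rw [face_apply]
  simp only [hf.eq_iff]
  fin_cases i <;> simpa using hi

/-- `P : Γ(g, h) → Γ(h, g⁻¹h⁻¹)`. -/
def Gamma.P {s : LoopSection M m₀} {g h : FundamentalGroup M m₀} (a : Gamma s g h) :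
    Gamma s h (g⁻¹ * h⁻¹) :=
  Quotient.map Triangle.P
    (fun _ _ h => homotopicRel_comp_face h (face_mem_bdry (by decide))) a

/-- `Q : Γ(g, h) → Γ(g⁻¹, hg)`. -/
def Gamma.Q {s : LoopSection M m₀} {g h : FundamentalGroup M m₀} (a : Gamma s g h) :
    Gamma s g⁻¹ (h * g) :=
  Quotient.map Triangle.Q
    (fun _ _ h => homotopicRel_comp_face h (face_mem_bdry (by decide))) a

/-- `d` is the class of the face `[1,2,3]` of a singular 3-simplex `ω` whose faces `[1,2,0]`,
`[0,2,3]`, `[1,0,3]` are in the classes `a`, `b`, `c`. -/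
def Fills {s : LoopSection M m₀} {g h' h k' p q : FundamentalGroup M m₀} (a : Gamma s g h')
    (b : Gamma s h k') (c : Gamma s p q) (d : Gamma s g k') : Prop :=
  ∃ (ω : C(Δ₃, M)) (a' : Triangle s g h') (b' : Triangle s h k') (c' : Triangle s p q)
    (d' : Triangle s g k'), Gamma.mk a' = a ∧ Gamma.mk b' = b ∧ Gamma.mk c' = c ∧
    Gamma.mk d' = d ∧ ω.comp (face ![1, 2, 0]) = a'.1 ∧ ω.comp (face ![0, 2, 3]) = b'.1 ∧
    ω.comp (face ![1, 0, 3]) = c'.1 ∧ ω.comp (face ![1, 2, 3]) = d'.1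

/-- The point of the 2-simplex with given coordinates. -/
def pt (x y z : ℝ) (hx : 0 ≤ x) (hy : 0 ≤ y) (hz : 0 ≤ z) (h : x + y + z = 1) : Δ₂ :=
  ⟨![x, y, z], by intro i; fin_cases i <;> simpa, by simpa [Fin.sum_univ_three] using h⟩

theorem continuous_coe {n : ℕ} (i : Fin n) : Continuous fun p : stdSimplex ℝ (Fin n) => p i :=
  (continuous_apply i).comp continuous_subtype_val

theorem continuous_pt {Z : Type*} [TopologicalSpace Z] {x y z : Z → ℝ} (hx : ∀ w, 0 ≤ x w)
    (hy : ∀ w, 0 ≤ y w) (hz : ∀ w, 0 ≤ z w) (h : ∀ w, x w + y w + z w = 1)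
    (cx : Continuous x) (cy : Continuous y) (cz : Continuous z) :
    Continuous fun w => pt (x w) (y w) (z w) (hx w) (hy w) (hz w) (h w) := by
  refine Continuous.subtype_mk (continuous_pi fun i => ?_) _
  fin_cases i <;> assumption

/-- The projections of the 3-simplex used to extend a map from three faces. -/
def proj₁ (x : Δ₃) : Δ₂ :=
  pt (x 1 - min (x 1) (x 3)) (x 2 - min (x 2) (x 3)) (x 0 + x 3 + min (x 1) (x 3) + min (x 2) (x 3))
    (sub_nonneg.2 (min_le_left _ _)) (sub_nonneg.2 (min_le_left _ _))
    (by have := stdSimplex.zero_le x; have := le_min (this 1) (this 3)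
        have := le_min (stdSimplex.zero_le x 2) (stdSimplex.zero_le x 3)
        linarith [stdSimplex.zero_le x 0, stdSimplex.zero_le x 3])
    (by linarith [Δ₃.sum x])

/-- See `proj₁`. -/
def proj₂ (x : Δ₃) : Δ₂ :=
  pt (x 0 + x 1 + min (x 2) (x 1) + min (x 3) (x 1)) (x 2 - min (x 2) (x 1)) (x 3 - min (x 3) (x 1))
    (by have := le_min (stdSimplex.zero_le x 2) (stdSimplex.zero_le x 1)
        have := le_min (stdSimplex.zero_le x 3) (stdSimplex.zero_le x 1)
        linarith [stdSimplex.zero_le x 0, stdSimplex.zero_le x 1])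
    (sub_nonneg.2 (min_le_left _ _)) (sub_nonneg.2 (min_le_left _ _))
    (by linarith [Δ₃.sum x])

/-- See `proj₁`. -/
def proj₃ (x : Δ₃) : Δ₂ :=
  pt (x 1 - min (x 1) (x 2)) (x 0 + x 2 + min (x 1) (x 2) + min (x 3) (x 2)) (x 3 - min (x 3) (x 2))
    (sub_nonneg.2 (min_le_left _ _))
    (by have := le_min (stdSimplex.zero_le x 1) (stdSimplex.zero_le x 2)
        have := le_min (stdSimplex.zero_le x 3) (stdSimplex.zero_le x 2)
        linarith [stdSimplex.zero_le x 0, stdSimplex.zero_le x 2])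
    (sub_nonneg.2 (min_le_left _ _))
    (by linarith [Δ₃.sum x])

/-- Three singular 2-simplices with matching edges are faces of a singular 3-simplex whose fourth
face has the expected boundary. -/
theorem exists_fills {s : LoopSection M m₀} {g h' h k' p q : FundamentalGroup M m₀}
    (e₁ : h' = h⁻¹) (e₂ : p = h⁻¹ * g) (e₃ : q = k' * h) (a : Gamma s g h') (b : Gamma s h k')
    (c : Gamma s p q) : ∃ d, Fills a b c d := by
  obtain ⟨a, rfl⟩ := Quotient.exists_rep a
  obtain ⟨b, rfl⟩ := Quotient.exists_rep b
  obtain ⟨c, rfl⟩ := Quotient.exists_rep c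
  subst e₁ e₂ e₃
  have cc : ∀ i : Fin 4, Continuous fun p : Δ₃ => p i := continuous_coe
  have c0 := cc 0
  have c1 := cc 1
  have c2 := cc 2
  have c3 := cc 3
  have k1 : Continuous proj₁ := continuous_pt _ _ _ _ (c1.sub (c1.min c3)) (c2.sub (c2.min c3))
    (((c0.add c3).add (c1.min c3)).add (c2.min c3))
  have k2 : Continuous proj₂ := continuous_pt _ _ _ _
    (((c0.add c1).add (c2.min c1)).add (c3.min c1)) (c2.sub (c2.min c1)) (c3.sub (c3.min c1))
  have k3 : Continuous proj₃ := continuous_pt _ _ _ _ (c1.sub (c1.min c2))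
    (((c0.add c2).add (c1.min c2)).add (c3.min c2)) (c3.sub (c3.min c2))
  have hbc : ∀ x : Δ₃, x 1 = x 2 → b.1 (proj₂ x) = c.1 (proj₃ x) := fun x hx => by
    have e : x 3 - min (x 3) (x 1) = x 3 - min (x 3) (x 2) := by rw [hx]
    rw [b.2.2.2 (proj₂ x) (by change x 2 - min (x 2) (x 1) = 0; rw [hx]; simp),
      c.2.2.1 (proj₃ x) (by change x 1 - min (x 1) (x 2) = 0; rw [hx]; simp)]
    exact congrArg _ (Subtype.ext e)
  have hab : ∀ x : Δ₃, x 3 = x 1 → x 1 ≤ x 2 → a.1 (proj₁ x) = b.1 (proj₂ x) := fun x hx hx' => by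
    rw [a.2.2.1 (proj₁ x) (by change x 1 - min (x 1) (x 3) = 0; rw [hx]; simp),
      b.2.1 (proj₂ x) (by change x 3 - min (x 3) (x 1) = 0; rw [hx]; simp), loop_inv_apply]
    change x 0 + x 3 + min (x 1) (x 3) + min (x 2) (x 3) + (x 2 - min (x 2) (x 1)) = 1
    rw [hx, min_self, min_eq_right hx']
    linarith [Δ₃.sum x]
  have hac : ∀ x : Δ₃, x 3 = x 2 → x 2 ≤ x 1 → a.1 (proj₁ x) = c.1 (proj₃ x) := fun x hx hx' => by
    have e : x 0 + x 3 + min (x 1) (x 3) + min (x 2) (x 3) =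
      x 0 + x 2 + min (x 1) (x 2) + min (x 3) (x 2) := by rw [hx]
    rw [a.2.2.2 (proj₁ x) (by change x 2 - min (x 2) (x 3) = 0; rw [hx]; simp),
      c.2.1 (proj₃ x) (by change x 3 - min (x 3) (x 2) = 0; rw [hx]; simp)]
    exact congrArg _ (Subtype.ext e)
  let ω : C(Δ₃, M) := ⟨fun x => if x 3 ≤ min (x 1) (x 2) then a.1 (proj₁ x) else
    if x 1 ≤ x 2 then b.1 (proj₂ x) else c.1 (proj₃ x), by
    refine Continuous.if_le (by fun_prop) (Continuous.if_le (by fun_prop) (by fun_prop) c1 c2 hbc)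
      c3 (c1.min c2) fun x hx => ?_
    split_ifs with hx'
    · exact hab x (by rw [hx, min_eq_left hx']) hx'
    · exact hac x (by rw [hx, min_eq_right (not_le.1 hx').le]) (not_le.1 hx').le⟩
  have hω : ∀ x, ω x = if x 3 ≤ min (x 1) (x 2) then a.1 (proj₁ x) else
    if x 1 ≤ x 2 then b.1 (proj₂ x) else c.1 (proj₃ x) := fun x => rfl
  have ω1 : ∀ x, x 3 = 0 → ω x = a.1 (proj₁ x) := fun x hx => by
    rw [hω, if_pos]
    rw [hx]; exact le_min (stdSimplex.zero_le x 1) (stdSimplex.zero_le x 2)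
  have ω2 : ∀ x, x 1 = 0 → ω x = b.1 (proj₂ x) := fun x hx => by
    have h2 : x 1 ≤ x 2 := hx ▸ stdSimplex.zero_le x 2
    rw [hω, if_pos h2]
    split_ifs with h3
    · refine hab x (le_antisymm (h3.trans (min_le_left _ _)) ?_) h2
      rw [hx]; exact stdSimplex.zero_le x 3
    · rfl
  have ω3 : ∀ x, x 2 = 0 → ω x = c.1 (proj₃ x) := fun x hx => by
    have h2 : x 2 ≤ x 1 := hx ▸ stdSimplex.zero_le x 1
    rw [hω]
    split_ifs with h3 h4
    · refine hac x (le_antisymm (h3.trans (min_le_right _ _)) ?_) h2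
      rw [hx]; exact stdSimplex.zero_le x 3
    · exact hbc x (le_antisymm h4 h2)
    · rfl
  have hpt : ∀ {x y z : ℝ} {hx hy hz hs} {r : Δ₂}, x = r 0 → y = r 1 → z = r 2 →
      pt x y z hx hy hz hs = r := fun h0 h1 h2 => by
    subst h0 h1 h2
    ext i
    fin_cases i <;> rfl
  have fa : ω.comp (face ![1, 2, 0]) = a.1 := by
    ext r
    rw [ContinuousMap.comp_apply, ω1 _ (by simp [face_apply])]
    exact congrArg a.1 (hpt (by simp [face_apply]) (by simp [face_apply])
      (by simp [face_apply]))
  have fb : ω.comp (face ![0, 2, 3]) = b.1 := by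
    ext r
    rw [ContinuousMap.comp_apply, ω2 _ (by simp [face_apply])]
    exact congrArg b.1 (hpt (by simp [face_apply]) (by simp [face_apply])
      (by simp [face_apply]))
  have fc : ω.comp (face ![1, 0, 3]) = c.1 := by
    ext r
    rw [ContinuousMap.comp_apply, ω3 _ (by simp [face_apply])]
    exact congrArg c.1 (hpt (by simp [face_apply]) (by simp [face_apply])
      (by simp [face_apply]))
  refine ⟨Gamma.mk ⟨ω.comp (face ![1, 2, 3]), fun r hr => ?_, fun r hr => ?_, fun r hr => ?_⟩,
    ω, a, b, c, _, rfl, rfl, rfl, rfl, fa, fb, fc, rfl⟩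
  · rw [ContinuousMap.comp_apply, ω1 _ (by simp [face_apply, hr])]
    have e : proj₁ (face ![1, 2, 3] r) = r := hpt (by simp [face_apply, hr])
      (by simp [face_apply, hr]) (by simp [face_apply, hr])
    rw [e, a.2.1 r hr]
  · rw [ContinuousMap.comp_apply, ω2 _ (by simp [face_apply, hr])]
    have e : proj₂ (face ![1, 2, 3] r) = r := hpt (by simp [face_apply, hr])
      (by simp [face_apply, hr]) (by simp [face_apply, hr])
    rw [e, b.2.2.1 r hr]
  · rw [ContinuousMap.comp_apply, ω3 _ (by simp [face_apply, hr])]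
    have e : proj₃ (face ![1, 2, 3] r) = r := hpt (by simp [face_apply, hr])
      (by simp [face_apply, hr]) (by simp [face_apply, hr])
    rw [e, c.2.2.2 r hr]
    congr 2
    group

/-- The operations of `Γ(M)`. The tri-product `m(a, b, c)` is the class of the fourth face of a
singular 3-simplex with faces `a`, `b`, `c`. -/
def gammaData (s : LoopSection M m₀) : DeltaData.{u, u} (FundamentalGroup M m₀) where
  T g h := Gamma s g h
  m e₁ e₂ e₃ a b c := Classical.choose (exists_fills e₁ e₂ e₃ a b c)
  P a := a.P
  Q a := a.Q

/-- The smallest barycentric coordinate. -/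
def minCoord (p : Δ₂) : ℝ := min (p 0) (min (p 1) (p 2))

/-- The coordinates on the square `1/8 ≤ p₁, p₂ ≤ 3/8` in the interior of the 2-simplex, extended by
truncation. -/
def bubbleSquare (p : Δ₂) : Fin 2 → I := fun i => trunc (4 * p i.succ - 1 / 2)

/-- A self-map of the 2-simplex that is the identity on the boundary and sends all points with
coordinates at least `1/8` to the vertex `[0]`; every point moves on the segment to `[0]`. -/
def pinch (p : Δ₂) : Δ₂ :=
  pt (p 0 + min (8 * minCoord p) 1 * (1 - p 0)) ((1 - min (8 * minCoord p) 1) * p 1)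
    ((1 - min (8 * minCoord p) 1) * p 2)
    (by
      have h0 := stdSimplex.zero_le p 0
      have h1 := stdSimplex.le_one p 0
      have : 0 ≤ minCoord p := le_min h0 (le_min (stdSimplex.zero_le p 1) (stdSimplex.zero_le p 2))
      have : 0 ≤ min (8 * minCoord p) 1 := le_min (by linarith) (by norm_num)
      nlinarith)
    (mul_nonneg (sub_nonneg.2 (min_le_right _ _)) (stdSimplex.zero_le p 1))
    (mul_nonneg (sub_nonneg.2 (min_le_right _ _)) (stdSimplex.zero_le p 2))
    (by linear_combination (1 - min (8 * minCoord p) 1) * Δ₂.sum p)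

theorem continuous_minCoord : Continuous minCoord := by
  have h : ∀ i : Fin 3, Continuous fun p : Δ₂ => p i := continuous_coe
  exact (h 0).min ((h 1).min (h 2))

theorem continuous_pinch : Continuous pinch := by
  have hm : Continuous fun p => min (8 * minCoord p) 1 :=
    (continuous_const.mul continuous_minCoord).min continuous_const
  have h : ∀ i : Fin 3, Continuous fun p : Δ₂ => p i := continuous_coe
  exact continuous_pt _ _ _ _ ((h 0).add (hm.mul (continuous_const.sub (h 0))))
    ((continuous_const.sub hm).mul (h 1)) ((continuous_const.sub hm).mul (h 2))

theorem continuous_bubbleSquare : Continuous bubbleSquare := by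
  have h : ∀ i : Fin 3, Continuous fun p : Δ₂ => p i := continuous_coe
  exact continuous_pi fun i =>
    continuous_projIcc.comp ((continuous_const.mul (h i.succ)).sub continuous_const)

theorem minCoord_eq_zero {p : Δ₂} (hp : p ∈ bdry) : minCoord p = 0 := by
  refine le_antisymm ?_ (le_min (stdSimplex.zero_le p 0)
    (le_min (stdSimplex.zero_le p 1) (stdSimplex.zero_le p 2)))
  obtain ⟨i, hi⟩ := hp
  fin_cases i <;> simp only [Fin.zero_eta, Fin.mk_one, Fin.reduceFinMk] at hi <;>
    simp [minCoord, hi]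

theorem pinch_of_mem_bdry {p : Δ₂} (hp : p ∈ bdry) : pinch p = p := by
  ext i
  fin_cases i
  · change p 0 + min (8 * minCoord p) 1 * (1 - p 0) = p 0
    simp [minCoord_eq_zero hp]
  · change (1 - min (8 * minCoord p) 1) * p 1 = p 1
    simp [minCoord_eq_zero hp]
  · change (1 - min (8 * minCoord p) 1) * p 2 = p 2
    simp [minCoord_eq_zero hp]

theorem pinch_of_le {p : Δ₂} (hp : 1 / 8 ≤ minCoord p) : pinch p = stdSimplex.vertex 0 := by
  have h : min (8 * minCoord p) 1 = 1 := min_eq_right (by linarith)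
  ext i
  fin_cases i
  · change p 0 + min (8 * minCoord p) 1 * (1 - p 0) = 1
    rw [h]; ring
  · change (1 - min (8 * minCoord p) 1) * p 1 = 0
    rw [h]; ring
  · change (1 - min (8 * minCoord p) 1) * p 2 = 0
    rw [h]; ring

theorem bubbleSquare_mem {p : Δ₂} (hp : minCoord p = 1 / 8) :
    bubbleSquare p ∈ Cube.boundary (Fin 2) := by
  have h : minCoord p ≤ 1 / 8 := hp.le
  simp only [minCoord, min_le_iff] at h
  rcases h with h | h | h
  · rcases le_total (p 1) (p 2) with h' | h'
    · exact ⟨1, .inr (trunc_of_ge (by change 1 ≤ 4 * p 2 - 1 / 2; linarith [Δ₂.sum p]))⟩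
    · exact ⟨0, .inr (trunc_of_ge (by change 1 ≤ 4 * p 1 - 1 / 2; linarith [Δ₂.sum p]))⟩
  · exact ⟨0, .inl (trunc_of_le (by change 4 * p 1 - 1 / 2 ≤ 0; linarith))⟩
  · exact ⟨1, .inl (trunc_of_le (by change 4 * p 2 - 1 / 2 ≤ 0; linarith))⟩

theorem Triangle.vertex_zero {s : LoopSection M m₀} {g h : FundamentalGroup M m₀}
    (x : Triangle s g h) : x.1 (stdSimplex.vertex 0) = m₀ := by
  rw [x.2.1 _ (by simp)]
  have e : coord (stdSimplex.vertex (S := ℝ) (0 : Fin 3)) 1 = 0 := Subtype.ext (by simp [coord])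
  rw [e, Path.source]

/-- The singular 2-simplex `x` with the sphere `a` glued in at the corner `[0]`: the interior points
with coordinates at least `1/8` are mapped by `a`, the rest by `x` after stretching it over the
whole simplex. -/
def bubbleTriangle {s : LoopSection M m₀} {g h : FundamentalGroup M m₀} (a : Ω^ (Fin 2) M m₀)
    (x : Triangle s g h) : Triangle s g h :=
  ⟨⟨fun p => if 1 / 8 ≤ minCoord p then a (bubbleSquare p) else x.1 (pinch p), by
      refine Continuous.if_le (a.1.continuous.comp continuous_bubbleSquare)
        (x.1.continuous.comp continuous_pinch) continuous_const continuous_minCoord fun p hp => ?_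
      rw [pinch_of_le hp.le, x.vertex_zero, GenLoop.boundary a _ (bubbleSquare_mem hp.symm)]⟩, by
    have e : ∀ p ∈ bdry, (if 1 / 8 ≤ minCoord p then a (bubbleSquare p) else x.1 (pinch p)) =
        x.1 p := fun p hp => by
      rw [if_neg (by rw [minCoord_eq_zero hp]; norm_num), pinch_of_mem_bdry hp]
    exact ⟨fun p hp => (e p ⟨2, hp⟩).trans (x.2.1 p hp),
      fun p hp => (e p ⟨0, hp⟩).trans (x.2.2.1 p hp),
      fun p hp => (e p ⟨1, hp⟩).trans (x.2.2.2 p hp)⟩⟩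

theorem bubbleTriangle_homotopic {s : LoopSection M m₀} {g h : FundamentalGroup M m₀}
    {a b : Ω^ (Fin 2) M m₀} (hab : GenLoop.Homotopic a b) {x y : Triangle s g h}
    (hxy : x.1.HomotopicRel y.1 bdry) :
    (bubbleTriangle a x).1.HomotopicRel (bubbleTriangle b y).1 bdry := by
  obtain ⟨H⟩ := hab
  obtain ⟨K⟩ := hxy
  have c1 := continuous_bubbleSquare
  have c2 := continuous_pinch
  have c3 := continuous_minCoord
  refine ⟨⟨⟨⟨fun w => if 1 / 8 ≤ minCoord w.2 then H (w.1, bubbleSquare w.2)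
    else K (w.1, pinch w.2), ?_⟩, fun p => ?_, fun p => ?_⟩, fun t p hp => ?_⟩⟩
  · refine Continuous.if_le (by fun_prop) (by fun_prop) (by fun_prop) (by fun_prop) fun w hw => ?_
    rw [pinch_of_le hw.le, K.eq_fst _ ⟨1, by simp⟩, H.eq_fst _ (bubbleSquare_mem hw.symm),
      x.vertex_zero]
    exact a.2 _ (bubbleSquare_mem hw.symm)
  · simp only [K.apply_zero, H.apply_zero]
    rfl
  · simp only [K.apply_one, H.apply_one]
    rfl
  · have e : ¬ 1 / 8 ≤ minCoord p := by rw [minCoord_eq_zero hp]; norm_num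
    change (if 1 / 8 ≤ minCoord p then H (t, bubbleSquare p) else K (t, pinch p)) =
      if 1 / 8 ≤ minCoord p then a (bubbleSquare p) else x.1 (pinch p)
    rw [if_neg e, if_neg e, pinch_of_mem_bdry hp, K.eq_fst t hp]

/-- The class of the singular 2-simplex `x` with the element `a` of `π₂(M, m₀)` glued in at the
corner `[0]`. -/
def bubble {s : LoopSection M m₀} {g h : FundamentalGroup M m₀} (a : PiTwo M m₀)
    (x : Gamma s g h) : Gamma s g h :=
  Quotient.map₂ (sa := GenLoop.Homotopic.setoid (Fin 2) m₀) (sb := triangleSetoid s g h)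
    (sc := triangleSetoid s g h) bubbleTriangle
    (fun _ _ hab _ _ hxy => bubbleTriangle_homotopic hab hxy) a x

/-- A choice of base elements `x(g, h) ∈ Γ(g, h)` compatible with `P` and `Q`. -/
structure BaseElements (s : LoopSection M m₀) where
  elt : ∀ g h, Gamma s g h
  P_elt : ∀ g h, (elt g h).P = elt h (g⁻¹ * h⁻¹)
  Q_elt : ∀ g h, (elt g h).Q = elt g⁻¹ (h * g)

/-- `α` is the 3-cochain of the base elements `x`: the product of `x(g, h⁻¹)`, `x(h, k⁻¹)` and
`x(h⁻¹g, k⁻¹h)` is `x(g, k⁻¹)` with the element `y(g, h, k) = α(g⁻¹h, h⁻¹k, k⁻¹)` of `π₂(M, m₀)`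
glued in at the corner `[0]`. -/
def BaseElements.IsCochain {s : LoopSection M m₀} (x : BaseElements s)
    (α : FundamentalGroup M m₀ → FundamentalGroup M m₀ → FundamentalGroup M m₀ → PiTwo M m₀) :
    Prop :=
  ∀ g h k : FundamentalGroup M m₀,
    (gammaData s).m rfl rfl rfl (x.elt g h⁻¹) (x.elt h k⁻¹) (x.elt (h⁻¹ * g) (k⁻¹ * h)) =
      bubble (α (g⁻¹ * h) (h⁻¹ * k) k⁻¹) (x.elt g k⁻¹)

end Gamma

end DeltaGrp

end

open DeltaGrp

/-! Everything rests on one extension principle. Subtracting the smallest of the coordinates other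
than coordinate 0 from each of them, and adding the total to coordinate 0, retracts a simplex onto
the union of its faces through [0]. Hence continuous families of maps on these faces that agree on
overlaps extend to the simplex (`exists_horn_extension`). In dimension three this yields products.
Applied to homotopies of three faces, it shows that the fourth face is unique up to homotopy
(`Fills.unique`), so the tri-product is well defined. In dimension four it yields the associativity
axiom `m_m`. The remaining axioms only permute the vertices of one triangle or one tetrahedron
(`gammaData_isDeltaGroup`).

The next point is that π₂ acts simply transitively on every Γ(g, h) by gluing spheres. A sphere
inserted into a 3-simplex along the fibres of a projection to a triangle appears in two faces and
leaves the other two unchanged; this moves spheres through products. Moving a sphere to another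
corner transports it along an edge, which is where the action of π₁ enters (`bubble_P`, `bubble_Q`,
`m_bubble_middle`). For the constant triangle, comparison of a square with a triangle identifies π₂
with Γ(1, 1); products with degenerate triangles carry this to all g and h (`bubble_injective`,
`exists_bubble`, `bubble_add`).

Relative to base elements, each element of Γ(g, h) therefore has one coordinate in π₂, and
`gmul_bubble`, `bubble_P` and `bubble_Q` say that in these coordinates the operations are those of
T(π₁, π₂, α). So T(π₁, π₂, α) inherits the axioms from Γ(M), and the axioms evaluated on zeros are
the symmetries of α and the cocycle identity (`mem_ZS₃_of_isDeltaGroup`).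

Torsion is an obstruction to the choices only. An element of order two could obstruct loops
compatible with inversion. For base elements the symmetric group of the vertices acts on labels of
edges. Without elements of order two or three, a permutation that fixes the labels moves vertices
only along edges with label 1, and then a suitable degenerate triangle is fixed as a map
(`exists_hasLabels`).

For invariance, homotopies from f ∘ s(g) to s'(φ g), with base point travelling along γ, are chosen
compatibly with inversion. Moving triangles along them (`Prism`) is well defined on classes and
respects P, Q, products and the gluing of spheres. The difference in π₂ between the image of x(g, h)
and x'(φ g, φ h) is a symmetric 2-cochain because of P and Q, and its coboundary is the difference
of the two cocycles because of the product (`cochainCongr_sub_mem_BS₃`). Independence of choices is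
the case of the identity map and the constant path. -/

noncomputable section

namespace DeltaGrp

universe u v w

/-! ### Affine maps and straight lines in simplices -/

section Simplex

variable {M : Type*} [TopologicalSpace M]

/-- The affine map of standard simplices induced by a map of vertices. -/
def smap {m n : ℕ} (f : Fin m → Fin n) : C(stdSimplex ℝ (Fin m), stdSimplex ℝ (Fin n)) :=
  ⟨stdSimplex.map f, stdSimplex.continuous_map f⟩

theorem smap_apply {m n : ℕ} (f : Fin m → Fin n) (p : stdSimplex ℝ (Fin m)) (j : Fin n) :
    smap f p j = ∑ i, if f i = j then p i else 0 := by
  simp [smap, FunOnFinite.linearMap_apply_apply, Finset.sum_filter]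

theorem smap_face {m n : ℕ} (g : Fin m → Fin n) (f : Fin 3 → Fin m) (p : Δ₂) :
    smap g (face f p) = face (g ∘ f) p :=
  stdSimplex.map_comp_apply f g p

theorem smap_comp_face {m n : ℕ} (g : Fin m → Fin n) (f : Fin 3 → Fin m) :
    (smap g).comp (face f) = face (g ∘ f) :=
  ContinuousMap.ext fun p => smap_face g f p

theorem face_comp_face {n : ℕ} (g : Fin 3 → Fin n) (f : Fin 3 → Fin 3) :
    (face g).comp (face f) = face (g ∘ f) :=
  smap_comp_face g f

theorem face_id (p : Δ₂) : face ![0, 1, 2] p = p := by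
  have : (![0, 1, 2] : Fin 3 → Fin 3) = id := by decide
  rw [this]
  exact stdSimplex.map_id_apply p

theorem Δ₂_ext {p q : Δ₂} (h0 : p 0 = q 0) (h1 : p 1 = q 1) (h2 : p 2 = q 2) : p = q := by
  ext i; fin_cases i <;> assumption

theorem continuous_simplex_mk {Z : Type*} [TopologicalSpace Z] {n : ℕ}
    {f : Z → stdSimplex ℝ (Fin n)} (h : ∀ i, Continuous fun z => f z i) : Continuous f :=
  continuous_induced_rng.2 (continuous_pi h)

@[fun_prop]
theorem continuous_simplex_apply {Z : Type*} [TopologicalSpace Z] {n : ℕ}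
    {f : Z → stdSimplex ℝ (Fin n)} (h : Continuous f) (i : Fin n) : Continuous fun z => f z i :=
  (continuous_coe i).comp h

@[fun_prop]
theorem continuous_coord {Z : Type*} [TopologicalSpace Z] {n : ℕ}
    {f : Z → stdSimplex ℝ (Fin n)} (h : Continuous f) (i : Fin n) :
    Continuous fun z => coord (f z) i :=
  Continuous.subtype_mk (continuous_simplex_apply h i) _

/-- The point dividing the segment from `p` to `q` in the ratio `t : 1 - t`. -/
def lerp {n : ℕ} (t : I) (p q : stdSimplex ℝ (Fin n)) : stdSimplex ℝ (Fin n) :=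
  ⟨fun i => (1 - t) * p i + t * q i,
    fun i => add_nonneg (mul_nonneg (by linarith [t.2.2]) (stdSimplex.zero_le p i))
      (mul_nonneg t.2.1 (stdSimplex.zero_le q i)),
    by rw [Finset.sum_add_distrib, ← Finset.mul_sum, ← Finset.mul_sum, stdSimplex.sum_eq_one,
        stdSimplex.sum_eq_one]; ring⟩

theorem lerp_apply {n : ℕ} (t : I) (p q : stdSimplex ℝ (Fin n)) (i : Fin n) :
    lerp t p q i = (1 - t) * p i + t * q i := rfl

@[fun_prop]
theorem continuous_lerp {Z : Type*} [TopologicalSpace Z] {n : ℕ} {t : Z → I}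
    {p q : Z → stdSimplex ℝ (Fin n)} (ht : Continuous t) (hp : Continuous p) (hq : Continuous q) :
    Continuous fun z => lerp (t z) (p z) (q z) := by
  refine continuous_simplex_mk fun i => ?_
  simp only [lerp_apply]
  fun_prop

theorem lerp_zero {n : ℕ} (p q : stdSimplex ℝ (Fin n)) : lerp 0 p q = p := by
  ext i; simp [lerp_apply]

theorem lerp_one {n : ℕ} (p q : stdSimplex ℝ (Fin n)) : lerp 1 p q = q := by
  ext i; simp [lerp_apply]

theorem lerp_self {n : ℕ} (t : I) (p : stdSimplex ℝ (Fin n)) : lerp t p p = p := by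
  ext i; rw [lerp_apply]; ring

/-- Maps into a simplex that agree on a set are homotopic relative to it along straight lines. -/
theorem homotopicRel_comp_of_eqOn {X : Type*} [TopologicalSpace X] {n : ℕ} {S : Set X}
    (ω : C(stdSimplex ℝ (Fin n), M)) {f g : C(X, stdSimplex ℝ (Fin n))}
    (h : ∀ x ∈ S, f x = g x) : (ω.comp f).HomotopicRel (ω.comp g) S := by
  refine ⟨⟨⟨⟨fun w => ω (lerp w.1 (f w.2) (g w.2)), by fun_prop⟩, fun x => ?_, fun x => ?_⟩,
    fun t x hx => ?_⟩⟩
  · simp [lerp_zero]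
  · simp [lerp_one]
  · simp [h x hx, lerp_self]

/-! ### Filling horns -/

/-- The smallest coordinate of a point of the simplex, except for the coordinate `0`. -/
def minTail {n : ℕ} [NeZero n] (x : stdSimplex ℝ (Fin (n + 1))) : ℝ :=
  Finset.univ.inf' ⟨0, Finset.mem_univ _⟩ fun i : Fin n => x i.succ

variable {n : ℕ} [NeZero n]

theorem minTail_le (x : stdSimplex ℝ (Fin (n + 1))) (i : Fin n) : minTail x ≤ x i.succ :=
  Finset.inf'_le _ (Finset.mem_univ i)

theorem minTail_nonneg (x : stdSimplex ℝ (Fin (n + 1))) : 0 ≤ minTail x :=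
  (Finset.le_inf'_iff _ _).2 fun i _ => stdSimplex.zero_le x i.succ

theorem minTail_eq {x : stdSimplex ℝ (Fin (n + 1))} {k : Fin n}
    (h : ∀ l : Fin n, x k.succ ≤ x l.succ) : minTail x = x k.succ :=
  le_antisymm (minTail_le x k) ((Finset.le_inf'_iff _ _).2 fun l _ => h l)

theorem exists_minTail (x : stdSimplex ℝ (Fin (n + 1))) :
    ∃ k : Fin n, ∀ l : Fin n, x k.succ ≤ x l.succ :=
  Finite.exists_min fun i : Fin n => x i.succ

theorem continuous_minTail : Continuous (minTail : stdSimplex ℝ (Fin (n + 1)) → ℝ) :=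
  Continuous.finset_inf'_apply _ fun i _ => continuous_coe i.succ

/-- The retraction of the simplex onto the union of the faces that contain the vertex `[0]`. -/
def hornRetract (x : stdSimplex ℝ (Fin (n + 1))) : stdSimplex ℝ (Fin (n + 1)) :=
  ⟨Fin.cons (x 0 + n * minTail x) fun i => x i.succ - minTail x, by
    intro i
    refine Fin.cases ?_ (fun j => ?_) i
    · exact add_nonneg (stdSimplex.zero_le x 0) (mul_nonneg n.cast_nonneg (minTail_nonneg x))
    · exact sub_nonneg.2 (minTail_le x j), by
    rw [Fin.sum_univ_succ]
    have := stdSimplex.sum_eq_one x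
    rw [Fin.sum_univ_succ] at this
    simp only [Fin.cons_zero, Fin.cons_succ, Finset.sum_sub_distrib, Finset.sum_const,
      Finset.card_univ, Fintype.card_fin, nsmul_eq_mul]
    linarith⟩

theorem hornRetract_zero (x : stdSimplex ℝ (Fin (n + 1))) :
    hornRetract x 0 = x 0 + n * minTail x := rfl

theorem hornRetract_succ (x : stdSimplex ℝ (Fin (n + 1))) (i : Fin n) :
    hornRetract x i.succ = x i.succ - minTail x := rfl

theorem hornRetract_eq {x : stdSimplex ℝ (Fin (n + 1))} {k : Fin n} (h : x k.succ = 0) :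
    hornRetract x = x := by
  have e : minTail x = 0 := by
    rw [minTail_eq (k := k) fun l => by rw [h]; exact stdSimplex.zero_le x _, h]
  ext i
  refine Fin.cases ?_ (fun j => ?_) i
  · rw [hornRetract_zero, e, mul_zero, add_zero]
  · rw [hornRetract_succ, e, sub_zero]

theorem continuous_hornRetract :
    Continuous (hornRetract : stdSimplex ℝ (Fin (n + 1)) → stdSimplex ℝ (Fin (n + 1))) := by
  have := continuous_minTail (n := n)
  refine continuous_simplex_mk fun i => ?_
  refine Fin.cases ?_ (fun j => ?_) i
  · simp only [hornRetract_zero]; fun_prop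
  · simp only [hornRetract_succ]; fun_prop

/-- Continuous families of maps on the faces of a simplex that contain the vertex `[0]`, which agree
on common faces, extend to the simplex. -/
theorem exists_horn_extension {Z : Type*} [TopologicalSpace Z]
    (W : Fin n → C(Z × stdSimplex ℝ (Fin (n + 1)), M))
    (hW : ∀ k l, k < l → ∀ z y, y k.succ = 0 → y l.succ = 0 → W k (z, y) = W l (z, y)) :
    ∃ Ψ : C(Z × stdSimplex ℝ (Fin (n + 1)), M),
      (∀ z x, Ψ (z, hornRetract x) = Ψ (z, x)) ∧
      ∀ k z x, x k.succ = 0 → Ψ (z, x) = W k (z, x) := by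
  have hW' : ∀ k l z y, y k.succ = 0 → y l.succ = 0 → W k (z, y) = W l (z, y) := by
    intro k l z y hk hl
    rcases lt_trichotomy k l with h | rfl | h
    · exact hW k l h z y hk hl
    · rfl
    · exact (hW l k h z y hl hk).symm
  choose κ hκ using exists_minTail (n := n)
  -- The choice of `κ` is harmless: where two coordinates are both minimal, the retracted point lies
  -- on both faces, and there the given maps agree. Continuity then follows from the finite closed
  -- cover by the sets on which a given coordinate is minimal.
  let F : Z × stdSimplex ℝ (Fin (n + 1)) → M := fun w => W (κ w.2) (w.1, hornRetract w.2)
  have hF : ∀ (k : Fin n) (z) (x), (∀ l : Fin n, x k.succ ≤ x l.succ) →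
      F (z, x) = W k (z, hornRetract x) := fun k z x hk => by
    refine hW' _ _ _ _ ?_ ?_
    · rw [hornRetract_succ, minTail_eq (hκ x), sub_self]
    · rw [hornRetract_succ, minTail_eq hk, sub_self]
  have hF0 : ∀ (k : Fin n) (z) (x), x k.succ = 0 → F (z, x) = W k (z, x) := fun k z x hk => by
    rw [hF k z x fun l => by rw [hk]; exact stdSimplex.zero_le x _, hornRetract_eq hk]
  have hc : Continuous F := by
    refine (locallyFinite_of_finite fun k : Fin n =>
      {w : Z × stdSimplex ℝ (Fin (n + 1)) | ∀ l : Fin n, w.2 k.succ ≤ w.2 l.succ}).continuous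
      ?_ (fun k => ?_) fun k => ?_
    · exact Set.eq_univ_of_forall fun w => Set.mem_iUnion.2 ⟨κ w.2, hκ w.2⟩
    · simp only [Set.ofPred_forall]
      exact isClosed_iInter fun l => isClosed_le (by fun_prop) (by fun_prop)
    · have : Continuous fun w : Z × stdSimplex ℝ (Fin (n + 1)) => W k (w.1, hornRetract w.2) := by
        have := continuous_hornRetract (n := n)
        fun_prop
      exact this.continuousOn.congr fun w hw => hF k w.1 w.2 hw
  refine ⟨⟨F, hc⟩, fun z x => ?_, hF0⟩
  change F _ = F _
  have h0 : hornRetract x (κ x).succ = 0 := by rw [hornRetract_succ, minTail_eq (hκ x), sub_self]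
  rw [hF0 (κ x) z _ h0]

end Simplex

/-! ### Filling three faces of a 3-simplex, with parameters -/

section Fill

variable {G : Type*} [Group G] {Z : Type*} [TopologicalSpace Z] {N : Type*} [TopologicalSpace N]
variable {M : Type u} [TopologicalSpace M] {m₀ : M}

/-- Points of a simplex whose coordinates vanish outside the vertices of a face are in the face. -/
theorem exists_face {n : ℕ} {f : Fin 3 → Fin n} (hf : Function.Injective f)
    {y : stdSimplex ℝ (Fin n)} (h : ∀ j, (∀ i, f i ≠ j) → y j = 0) : ∃ q, face f q = y := by
  have hs : ∑ i, y (f i) = 1 := by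
    rw [← stdSimplex.sum_eq_one y]
    refine Finset.sum_of_injOn f hf.injOn (by simp) (fun j _ hj => h j fun i hi => ?_)
      (fun _ _ => rfl)
    exact hj ⟨i, by simp, hi⟩
  refine ⟨⟨fun i => y (f i), fun i => stdSimplex.zero_le y _, hs⟩, ?_⟩
  ext j
  have e : ∀ i, (⟨fun i => y (f i), fun i => stdSimplex.zero_le y _, hs⟩ : Δ₂) i = y (f i) :=
    fun _ => rfl
  rw [face_apply, e, e, e]
  by_cases hj : ∃ i, f i = j
  · obtain ⟨i, rfl⟩ := hj
    simp only [hf.eq_iff]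
    fin_cases i <;> simp
  · push Not at hj
    simp [hj, h j hj]

/-- A family of edges, labelled by `G`, in which inverse labels belong to reversed edges. -/
def IsReversible (e : G → Z → I → N) : Prop :=
  ∀ g z (t t' : I), (t : ℝ) + t' = 1 → e g⁻¹ z t = e g z t'

/-- A family of singular 2-simplices with edges from the family `e`, labelled by `g`, `h` and
`h * g`. -/
def IsTri (e : G → Z → I → N) (g h : G) (A : C(Z × Δ₂, N)) : Prop :=
  (∀ z p, p 2 = 0 → A (z, p) = e g z (coord p 1)) ∧
    (∀ z p, p 0 = 0 → A (z, p) = e h z (coord p 2)) ∧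
    ∀ z p, p 1 = 0 → A (z, p) = e (h * g) z (coord p 2)

/-- The restriction of a family of singular simplices to a face. -/
def faceFamily {n : ℕ} (A : C(Z × stdSimplex ℝ (Fin n), N)) (f : Fin 3 → Fin n) : C(Z × Δ₂, N) :=
  A.comp ((ContinuousMap.id Z).prodMap (face f))

theorem faceFamily_apply {n : ℕ} (A : C(Z × stdSimplex ℝ (Fin n), N)) (f : Fin 3 → Fin n) (z : Z)
    (p : Δ₂) : faceFamily A f (z, p) = A (z, face f p) := rfl

/-- The composition of a family of singular 2-simplices with an affine map onto the 2-simplex. -/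
def pullFamily {n : ℕ} (A : C(Z × Δ₂, N)) (f : Fin n → Fin 3) : C(Z × stdSimplex ℝ (Fin n), N) :=
  A.comp ((ContinuousMap.id Z).prodMap (smap f))

/-- Three families of singular 2-simplices with matching edges are faces of a family of singular
3-simplices. -/
theorem exists_fill_family {e : G → Z → I → N} (he : IsReversible e) {g h' h k' p q : G}
    (e₁ : h' = h⁻¹) (e₂ : p = h⁻¹ * g) (e₃ : q = k' * h) {A B C : C(Z × Δ₂, N)}
    (hA : IsTri e g h' A) (hB : IsTri e h k' B) (hC : IsTri e p q C) :
    ∃ Ψ : C(Z × Δ₃, N), (∀ z x, Ψ (z, hornRetract x) = Ψ (z, x)) ∧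
      faceFamily Ψ ![1, 2, 0] = A ∧ faceFamily Ψ ![0, 2, 3] = B ∧ faceFamily Ψ ![1, 0, 3] = C ∧
      IsTri e g k' (faceFamily Ψ ![1, 2, 3]) := by
  subst e₁ e₂ e₃
  -- Each family is first pulled back to the whole 3-simplex along a left inverse of its face map on
  -- vertices: `![0, 0, 1, 2]` inverts `![0, 2, 3]`, `![1, 0, 1, 2]` inverts `![1, 0, 3]` and `![2,
  -- 0, 1, 2]` inverts `![1, 2, 0]`. The image of the omitted vertex is arbitrary, since only the
  -- values on the respective face matter.
  obtain ⟨Ψ, hr, hΨ⟩ := exists_horn_extension (n := 3)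
    ![pullFamily B ![0, 0, 1, 2], pullFamily C ![1, 0, 1, 2], pullFamily A ![2, 0, 1, 2]] (by
      intro k l hkl z y hk hl
      have sA : ∀ i, smap ![2, 0, 1, (2 : Fin 3)] y i = ![y 1, y 2, y 0 + y 3] i := fun i => by
        fin_cases i <;> simp [smap_apply, Fin.sum_univ_four]
      have sB : ∀ i, smap ![0, 0, 1, (2 : Fin 3)] y i = ![y 0 + y 1, y 2, y 3] i := fun i => by
        fin_cases i <;> simp [smap_apply, Fin.sum_univ_four]
      have sC : ∀ i, smap ![1, 0, 1, (2 : Fin 3)] y i = ![y 1, y 0 + y 2, y 3] i := fun i => by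
        fin_cases i <;> simp [smap_apply, Fin.sum_univ_four]
      have hs := Δ₃.sum y
      obtain ⟨rfl, rfl⟩ | ⟨rfl, rfl⟩ | ⟨rfl, rfl⟩ :
          k = 0 ∧ l = 1 ∨ k = 0 ∧ l = 2 ∨ k = 1 ∧ l = 2 := by
        clear hk hl; revert hkl; revert k l; decide
      · replace hk : y 1 = 0 := hk
        replace hl : y 2 = 0 := hl
        change B (z, smap _ y) = C (z, smap _ y)
        rw [hB.2.2 _ _ (by rw [sB]; exact hl), hC.2.1 _ _ (by rw [sC]; exact hk)]
        congr 1
        exact coord_congr (by rw [sB, sC]; rfl)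
      · replace hk : y 1 = 0 := hk
        replace hl : y 3 = 0 := hl
        change B (z, smap _ y) = A (z, smap _ y)
        rw [hB.1 _ _ (by rw [sB]; exact hl), hA.2.1 _ _ (by rw [sA]; exact hk)]
        refine (he _ _ _ _ ?_).symm
        change smap ![2, 0, 1, (2 : Fin 3)] y 2 + smap ![0, 0, 1, (2 : Fin 3)] y 1 = 1
        rw [sA, sB]
        change y 0 + y 3 + y 2 = 1
        linarith
      · replace hk : y 2 = 0 := hk
        replace hl : y 3 = 0 := hl
        change C (z, smap _ y) = A (z, smap _ y)
        rw [hC.1 _ _ (by rw [sC]; exact hl), hA.2.2 _ _ (by rw [sA]; exact hk)]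
        congr 1
        refine coord_congr ?_
        rw [sA, sC]
        change y 0 + y 2 = y 0 + y 3
        rw [hk, hl])
  have fA : ∀ z x, x 3 = 0 → Ψ (z, x) = A (z, smap ![2, 0, 1, 2] x) := fun z x hx => hΨ 2 z x hx
  have fB : ∀ z x, x 1 = 0 → Ψ (z, x) = B (z, smap ![0, 0, 1, 2] x) := fun z x hx => hΨ 0 z x hx
  have fC : ∀ z x, x 2 = 0 → Ψ (z, x) = C (z, smap ![1, 0, 1, 2] x) := fun z x hx => hΨ 1 z x hx
  refine ⟨Ψ, hr, ?_, ?_, ?_, fun z p hp => ?_, fun z p hp => ?_, fun z p hp => ?_⟩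
  · ext ⟨z, p⟩
    rw [faceFamily_apply, fA _ _ (by simp [face_apply]), smap_face]
    exact congrArg (fun q => A (z, q)) ((congrArg (face · p) (by decide)).trans (face_id p))
  · ext ⟨z, p⟩
    rw [faceFamily_apply, fB _ _ (by simp [face_apply]), smap_face]
    exact congrArg (fun q => B (z, q)) ((congrArg (face · p) (by decide)).trans (face_id p))
  · ext ⟨z, p⟩
    rw [faceFamily_apply, fC _ _ (by simp [face_apply]), smap_face]
    exact congrArg (fun q => C (z, q)) ((congrArg (face · p) (by decide)).trans (face_id p))
  · rw [faceFamily_apply, fA _ _ (by simp [face_apply, hp]), smap_face]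
    rw [hA.1 _ _ (by simp [face_apply, hp])]
    congr 1
    exact coord_congr (by simp [face_apply])
  · rw [faceFamily_apply, fB _ _ (by simp [face_apply, hp]), smap_face]
    rw [hB.2.1 _ _ (by simp [face_apply, hp])]
    congr 1
    exact coord_congr (by simp [face_apply])
  · rw [faceFamily_apply, fC _ _ (by simp [face_apply, hp]), smap_face]
    rw [hC.2.2 _ _ (by simp [face_apply, hp])]
    congr 1
    · group
    · exact coord_congr (by simp [face_apply])

theorem isReversible_loop {Y : Type*} (s : LoopSection M m₀) :
    IsReversible fun (g : FundamentalGroup M m₀) (_ : Y) t => s.loop g t :=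
  fun g _ _ _ h => loop_inv_apply s g h

theorem Triangle.isTri {s : LoopSection M m₀} {g h : FundamentalGroup M m₀} (a : Triangle s g h) :
    IsTri (fun g (_ : Z) t => s.loop g t) g h (a.1.comp ContinuousMap.snd) :=
  ⟨fun _ p hp => a.2.1 p hp, fun _ p hp => a.2.2.1 p hp, fun _ p hp => a.2.2.2 p hp⟩

theorem Triangle.isTri_homotopy {s : LoopSection M m₀} {g h : FundamentalGroup M m₀}
    (a : Triangle s g h) {b : C(Δ₂, M)} (H : a.1.HomotopyRel b bdry) :
    IsTri (fun g (_ : I) t => s.loop g t) g h H.toContinuousMap :=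
  ⟨fun t p hp => (H.eq_fst t ⟨2, hp⟩).trans (a.2.1 p hp),
    fun t p hp => (H.eq_fst t ⟨0, hp⟩).trans (a.2.2.1 p hp),
    fun t p hp => (H.eq_fst t ⟨1, hp⟩).trans (a.2.2.2 p hp)⟩

/-- The member of a family of singular 2-simplices at a parameter. -/
def IsTri.triangle {s : LoopSection M m₀} {g h : FundamentalGroup M m₀} {A : C(Z × Δ₂, M)} {z : Z}
    (hA : IsTri (fun g (_ : Z) t => s.loop g t) g h A) : Triangle s g h :=
  ⟨A.comp ((ContinuousMap.const _ z).prodMk (ContinuousMap.id _)),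
    fun p hp => hA.1 z p hp, fun p hp => hA.2.1 z p hp, fun p hp => hA.2.2 z p hp⟩

/-- Three singular 2-simplices with matching edges are faces of a singular 3-simplex. -/
theorem exists_fill {s : LoopSection M m₀} {g h' h k' p q : FundamentalGroup M m₀}
    (e₁ : h' = h⁻¹) (e₂ : p = h⁻¹ * g) (e₃ : q = k' * h) (a : Triangle s g h')
    (b : Triangle s h k') (c : Triangle s p q) :
    ∃ (ω : C(Δ₃, M)) (d : Triangle s g k'), ω.comp (face ![1, 2, 0]) = a.1 ∧
      ω.comp (face ![0, 2, 3]) = b.1 ∧ ω.comp (face ![1, 0, 3]) = c.1 ∧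
      ω.comp (face ![1, 2, 3]) = d.1 := by
  obtain ⟨Ψ, -, ha, hb, hc, hd⟩ := exists_fill_family (isReversible_loop (Y := Unit) s) e₁ e₂ e₃
    a.isTri b.isTri c.isTri
  exact ⟨Ψ.comp ((ContinuousMap.const _ ()).prodMk (ContinuousMap.id _)), hd.triangle (z := ()),
    ContinuousMap.ext fun p => DFunLike.congr_fun ha ((), p),
    ContinuousMap.ext fun p => DFunLike.congr_fun hb ((), p),
    ContinuousMap.ext fun p => DFunLike.congr_fun hc ((), p), rfl⟩

/-- Maps of the 3-simplex that agree on the faces containing the vertex `[0]` agree on the image of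
the retraction onto the union of these faces. -/
theorem eq_hornRetract {N : Type*} {ω ω' : Δ₃ → N}
    (ha : ∀ p, ω (face ![1, 2, 0] p) = ω' (face ![1, 2, 0] p))
    (hb : ∀ p, ω (face ![0, 2, 3] p) = ω' (face ![0, 2, 3] p))
    (hc : ∀ p, ω (face ![1, 0, 3] p) = ω' (face ![1, 0, 3] p)) (x : Δ₃) :
    ω (hornRetract x) = ω' (hornRetract x) := by
  obtain ⟨k, hk⟩ := exists_minTail (n := 3) x
  have h0 : hornRetract (n := 3) x k.succ = 0 := by
    rw [hornRetract_succ, minTail_eq hk, sub_self]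
  generalize hornRetract (n := 3) x = y at h0
  fin_cases k
  · obtain ⟨q, rfl⟩ := exists_face (f := ![0, 2, 3]) (y := y) (by decide) fun j hj => by
      have : j = 1 := by revert hj; revert j; decide
      rw [this]; exact h0
    exact hb q
  · obtain ⟨q, rfl⟩ := exists_face (f := ![1, 0, 3]) (y := y) (by decide) fun j hj => by
      have : j = 2 := by revert hj; revert j; decide
      rw [this]; exact h0
    exact hc q
  · obtain ⟨q, rfl⟩ := exists_face (f := ![1, 2, 0]) (y := y) (by decide) fun j hj => by
      have : j = 3 := by revert hj; revert j; decide
      rw [this]; exact h0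
    exact ha q

/-- The face of a 3-simplex opposite to `[0]` can be pushed into the other faces. -/
theorem homotopicRel_hornRetract (ω : C(Δ₃, M)) :
    (ω.comp (face ![1, 2, 3])).HomotopicRel
      (ω.comp ((⟨hornRetract, continuous_hornRetract⟩ : C(Δ₃, Δ₃)).comp (face ![1, 2, 3]))) bdry := by
  refine homotopicRel_comp_of_eqOn ω fun p hp => ?_
  obtain ⟨i, hi⟩ := hp
  refine (hornRetract_eq (k := i) ?_).symm
  rw [face_apply]
  fin_cases i <;> simpa using hi

/-- The fourth face of a singular 3-simplex is determined by the others up to homotopy. -/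
theorem Fills.unique {s : LoopSection M m₀} {g h' h k' p q : FundamentalGroup M m₀}
    (e₁ : h' = h⁻¹) (e₂ : p = h⁻¹ * g) (e₃ : q = k' * h) {a : Gamma s g h'} {b : Gamma s h k'}
    {c : Gamma s p q} {d d' : Gamma s g k'} (hd : Fills a b c d) (hd' : Fills a b c d') :
    d = d' := by
  obtain ⟨ω, a₁, b₁, c₁, d₁, ha, hb, hc, rfl, wa, wb, wc, wd⟩ := hd
  obtain ⟨ω', a₂, b₂, c₂, d₂, rfl, rfl, rfl, rfl, wa', wb', wc', wd'⟩ := hd'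
  obtain ⟨Ha⟩ : a₁.1.HomotopicRel a₂.1 bdry := Quotient.exact ha
  obtain ⟨Hb⟩ : b₁.1.HomotopicRel b₂.1 bdry := Quotient.exact hb
  obtain ⟨Hc⟩ : c₁.1.HomotopicRel c₂.1 bdry := Quotient.exact hc
  obtain ⟨Ψ, hr, fa, fb, fc, fd⟩ := exists_fill_family (isReversible_loop (Y := I) s) e₁ e₂ e₃
    (a₁.isTri_homotopy Ha) (b₁.isTri_homotopy Hb) (c₁.isTri_homotopy Hc)
  have fa' : ∀ t p, Ψ (t, face ![1, 2, 0] p) = Ha (t, p) := fun t p => DFunLike.congr_fun fa (t, p)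
  have fb' : ∀ t p, Ψ (t, face ![0, 2, 3] p) = Hb (t, p) := fun t p => DFunLike.congr_fun fb (t, p)
  have fc' : ∀ t p, Ψ (t, face ![1, 0, 3] p) = Hc (t, p) := fun t p => DFunLike.congr_fun fc (t, p)
  -- The filling `Ψ` of the three homotopies has the retracted maps `ω` and `ω'` as its ends,
  -- because it factors through the retraction. On its fourth face the edges do not depend on time,
  -- so this is a homotopy relative to the boundary.
  have key : (ω.comp ((⟨hornRetract, continuous_hornRetract⟩ : C(Δ₃, Δ₃)).comp
      (face ![1, 2, 3]))).HomotopicRel (ω'.comp ((⟨hornRetract, continuous_hornRetract⟩ :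
      C(Δ₃, Δ₃)).comp (face ![1, 2, 3]))) bdry := by
    have h0 : ∀ x, ω (hornRetract x) = Ψ (0, x) := fun x => by
      rw [← hr]
      refine eq_hornRetract (ω := ω) (ω' := fun x => Ψ (0, x)) (fun p => ?_) (fun p => ?_)
        (fun p => ?_) x
      · rw [fa', Ha.apply_zero, ← wa]; rfl
      · rw [fb', Hb.apply_zero, ← wb]; rfl
      · rw [fc', Hc.apply_zero, ← wc]; rfl
    have h1 : ∀ x, ω' (hornRetract x) = Ψ (1, x) := fun x => by
      rw [← hr]
      refine eq_hornRetract (ω := ω') (ω' := fun x => Ψ (1, x)) (fun p => ?_) (fun p => ?_)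
        (fun p => ?_) x
      · rw [fa', Ha.apply_one, ← wa']; rfl
      · rw [fb', Hb.apply_one, ← wb']; rfl
      · rw [fc', Hc.apply_one, ← wc']; rfl
    refine ⟨⟨⟨faceFamily Ψ ![1, 2, 3], fun p => (h0 _).symm, fun p => (h1 _).symm⟩,
      fun t p hp => ?_⟩⟩
    have e : faceFamily Ψ ![1, 2, 3] (t, p) = faceFamily Ψ ![1, 2, 3] (0, p) := by
      obtain ⟨i, hi⟩ := hp
      fin_cases i
      · rw [fd.2.1 _ _ hi, fd.2.1 _ _ hi]
      · rw [fd.2.2 _ _ hi, fd.2.2 _ _ hi]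
      · rw [fd.1 _ _ hi, fd.1 _ _ hi]
    exact e.trans (h0 _).symm
  refine Quotient.sound ?_
  change d₁.1.HomotopicRel d₂.1 bdry
  rw [← wd, ← wd']
  exact ((homotopicRel_hornRetract ω).trans key).trans (homotopicRel_hornRetract ω').symm

/-- Existence and uniqueness of fillers make the choice in `gammaData` immaterial; products can from
now on be computed by exhibiting any one 3-simplex. -/
theorem gammaData_m_eq_iff {s : LoopSection M m₀} {g h' h k' p q : FundamentalGroup M m₀}
    (e₁ : h' = h⁻¹) (e₂ : p = h⁻¹ * g) (e₃ : q = k' * h) (a : Gamma s g h') (b : Gamma s h k')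
    (c : Gamma s p q) (d : Gamma s g k') :
    (gammaData s).m e₁ e₂ e₃ a b c = d ↔ Fills a b c d := by
  have h0 : Fills a b c ((gammaData s).m e₁ e₂ e₃ a b c) :=
    Classical.choose_spec (exists_fills e₁ e₂ e₃ a b c)
  exact ⟨fun h => h ▸ h0, fun h => h0.unique e₁ e₂ e₃ h⟩

end Fill

/-! ### The axioms of a Δ-group for singular triangles -/

section DeltaGroup

variable {M : Type u} [TopologicalSpace M] {m₀ : M} {s : LoopSection M m₀}

/-- The class `x` is represented by the map `t`. -/
def Rep {g h : FundamentalGroup M m₀} (x : Gamma s g h) (t : C(Δ₂, M)) : Prop :=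
  ∃ a : Triangle s g h, Gamma.mk a = x ∧ a.1 = t

theorem Gamma.exists_rep {g h : FundamentalGroup M m₀} (x : Gamma s g h) :
    ∃ a : Triangle s g h, Gamma.mk a = x :=
  Quotient.exists_rep x

theorem rep_mk {g h : FundamentalGroup M m₀} (a : Triangle s g h) : Rep (Gamma.mk a) a.1 :=
  ⟨a, rfl, rfl⟩

theorem Rep.P {g h : FundamentalGroup M m₀} {x : Gamma s g h} {t : C(Δ₂, M)} (hx : Rep x t) :
    Rep x.P (t.comp (face ![1, 2, 0])) := by
  obtain ⟨a, rfl, rfl⟩ := hx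
  exact ⟨a.P, rfl, rfl⟩

theorem Rep.Q {g h : FundamentalGroup M m₀} {x : Gamma s g h} {t : C(Δ₂, M)} (hx : Rep x t) :
    Rep x.Q (t.comp (face ![1, 0, 2])) := by
  obtain ⟨a, rfl, rfl⟩ := hx
  exact ⟨a.Q, rfl, rfl⟩

theorem Rep.eq_of_homotopicRel {g h : FundamentalGroup M m₀} {x y : Gamma s g h} {t t' : C(Δ₂, M)}
    (hx : Rep x t) (hy : Rep y t') (htt : t.HomotopicRel t' bdry) : x = y := by
  obtain ⟨a, rfl, rfl⟩ := hx
  obtain ⟨b, rfl, rfl⟩ := hy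
  exact Quotient.sound htt

theorem Rep.eq {g h : FundamentalGroup M m₀} {x y : Gamma s g h} {t : C(Δ₂, M)}
    (hx : Rep x t) (hy : Rep y t) : x = y :=
  hx.eq_of_homotopicRel hy (.refl t)

theorem Rep.heq {g h g' h' : FundamentalGroup M m₀} {x : Gamma s g h} {y : Gamma s g' h'}
    {t : C(Δ₂, M)} (hx : Rep x t) (hy : Rep y t) (hg : g = g') (hh : h = h') : x ≍ y := by
  subst hg hh
  exact heq_of_eq (hx.eq hy)

theorem fills_iff {g h' h k' p q : FundamentalGroup M m₀} {a : Gamma s g h'} {b : Gamma s h k'}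
    {c : Gamma s p q} {d : Gamma s g k'} :
    Fills a b c d ↔ ∃ ω : C(Δ₃, M), Rep a (ω.comp (face ![1, 2, 0])) ∧
      Rep b (ω.comp (face ![0, 2, 3])) ∧ Rep c (ω.comp (face ![1, 0, 3])) ∧
      Rep d (ω.comp (face ![1, 2, 3])) := by
  constructor
  · rintro ⟨ω, a', b', c', d', ha, hb, hc, hd, wa, wb, wc, wd⟩
    exact ⟨ω, ⟨a', ha, wa.symm⟩, ⟨b', hb, wb.symm⟩, ⟨c', hc, wc.symm⟩, ⟨d', hd, wd.symm⟩⟩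
  · rintro ⟨ω, ⟨a', ha, wa⟩, ⟨b', hb, wb⟩, ⟨c', hc, wc⟩, ⟨d', hd, wd⟩⟩
    exact ⟨ω, a', b', c', d', ha, hb, hc, hd, wa.symm, wb.symm, wc.symm, wd.symm⟩

/-- The tri-product of `Γ(M)`. -/
def gmul {g h' h k' p q : FundamentalGroup M m₀} (e₁ : h' = h⁻¹) (e₂ : p = h⁻¹ * g)
    (e₃ : q = k' * h) (a : Gamma s g h') (b : Gamma s h k') (c : Gamma s p q) : Gamma s g k' :=
  (gammaData s).m e₁ e₂ e₃ a b c

theorem exists_fill_m {g h' h k' p q : FundamentalGroup M m₀} (e₁ : h' = h⁻¹) (e₂ : p = h⁻¹ * g)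
    (e₃ : q = k' * h) (a : Gamma s g h') (b : Gamma s h k') (c : Gamma s p q) :
    ∃ ω : C(Δ₃, M), Rep a (ω.comp (face ![1, 2, 0])) ∧
      Rep b (ω.comp (face ![0, 2, 3])) ∧ Rep c (ω.comp (face ![1, 0, 3])) ∧
      Rep (gmul e₁ e₂ e₃ a b c) (ω.comp (face ![1, 2, 3])) :=
  fills_iff.1 ((gammaData_m_eq_iff e₁ e₂ e₃ a b c _).1 rfl)

theorem m_eq_of_rep {g h' h k' p q : FundamentalGroup M m₀} (e₁ : h' = h⁻¹) (e₂ : p = h⁻¹ * g)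
    (e₃ : q = k' * h) {a : Gamma s g h'} {b : Gamma s h k'} {c : Gamma s p q} {d : Gamma s g k'}
    (ω : C(Δ₃, M)) (ha : Rep a (ω.comp (face ![1, 2, 0]))) (hb : Rep b (ω.comp (face ![0, 2, 3])))
    (hc : Rep c (ω.comp (face ![1, 0, 3]))) (hd : Rep d (ω.comp (face ![1, 2, 3]))) :
    gmul e₁ e₂ e₃ a b c = d :=
  (gammaData_m_eq_iff e₁ e₂ e₃ a b c d).2 (fills_iff.2 ⟨ω, ha, hb, hc, hd⟩)

/-- The operation `m` may be computed with a singular 3-simplex composed with an affine map. -/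
theorem m_heq_of_rep {g h' h k' p q : FundamentalGroup M m₀} (e₁ : h' = h⁻¹) (e₂ : p = h⁻¹ * g)
    (e₃ : q = k' * h) {a : Gamma s g h'} {b : Gamma s h k'} {c : Gamma s p q}
    {g₀ k₀ : FundamentalGroup M m₀} {d : Gamma s g₀ k₀} {n : ℕ} (ω : C(stdSimplex ℝ (Fin n), M))
    (f : Fin 4 → Fin n) (ha : Rep a (ω.comp (face ![f 1, f 2, f 0])))
    (hb : Rep b (ω.comp (face ![f 0, f 2, f 3])))
    (hc : Rep c (ω.comp (face ![f 1, f 0, f 3]))) (hd : Rep d (ω.comp (face ![f 1, f 2, f 3])))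
    (hg : g₀ = g) (hk : k₀ = k') : d ≍ gmul e₁ e₂ e₃ a b c := by
  subst hg hk
  have hf : ∀ i j k, (ω.comp (smap f)).comp (face ![i, j, k]) = ω.comp (face ![f i, f j, f k]) := by
    intro i j k
    rw [ContinuousMap.comp_assoc, smap_comp_face]
    congr 2
    ext l
    fin_cases l <;> rfl
  refine heq_of_eq (m_eq_of_rep e₁ e₂ e₃ (ω.comp (smap f)) ?_ ?_ ?_ ?_).symm
  all_goals rw [hf]; assumption

theorem comp_face_comp_face {n : ℕ} (ω : C(stdSimplex ℝ (Fin n), M)) (i j k : Fin n)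
    (f : Fin 3 → Fin 3) : (ω.comp (face ![i, j, k])).comp (face f) =
      ω.comp (face ![![i, j, k] (f 0), ![i, j, k] (f 1), ![i, j, k] (f 2)]) := by
  rw [ContinuousMap.comp_assoc, face_comp_face]
  congr 2
  ext l
  fin_cases l <;> rfl

theorem Rep.P' {g h : FundamentalGroup M m₀} {x : Gamma s g h} {n : ℕ}
    {ω : C(stdSimplex ℝ (Fin n), M)} {i j k : Fin n} (hx : Rep x (ω.comp (face ![i, j, k]))) :
    Rep x.P (ω.comp (face ![j, k, i])) := by
  have := hx.P
  rwa [comp_face_comp_face] at this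

theorem Rep.Q' {g h : FundamentalGroup M m₀} {x : Gamma s g h} {n : ℕ}
    {ω : C(stdSimplex ℝ (Fin n), M)} {i j k : Fin n} (hx : Rep x (ω.comp (face ![i, j, k]))) :
    Rep x.Q (ω.comp (face ![j, i, k])) := by
  have := hx.Q
  rwa [comp_face_comp_face] at this

theorem Triangle.rep_face {g h : FundamentalGroup M m₀} (a : Triangle s g h) :
    Rep (Gamma.mk a) (a.1.comp (face ![0, 1, 2])) :=
  ⟨a, rfl, ContinuousMap.ext fun p => by rw [ContinuousMap.comp_apply, face_id]⟩

/-- Four singular 3-simplices with matching faces are faces of a singular 4-simplex. -/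
theorem exists_pentachoron (ω₁ ω₂ ω₃ ω₄ : C(Δ₃, M))
    (h12 : ω₂.comp (face ![1, 2, 0]) = ω₁.comp (face ![0, 2, 3]))
    (h13 : ω₃.comp (face ![1, 2, 0]) = ω₁.comp (face ![1, 0, 3]))
    (h14 : ω₄.comp (face ![1, 2, 0]) = ω₁.comp (face ![1, 2, 3]))
    (h23 : ω₃.comp (face ![2, 0, 3]) = ω₂.comp (face ![1, 0, 3]))
    (h24 : ω₄.comp (face ![0, 2, 3]) = ω₂.comp (face ![0, 2, 3]))
    (h34 : ω₄.comp (face ![1, 0, 3]) = ω₃.comp (face ![1, 0, 3])) :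
    ∃ ω : C(Δ₃, M), ω.comp (face ![1, 2, 0]) = ω₁.comp (face ![1, 2, 0]) ∧
      ω.comp (face ![0, 2, 3]) = ω₂.comp (face ![1, 2, 3]) ∧
      ω.comp (face ![1, 0, 3]) = ω₃.comp (face ![1, 2, 3]) ∧
      ω.comp (face ![1, 2, 3]) = ω₄.comp (face ![1, 2, 3]) := by
  have key : ∀ {ω ω' : C(Δ₃, M)} {f f' : Fin 5 → Fin 4} (t : Fin 3 → Fin 5)
      (_ : ω.comp (face (f ∘ t)) = ω'.comp (face (f' ∘ t))) (_ : Function.Injective t)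
      {y : stdSimplex ℝ (Fin 5)} (_ : ∀ j, (∀ i, t i ≠ j) → y j = 0),
      ω (smap f y) = ω' (smap f' y) := by
    intro ω ω' f f' t h ht y hy
    obtain ⟨q, rfl⟩ := exists_face ht hy
    rw [smap_face, smap_face]
    exact DFunLike.congr_fun h q
  have fe : ∀ {n : ℕ} {t t' : Fin 3 → Fin n}, t 0 = t' 0 → t 1 = t' 1 → t 2 = t' 2 → t = t' := by
    intro n t t' h0 h1 h2
    ext i
    fin_cases i <;> simp [h0, h1, h2]
  -- With vertices in the order of their labels in the 3-simplices, `ω₄`, `ω₂`, `ω₃`, `ω₁` are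
  -- placed on [0,2,3,4], [0,1,3,4], [0,2,1,4], [1,2,3,0], the faces opposite to [1], [2], [3], [4].
  -- The vertex maps are left inverses of these lists. The six hypotheses are the agreements on the
  -- common triangles, and the new 3-simplex is the face [1,2,3,4].
  obtain ⟨Ψ, -, hΨ⟩ := exists_horn_extension (n := 4) (Z := Unit)
    ![(ω₄.comp (smap ![0, 0, 1, 2, 3])).comp .snd, (ω₂.comp (smap ![0, 1, 0, 2, 3])).comp .snd,
      (ω₃.comp (smap ![0, 2, 1, 0, 3])).comp .snd, (ω₁.comp (smap ![3, 0, 1, 2, 3])).comp .snd] (by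
      intro k l hkl z y hk hl
      obtain ⟨rfl, rfl⟩ | ⟨rfl, rfl⟩ | ⟨rfl, rfl⟩ | ⟨rfl, rfl⟩ | ⟨rfl, rfl⟩ | ⟨rfl, rfl⟩ :
          k = 0 ∧ l = 1 ∨ k = 0 ∧ l = 2 ∨ k = 0 ∧ l = 3 ∨ k = 1 ∧ l = 2 ∨ k = 1 ∧ l = 3 ∨
            k = 2 ∧ l = 3 := by
        clear hk hl; revert hkl; revert k l; decide
      · replace hk : y 1 = 0 := hk
        replace hl : y 2 = 0 := hl
        refine key (ω := ω₄) (ω' := ω₂) ![0, 3, 4] ?_ (by decide) fun j hj => ?_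
        · convert h24 using 2 <;> exact congrArg face (fe rfl rfl rfl)
        · have : j = 1 ∨ j = 2 := by revert hj; revert j; decide
          rcases this with rfl | rfl <;> assumption
      · replace hk : y 1 = 0 := hk
        replace hl : y 3 = 0 := hl
        refine key (ω := ω₄) (ω' := ω₃) ![2, 0, 4] ?_ (by decide) fun j hj => ?_
        · convert h34 using 2 <;> exact congrArg face (fe rfl rfl rfl)
        · have : j = 1 ∨ j = 3 := by revert hj; revert j; decide
          rcases this with rfl | rfl <;> assumption
      · replace hk : y 1 = 0 := hk
        replace hl : y 4 = 0 := hl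
        refine key (ω := ω₄) (ω' := ω₁) ![2, 3, 0] ?_ (by decide) fun j hj => ?_
        · convert h14 using 2 <;> exact congrArg face (fe rfl rfl rfl)
        · have : j = 1 ∨ j = 4 := by revert hj; revert j; decide
          rcases this with rfl | rfl <;> assumption
      · replace hk : y 2 = 0 := hk
        replace hl : y 3 = 0 := hl
        refine key (ω := ω₂) (ω' := ω₃) ![1, 0, 4] ?_ (by decide) fun j hj => ?_
        · convert h23.symm using 2 <;> exact congrArg face (fe rfl rfl rfl)
        · have : j = 2 ∨ j = 3 := by revert hj; revert j; decide
          rcases this with rfl | rfl <;> assumption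
      · replace hk : y 2 = 0 := hk
        replace hl : y 4 = 0 := hl
        refine key (ω := ω₂) (ω' := ω₁) ![1, 3, 0] ?_ (by decide) fun j hj => ?_
        · convert h12 using 2 <;> exact congrArg face (fe rfl rfl rfl)
        · have : j = 2 ∨ j = 4 := by revert hj; revert j; decide
          rcases this with rfl | rfl <;> assumption
      · replace hk : y 3 = 0 := hk
        replace hl : y 4 = 0 := hl
        refine key (ω := ω₃) (ω' := ω₁) ![2, 1, 0] ?_ (by decide) fun j hj => ?_
        · convert h13 using 2 <;> exact congrArg face (fe rfl rfl rfl)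
        · have : j = 3 ∨ j = 4 := by revert hj; revert j; decide
          rcases this with rfl | rfl <;> assumption)
  have hf : ∀ {ω : C(Δ₃, M)} {f : Fin 5 → Fin 4} (k : Fin 4) (t : Fin 3 → Fin 4) (t' : Fin 3 → Fin 4)
      (_ : ∀ x : stdSimplex ℝ (Fin 5), x k.succ = 0 → Ψ ((), x) = ω (smap f x))
      (_ : ∀ i, ![1, 2, 3, 4] (t i) ≠ k.succ) (_ : f ∘ ![1, 2, 3, 4] ∘ t = t') (p : Δ₂),
      Ψ ((), smap ![1, 2, 3, 4] (face t p)) = ω (face t' p) := by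
    intro ω f k t t' h hk ht p
    rw [smap_face, h, smap_face]
    · exact congrArg (fun r => ω (face r p)) ht
    · rw [face_apply, if_neg (show ¬(![1, 2, 3, 4] ∘ t) 0 = k.succ from hk 0),
        if_neg (show ¬(![1, 2, 3, 4] ∘ t) 1 = k.succ from hk 1),
        if_neg (show ¬(![1, 2, 3, 4] ∘ t) 2 = k.succ from hk 2)]
      norm_num
  refine ⟨Ψ.comp ((ContinuousMap.const _ ()).prodMk (smap ![1, 2, 3, 4])),
    ContinuousMap.ext fun p => ?_, ContinuousMap.ext fun p => ?_,
    ContinuousMap.ext fun p => ?_, ContinuousMap.ext fun p => ?_⟩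
  · exact hf (f := ![3, 0, 1, 2, 3]) 3 _ _ (hΨ 3 ()) (by decide) (by decide) p
  · exact hf (f := ![0, 1, 0, 2, 3]) 1 _ _ (hΨ 1 ()) (by decide) (by decide) p
  · exact hf (f := ![0, 2, 1, 0, 3]) 2 _ _ (hΨ 2 ()) (by decide) (by decide) p
  · exact hf (f := ![0, 0, 1, 2, 3]) 0 _ _ (hΨ 0 ()) (by decide) (by decide) p

theorem Triangle.Q_comp_face {g h : FundamentalGroup M m₀} (a : Triangle s g h) :
    a.Q.1.comp (face ![1, 0, 2]) = a.1 := by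
  change (a.1.comp (face ![1, 0, 2])).comp (face ![1, 0, 2]) = a.1
  rw [comp_face_comp_face]
  exact ContinuousMap.ext fun p => congrArg a.1 (face_id p)

/-- The axioms on P and Q alone are identities between permutations of the vertices of a triangle. A
filler remains a filler for other factors when its vertices are permuted, which gives `P_m`, `Q_m`
and `m_m_cancel`. The two sides of `m_m` are computed by four tetrahedra in the boundary of a
4-simplex, and the fifth tetrahedron compares them. -/
theorem gammaData_isDeltaGroup (s : LoopSection M m₀) : (gammaData s).IsDeltaGroup where
  P_P_P {g h} x := by
    obtain ⟨a, rfl⟩ := Gamma.exists_rep x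
    exact a.rep_face.P'.P'.P'.heq a.rep_face (by group) (by group)
  Q_Q {g h} x := by
    obtain ⟨a, rfl⟩ := Gamma.exists_rep x
    exact a.rep_face.Q'.Q'.heq a.rep_face (by group) (by group)
  P_P_Q {g h} x := by
    obtain ⟨a, rfl⟩ := Gamma.exists_rep x
    exact a.rep_face.Q'.P'.P'.heq a.rep_face.P'.Q' (by group) (by group)
  P_m {g h' h k' p q} e₁ e₂ e₃ a b c := by
    obtain ⟨ω, ha, hb, hc, hd⟩ := exists_fill_m e₁ e₂ e₃ a b c
    exact m_heq_of_rep _ _ _ ω ![0, 2, 3, 1] hb.P' hc.P' ha.P' hd.P' rfl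
      (by rw [e₂, e₃]; group)
  Q_m {g h' h k' p q} e₁ e₂ e₃ a b c := by
    obtain ⟨ω, ha, hb, hc, hd⟩ := exists_fill_m e₁ e₂ e₃ a b c
    exact m_heq_of_rep _ _ _ ω ![0, 2, 1, 3] ha.Q' hc.Q' hb.Q' hd.Q' rfl
      (by rw [e₂, e₃]; group)
  m_m {g h' h k' k l' p q r t} e₁ e₂ e₃ e₄ e₅ e₆ a b c d e f := by
    obtain ⟨a, rfl⟩ := Gamma.exists_rep a
    obtain ⟨b, rfl⟩ := Gamma.exists_rep b
    obtain ⟨c, rfl⟩ := Gamma.exists_rep c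
    obtain ⟨d, rfl⟩ := Gamma.exists_rep d
    obtain ⟨e, rfl⟩ := Gamma.exists_rep e
    obtain ⟨f, rfl⟩ := Gamma.exists_rep f
    obtain ⟨ω₁, d₁, ha₁, hb₁, hc₁, hd₁⟩ := exists_fill e₁ e₂ e₃ a b c
    obtain ⟨ω₂, d₂, ha₂, hb₂, hc₂, hd₂⟩ := exists_fill e₄ rfl rfl b d f
    obtain ⟨ω₃, d₃, ha₃, hb₃, hc₃, hd₃⟩ := exists_fill
      (g := p) (h' := q) (h := (k⁻¹ * h)⁻¹) (k' := l' * k * (k⁻¹ * h)) (p := r) (q := t)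
      (by rw [e₃, e₄]; group) (by rw [e₅, e₂]; group) (by rw [e₆]; group) c f.Q e
    obtain ⟨ω₄, d₄, ha₄, hb₄, hc₄, hd₄⟩ := exists_fill e₄ e₅ e₆ d₁ d e
    have rw₁ : (gammaData s).m e₁ e₂ e₃ (Gamma.mk a) (Gamma.mk b) (Gamma.mk c) = Gamma.mk d₁ :=
      m_eq_of_rep _ _ _ ω₁ ⟨a, rfl, ha₁.symm⟩ ⟨b, rfl, hb₁.symm⟩ ⟨c, rfl, hc₁.symm⟩
        ⟨d₁, rfl, hd₁.symm⟩
    have rw₂ : (gammaData s).m e₄ rfl rfl (Gamma.mk b) (Gamma.mk d) (Gamma.mk f) = Gamma.mk d₂ :=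
      m_eq_of_rep _ _ _ ω₂ ⟨b, rfl, ha₂.symm⟩ ⟨d, rfl, hb₂.symm⟩ ⟨f, rfl, hc₂.symm⟩
        ⟨d₂, rfl, hd₂.symm⟩
    have rw₃ := m_eq_of_rep (g := p) (h' := q) (h := (k⁻¹ * h)⁻¹) (k' := l' * k * (k⁻¹ * h))
      (p := r) (q := t) (by rw [e₃, e₄]; group) (by rw [e₅, e₂]; group) (by rw [e₆]; group) ω₃
      ⟨c, rfl, ha₃.symm⟩ ⟨f.Q, rfl, hb₃.symm⟩ ⟨e, rfl, hc₃.symm⟩ ⟨d₃, rfl, hd₃.symm⟩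
    have rw₄ : (gammaData s).m e₄ e₅ e₆ (Gamma.mk d₁) (Gamma.mk d) (Gamma.mk e) = Gamma.mk d₄ :=
      m_eq_of_rep _ _ _ ω₄ ⟨d₁, rfl, ha₄.symm⟩ ⟨d, rfl, hb₄.symm⟩ ⟨e, rfl, hc₄.symm⟩
        ⟨d₄, rfl, hd₄.symm⟩
    -- The triangle `f` is common to `ω₂` and `ω₃` with opposite orientations; this is the reason
    -- for `Q f` in the axiom and for the reflected face in the hypothesis that compares them.
    obtain ⟨ω, h1, h2, h3, h4⟩ := exists_pentachoron ω₁ ω₂ ω₃ ω₄ (ha₂.trans hb₁.symm)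
      (ha₃.trans hc₁.symm) (ha₄.trans hd₁.symm)
      (by
        have : (ω₃.comp (face ![0, 2, 3])).comp (face ![1, 0, 2]) = ω₂.comp (face ![1, 0, 3]) := by
          rw [hb₃, hc₂]
          exact f.Q_comp_face
        rwa [comp_face_comp_face] at this)
      (hb₄.trans hb₂.symm) (hc₄.trans hc₃.symm)
    rw [rw₁, rw₄, rw₂]
    refine Eq.trans ?_ (congrArg _ rw₃.symm)
    exact (m_eq_of_rep _ _ _ ω ⟨a, rfl, ha₁.symm.trans h1.symm⟩ ⟨d₂, rfl, hd₂.symm.trans h2.symm⟩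
      ⟨d₃, rfl, hd₃.symm.trans h3.symm⟩ ⟨d₄, rfl, hd₄.symm.trans h4.symm⟩).symm
  m_m_cancel {g h' h k' p q} e₁ e₂ e₃ f a b := by
    obtain ⟨ω, hf, ha, hb, hd⟩ := exists_fill_m e₁ e₂ e₃ f a b
    -- Exchanging the vertices [0] and [3] turns the product into the first factor and `f` into the
    -- fourth face.
    exact (m_heq_of_rep _ _ _ ω ![3, 1, 2, 0] hd ha.Q'.P'.P' hb.Q'.P' hf rfl
      (by rw [e₁]; group)).symm

end DeltaGroup

/-! ### Gluing spheres to singular simplices -/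

section Bubble

variable {M : Type u} [TopologicalSpace M] {m₀ : M} {s : LoopSection M m₀}

@[fun_prop]
theorem continuous_minCoord_comp {Z : Type*} [TopologicalSpace Z] {f : Z → Δ₂} (h : Continuous f) :
    Continuous fun z => minCoord (f z) :=
  continuous_minCoord.comp h

@[fun_prop]
theorem continuous_bubbleSquare_comp {Z : Type*} [TopologicalSpace Z] {f : Z → Δ₂}
    (h : Continuous f) : Continuous fun z => bubbleSquare (f z) :=
  continuous_bubbleSquare.comp h

theorem minCoord_nonneg (p : Δ₂) : 0 ≤ minCoord p :=
  le_min (stdSimplex.zero_le p 0) (le_min (stdSimplex.zero_le p 1) (stdSimplex.zero_le p 2))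

/-- The proportion in which a point is moved when a triangle is pinched. -/
def pinchRatio (p : Δ₂) : I := trunc (8 * minCoord p)

@[fun_prop]
theorem continuous_pinchRatio {Z : Type*} [TopologicalSpace Z] {f : Z → Δ₂} (h : Continuous f) :
    Continuous fun z => pinchRatio (f z) := by
  unfold pinchRatio; fun_prop

theorem pinchRatio_of_mem_bdry {p : Δ₂} (hp : p ∈ bdry) : pinchRatio p = 0 := by
  rw [pinchRatio, minCoord_eq_zero hp, trunc_of_le (by norm_num)]

theorem pinchRatio_of_le {p : Δ₂} (hp : 1 / 8 ≤ minCoord p) : pinchRatio p = 1 :=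
  trunc_of_ge (by linarith)

/-- Written as a motion along segments, pinching makes sense with any target point in place of the
vertex [0]; this freedom is needed to move an inserted sphere to another corner. -/
theorem pinch_eq_lerp (p : Δ₂) : pinch p = lerp (pinchRatio p) p (stdSimplex.vertex 0) := by
  have h : ((pinchRatio p : I) : ℝ) = min (8 * minCoord p) 1 := by
    rw [pinchRatio, trunc, Set.coe_projIcc, min_comm]
    exact max_eq_right (le_min (by linarith [minCoord_nonneg p]) zero_le_one)
  refine Δ₂_ext ?_ ?_ ?_
  · change p 0 + min (8 * minCoord p) 1 * (1 - p 0) = _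
    rw [lerp_apply, h]; simp; ring
  · change (1 - min (8 * minCoord p) 1) * p 1 = _
    rw [lerp_apply, h]; simp
  · change (1 - min (8 * minCoord p) 1) * p 2 = _
    rw [lerp_apply, h]; simp

theorem smap_lerp {m n : ℕ} (f : Fin m → Fin n) (t : I) (p q : stdSimplex ℝ (Fin m)) :
    smap f (lerp t p q) = lerp t (smap f p) (smap f q) := by
  ext j
  rw [lerp_apply, smap_apply, smap_apply, smap_apply, Finset.mul_sum, Finset.mul_sum,
    ← Finset.sum_add_distrib]
  refine Finset.sum_congr rfl fun i _ => ?_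
  split_ifs
  · rw [lerp_apply]
  · ring

theorem face_lerp {n : ℕ} (f : Fin 3 → Fin n) (t : I) (p q : Δ₂) :
    face f (lerp t p q) = lerp t (face f p) (face f q) :=
  smap_lerp f t p q

theorem face_vertex {n : ℕ} (f : Fin 3 → Fin n) (i : Fin 3) :
    face f (stdSimplex.vertex i) = stdSimplex.vertex (f i) :=
  stdSimplex.map_vertex f i

/-- The singular 2-simplex `y` is obtained from `x` by pinching it at the point `v`, and mapping
the interior by `F`. -/
def IsInsertion (y x : C(Δ₂, M)) (v : Δ₂) (F : Δ₂ → M) : Prop :=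
  ∀ p, y p = if 1 / 8 ≤ minCoord p then F p else x (lerp (pinchRatio p) p v)

theorem isInsertion_bubbleTriangle {g h : FundamentalGroup M m₀} (a : Ω^ (Fin 2) M m₀)
    (x : Triangle s g h) : IsInsertion (bubbleTriangle a x).1 x.1 (stdSimplex.vertex 0)
      fun p => a (bubbleSquare p) := fun p => by
  rw [← pinch_eq_lerp]
  rfl

/-- Insertions are homotopic if the points are moved along a path and the inserted maps are
homotopic along the image of the path. -/
theorem IsInsertion.homotopicRel {y₀ y₁ x : C(Δ₂, M)} {v : I → Δ₂} (hv : Continuous v)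
    {F : I → Δ₂ → M} (hF : Continuous fun w : I × Δ₂ => F w.1 w.2)
    (hb : ∀ t p, minCoord p = 1 / 8 → F t p = x (v t)) (h₀ : IsInsertion y₀ x (v 0) (F 0))
    (h₁ : IsInsertion y₁ x (v 1) (F 1)) : y₀.HomotopicRel y₁ bdry := by
  refine ⟨⟨⟨⟨fun w => if 1 / 8 ≤ minCoord w.2 then F w.1 w.2 else
    x (lerp (pinchRatio w.2) w.2 (v w.1)), ?_⟩, fun p => ?_, fun p => ?_⟩, fun t p hp => ?_⟩⟩
  · refine Continuous.if_le hF (by fun_prop) (by fun_prop) (by fun_prop) fun w hw => ?_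
    rw [hb _ _ hw.symm, pinchRatio_of_le hw.le, lerp_one]
  · exact (h₀ p).symm
  · exact (h₁ p).symm
  · have e : ¬ 1 / 8 ≤ minCoord p := by rw [minCoord_eq_zero hp]; norm_num
    change (if 1 / 8 ≤ minCoord p then F t p else x (lerp (pinchRatio p) p (v t))) = y₀ p
    rw [h₀ p, if_neg e, if_neg e, pinchRatio_of_mem_bdry hp, lerp_zero, lerp_zero]

/-- A singular 3-simplex can be pinched at the vertex `[1]`, along a map to the 2-simplex. -/
theorem exists_bubble_fill (ω : C(Δ₃, M)) (hω : ω (stdSimplex.vertex 1) = m₀)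
    (a : Ω^ (Fin 2) M m₀) (c : Fin 4 → Fin 3) :
    ∃ ω' : C(Δ₃, M), (∀ f : Fin 3 → Fin 4, c ∘ f = ![0, 1, 2] → f 0 = 1 →
        IsInsertion (ω'.comp (face f)) (ω.comp (face f)) (stdSimplex.vertex 0)
          fun p => a (bubbleSquare p)) ∧
      ∀ f : Fin 3 → Fin 4, (∃ j, ∀ i, c (f i) ≠ j) → ω'.comp (face f) = ω.comp (face f) := by
  -- The sphere is inserted along the fibres of the projection `smap c` to the triangle. A face
  -- projected identically receives one copy of it; a face projected into the boundary is not
  -- changed.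
  refine ⟨⟨fun q => if 1 / 8 ≤ minCoord (smap c q) then a (bubbleSquare (smap c q)) else
    ω (lerp (pinchRatio (smap c q)) q (stdSimplex.vertex 1)), ?_⟩, fun f hf h0 p => ?_,
    fun f ⟨j, hj⟩ => ContinuousMap.ext fun p => ?_⟩
  · refine Continuous.if_le (a.1.continuous.comp (by fun_prop)) (by fun_prop) (by fun_prop)
      (by fun_prop) fun q hq => ?_
    rw [GenLoop.boundary a _ (bubbleSquare_mem hq.symm), pinchRatio_of_le hq.le, lerp_one, hω]
  · change (if 1 / 8 ≤ minCoord (smap c (face f p)) then a (bubbleSquare (smap c (face f p))) else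
      ω (lerp (pinchRatio (smap c (face f p))) (face f p) (stdSimplex.vertex 1))) = _
    rw [smap_face, hf, face_id, ContinuousMap.comp_apply, face_lerp, face_vertex, h0]
  · have e : smap c (face f p) ∈ bdry := ⟨j, by
      rw [smap_face, face_apply]
      simp [Function.comp_apply, hj]⟩
    change (if 1 / 8 ≤ minCoord (smap c (face f p)) then a (bubbleSquare (smap c (face f p))) else
      ω (lerp (pinchRatio (smap c (face f p))) (face f p) (stdSimplex.vertex 1))) = _
    rw [if_neg (by rw [minCoord_eq_zero e]; norm_num), pinchRatio_of_mem_bdry e, lerp_zero]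
    rfl

theorem Rep.bubble {g h : FundamentalGroup M m₀} {x : Gamma s g h} {t y : C(Δ₂, M)} (hx : Rep x t)
    {a : Ω^ (Fin 2) M m₀}
    (hy : IsInsertion y t (stdSimplex.vertex 0) fun p => a (bubbleSquare p)) :
    Rep (bubble (PiTwo.mk a) x) y := by
  obtain ⟨b, rfl, rfl⟩ := hx
  exact ⟨bubbleTriangle a b, rfl, ContinuousMap.ext fun p =>
    (isInsertion_bubbleTriangle a b p).trans (hy p).symm⟩

theorem Rep.vertex_zero {g h : FundamentalGroup M m₀} {x : Gamma s g h} {t : C(Δ₂, M)}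
    (hx : Rep x t) : t (stdSimplex.vertex 0) = m₀ := by
  obtain ⟨b, rfl, rfl⟩ := hx
  exact b.vertex_zero

/-- The projection identifies the vertices [0] and [3]: the face of `x` and the product are mapped
isomorphically, while the faces of `y` and `z` collapse to edges. Both spheres sit at the vertex
[1], so no element of π₁ intervenes. -/
theorem m_bubble_left {g h' h k' p q : FundamentalGroup M m₀} (e₁ : h' = h⁻¹) (e₂ : p = h⁻¹ * g)
    (e₃ : q = k' * h) (a : PiTwo M m₀) (x : Gamma s g h') (y : Gamma s h k') (z : Gamma s p q) :
    gmul e₁ e₂ e₃ (bubble a x) y z = bubble a (gmul e₁ e₂ e₃ x y z) := by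
  obtain ⟨a, rfl⟩ := PiTwo.mk_surjective a
  obtain ⟨ω, hx, hy, hz, hd⟩ := exists_fill_m e₁ e₂ e₃ x y z
  have hv := hx.vertex_zero
  rw [ContinuousMap.comp_apply, face_vertex] at hv
  obtain ⟨ω', h1, h2⟩ := exists_bubble_fill ω hv a ![2, 0, 1, 2]
  refine m_eq_of_rep e₁ e₂ e₃ ω' (hx.bubble (h1 _ (by decide) rfl)) ?_ ?_
    (hd.bubble (h1 _ (by decide) rfl))
  · rwa [h2 _ ⟨0, by decide⟩]
  · rwa [h2 _ ⟨1, by decide⟩]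

/-- The same argument with the vertices [0] and [2] identified. The middle factor is different in
kind, since its corner is the vertex [0] of the 3-simplex and not [1]. -/
theorem m_bubble_right {g h' h k' p q : FundamentalGroup M m₀} (e₁ : h' = h⁻¹) (e₂ : p = h⁻¹ * g)
    (e₃ : q = k' * h) (a : PiTwo M m₀) (x : Gamma s g h') (y : Gamma s h k') (z : Gamma s p q) :
    gmul e₁ e₂ e₃ x y (bubble a z) = bubble a (gmul e₁ e₂ e₃ x y z) := by
  obtain ⟨a, rfl⟩ := PiTwo.mk_surjective a
  obtain ⟨ω, hx, hy, hz, hd⟩ := exists_fill_m e₁ e₂ e₃ x y z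
  have hv := hx.vertex_zero
  rw [ContinuousMap.comp_apply, face_vertex] at hv
  obtain ⟨ω', h1, h2⟩ := exists_bubble_fill ω hv a ![1, 0, 1, 2]
  refine m_eq_of_rep e₁ e₂ e₃ ω' ?_ ?_ (hz.bubble (h1 _ (by decide) rfl))
    (hd.bubble (h1 _ (by decide) rfl))
  · rwa [h2 _ ⟨2, by decide⟩]
  · rwa [h2 _ ⟨0, by decide⟩]

/-! ### Maps to the square -/

/-- The point of the square with truncated coordinates `a` and `b`. -/
def sq (a b : ℝ) : Fin 2 → I := ![trunc a, trunc b]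

@[fun_prop]
theorem continuous_sq {Z : Type*} [TopologicalSpace Z] {f g : Z → ℝ} (hf : Continuous f)
    (hg : Continuous g) : Continuous fun z => sq (f z) (g z) := by
  refine continuous_pi fun i => ?_
  fin_cases i
  · change Continuous fun z => trunc (f z); fun_prop
  · change Continuous fun z => trunc (g z); fun_prop

theorem bubbleSquare_eq_sq (p : Δ₂) : bubbleSquare p = sq (4 * p 1 - 1 / 2) (4 * p 2 - 1 / 2) := by
  ext i; fin_cases i <;> rfl

/-- The truncations of two points of the plane lie on a common side of the square. -/
def Side (a b a' b' : ℝ) : Prop :=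
  a ≤ 0 ∧ a' ≤ 0 ∨ 1 ≤ a ∧ 1 ≤ a' ∨ b ≤ 0 ∧ b' ≤ 0 ∨ 1 ≤ b ∧ 1 ≤ b'

/-- A side of the truncated square is the image of a half-plane, which is convex. Straight lines
between untruncated coordinates on a common side thus stay in the boundary, where a spherical map is
constant; this is how all homotopies of inserted spheres below are kept fixed on boundaries. -/
theorem Side.mem_boundary {a b a' b' : ℝ} (h : Side a b a' b') (t : I) :
    sq ((1 - t) * a + t * a') ((1 - t) * b + t * b') ∈ Cube.boundary (Fin 2) := by
  have h0 := t.2.1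
  have h1 : 0 ≤ 1 - (t : ℝ) := by linarith [t.2.2]
  have lo : ∀ {x y : ℝ}, x ≤ 0 → y ≤ 0 → (1 - t) * x + t * y ≤ 0 := fun hx hy =>
    add_nonpos (mul_nonpos_of_nonneg_of_nonpos h1 hx) (mul_nonpos_of_nonneg_of_nonpos h0 hy)
  have hi : ∀ {x y : ℝ}, 1 ≤ x → 1 ≤ y → 1 ≤ (1 - t) * x + t * y := fun hx hy => by
    nlinarith
  rcases h with ⟨h, h'⟩ | ⟨h, h'⟩ | ⟨h, h'⟩ | ⟨h, h'⟩
  · exact ⟨0, .inl (trunc_of_le (lo h h'))⟩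
  · exact ⟨0, .inr (trunc_of_ge (hi h h'))⟩
  · exact ⟨1, .inl (trunc_of_le (lo h h'))⟩
  · exact ⟨1, .inr (trunc_of_ge (hi h h'))⟩

theorem minCoord_le_cases {p : Δ₂} {r : ℝ} (h : minCoord p ≤ r) : p 0 ≤ r ∨ p 1 ≤ r ∨ p 2 ≤ r := by
  simpa only [minCoord, min_le_iff] using h

/-- The coordinates `p i` and `1 - p j` are interchangeable in maps to the square whose other
coordinate is `p k`. -/
theorem side_aux {x y z : ℝ} (hs : x + y + z = 1) (h : x ≤ 1 / 8 ∨ y ≤ 1 / 8 ∨ z ≤ 1 / 8) :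
    Side (4 * x - 1 / 2) (4 * z - 1 / 2) (3 / 2 - 4 * y) (4 * z - 1 / 2) := by
  -- The first coordinates differ by `4 * z - 2`. For `z` at most 1/2 this sign puts both beyond the
  -- same vertical side when `x` or `y` is small; for larger `z` both points are beyond the top
  -- side.
  rcases le_total z (1 / 2) with hz | hz
  · rcases h with h | h | h
    · exact .inl ⟨by linarith, by linarith⟩
    · exact .inr (.inl ⟨by linarith, by linarith⟩)
    · exact .inr (.inr (.inl ⟨by linarith, by linarith⟩))
  · exact .inr (.inr (.inr ⟨by linarith, by linarith⟩))

theorem Side.swap {a b a' b' : ℝ} (h : Side a b a' b') : Side b a b' a' := by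
  unfold Side at *; tauto

theorem Side.flip {a b a' b' : ℝ} (h : Side a b a' b') : Side (1 - a) b (1 - a') b' := by
  rcases h with ⟨h, h'⟩ | ⟨h, h'⟩ | h | h
  · exact .inr (.inl ⟨by linarith, by linarith⟩)
  · exact .inl ⟨by linarith, by linarith⟩
  · exact .inr (.inr (.inl h))
  · exact .inr (.inr (.inr h))

theorem Side.symm {a b a' b' : ℝ} (h : Side a b a' b') : Side a' b' a b := by
  unfold Side at *; tauto

end Bubble

/-! ### Rotating and reflecting a triangle with an inserted sphere -/

section Rotate

variable {M : Type u} [TopologicalSpace M] {m₀ : M} {s : LoopSection M m₀}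

theorem symm_trunc (a : ℝ) : unitInterval.symm (trunc a) = trunc (1 - a) := by
  rcases le_total a 0 with h | h
  · rw [trunc_of_le h, trunc_of_ge (by linarith), unitInterval.symm_zero]
  rcases le_total 1 a with h' | h'
  · rw [trunc_of_ge h', trunc_of_le (by linarith), unitInterval.symm_one]
  · rw [trunc, trunc, Set.projIcc_of_mem _ ⟨h, h'⟩,
      Set.projIcc_of_mem _ (⟨by linarith, by linarith⟩ : 1 - a ∈ Set.Icc (0 : ℝ) 1)]
    rfl

theorem symmAt_zero_sq (a : Ω^ (Fin 2) M m₀) (r t : ℝ) :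
    GenLoop.symmAt 0 a (sq r t) = a (sq (1 - r) t) := by
  change a (fun j => if j = 0 then unitInterval.symm (sq r t 0) else sq r t j) = _
  congr 1
  funext j
  fin_cases j
  · exact symm_trunc r
  · rfl

theorem symmAt_one_sq (a : Ω^ (Fin 2) M m₀) (r t : ℝ) :
    GenLoop.symmAt 1 a (sq r t) = a (sq r (1 - t)) := by
  change a (fun j => if j = 1 then unitInterval.symm (sq r t 1) else sq r t j) = _
  congr 1
  funext j
  fin_cases j
  · rfl
  · exact symm_trunc t

theorem PiTwo.mk_symmAt (i : Fin 2) (a : Ω^ (Fin 2) M m₀) :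
    PiTwo.mk (GenLoop.symmAt i a) = -PiTwo.mk a :=
  (congrArg Additive.ofMul (HomotopyGroup.inv_spec (i := i) (p := a))).symm

theorem exists_insertion {x : C(Δ₂, M)} {v : Δ₂} {F : Δ₂ → M} (hF : Continuous F)
    (hb : ∀ p, minCoord p = 1 / 8 → F p = x v) : ∃ y, IsInsertion y x v F := by
  refine ⟨⟨fun p => if 1 / 8 ≤ minCoord p then F p else x (lerp (pinchRatio p) p v), ?_⟩,
    fun p => rfl⟩
  refine Continuous.if_le hF (by fun_prop) (by fun_prop) (by fun_prop) fun p hp => ?_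
  rw [hb _ hp.symm, pinchRatio_of_le hp.le, lerp_one]

theorem continuous_genLoop_sq {Z : Type*} [TopologicalSpace Z] (a : Ω^ (Fin 2) M m₀) {f g : Z → ℝ}
    (hf : Continuous f) (hg : Continuous g) : Continuous fun z => a (sq (f z) (g z)) :=
  a.1.continuous.comp (continuous_sq hf hg)

/-- Insertions of a sphere by maps to the square that send points to common sides. -/
theorem IsInsertion.homotopicRel_of_side {y₀ y₁ x : C(Δ₂, M)} {v : Δ₂} (hv : x v = m₀)
    {a : Ω^ (Fin 2) M m₀} {f g f' g' : Δ₂ → ℝ} (cf : Continuous f) (cg : Continuous g)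
    (cf' : Continuous f') (cg' : Continuous g')
    (hs : ∀ p, minCoord p = 1 / 8 → Side (f p) (g p) (f' p) (g' p))
    (h₀ : IsInsertion y₀ x v fun p => a (sq (f p) (g p)))
    (h₁ : IsInsertion y₁ x v fun p => a (sq (f' p) (g' p))) : y₀.HomotopicRel y₁ bdry := by
  refine IsInsertion.homotopicRel (x := x) (v := fun _ => v) continuous_const
    (F := fun t p => a (sq ((1 - t) * f p + t * f' p) ((1 - t) * g p + t * g' p)))
    (continuous_genLoop_sq a (by fun_prop) (by fun_prop)) (fun t p hp => ?_) ?_ ?_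
  · rw [GenLoop.boundary a _ ((hs p hp).mem_boundary t), hv]
  · simpa using h₀
  · simpa using h₁

/-- An inserted sphere can be moved along a path. -/
theorem IsInsertion.homotopicRel_transport {y₀ y₁ x : C(Δ₂, M)} {v v' : Δ₂} {γ : Path m₀ m₀}
    (hγ : ∀ t, x (lerp t v v') = γ t) {a : Ω^ (Fin 2) M m₀}
    (h₀ : IsInsertion y₀ x v fun p => a (bubbleSquare p))
    (h₁ : IsInsertion y₁ x v' fun p => transportLoop γ a (bubbleSquare p)) :
    y₀.HomotopicRel y₁ bdry := by
  obtain ⟨H, H0, H1, hb⟩ := freeHomotopic_transportLoop γ a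
  refine IsInsertion.homotopicRel (x := x) (v := fun t => lerp t v v') (by fun_prop)
    (F := fun t p => H (t, bubbleSquare p)) (by fun_prop) (fun t p hp => ?_) ?_ ?_
  · rw [hb _ _ (bubbleSquare_mem hp), hγ]
  · simpa only [lerp_zero, H0] using h₀
  · simpa only [lerp_one, H1] using h₁

theorem IsInsertion.comp_face {y x : C(Δ₂, M)} {i : Fin 3} {F : Δ₂ → M}
    (h : IsInsertion y x (stdSimplex.vertex i) F) {f : Fin 3 → Fin 3}
    (hf : ∀ p, minCoord (face f p) = minCoord p) {j : Fin 3} (hj : f j = i) :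
    IsInsertion (y.comp (face f)) (x.comp (face f)) (stdSimplex.vertex j) fun p => F (face f p) := by
  intro p
  have e : pinchRatio (face f p) = pinchRatio p := by rw [pinchRatio, hf]; rfl
  rw [ContinuousMap.comp_apply, h, hf, ContinuousMap.comp_apply, face_lerp, face_vertex, hj, e]

theorem minCoord_rotate (p : Δ₂) : minCoord (face ![1, 2, 0] p) = minCoord p := by
  simp only [minCoord, face_apply]
  simp
  rw [min_comm, min_assoc]

theorem minCoord_reflect (p : Δ₂) : minCoord (face ![1, 0, 2] p) = minCoord p := by
  simp only [minCoord, face_apply]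
  simp
  rw [← min_assoc, min_comm (p 1), min_assoc]

/-- The reflection puts the sphere at the vertex [1] with coordinates 0 and 2 in place of 1 and 2.
Replacing coordinate 0 by the complement of coordinate 1 exhibits it as a reflected sphere, and
moving it back to [0] runs through the edge labelled `g⁻¹` backwards, that is, along the loop of
`g`. -/
theorem bubbleTriangle_Q {g h : FundamentalGroup M m₀} (a : Ω^ (Fin 2) M m₀)
    (x : Triangle s g h) : (bubbleTriangle a x).Q.1.HomotopicRel
      (bubbleTriangle (transportLoop (s.loop g) (GenLoop.symmAt 0 a)) x.Q).1 bdry := by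
  have h₀ : IsInsertion (bubbleTriangle a x).Q.1 x.Q.1 (stdSimplex.vertex 1)
      fun p => a (sq (4 * p 0 - 1 / 2) (4 * p 2 - 1 / 2)) := by
    intro p
    refine ((isInsertion_bubbleTriangle a x).comp_face minCoord_reflect (j := 1) rfl p).trans ?_
    simp only [bubbleSquare_eq_sq]
    simp [face_apply, Triangle.Q]
  have hv : x.Q.1 (stdSimplex.vertex 1) = m₀ := by
    change x.1 (face _ _) = _
    rw [face_vertex]
    exact x.vertex_zero
  obtain ⟨y, hy⟩ := exists_insertion (x := x.Q.1) (v := stdSimplex.vertex 1)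
    (F := fun p => a (sq (3 / 2 - 4 * p 1) (4 * p 2 - 1 / 2)))
    (continuous_genLoop_sq a (by fun_prop) (by fun_prop)) fun p hp => by
      rw [hv]
      have h := (side_aux (Δ₂.sum p) (minCoord_le_cases hp.le)).mem_boundary 1
      simp only [Set.Icc.coe_one, sub_self, zero_mul, one_mul, zero_add] at h
      exact GenLoop.boundary a _ h
  refine (IsInsertion.homotopicRel_of_side hv (by fun_prop) (by fun_prop) (by fun_prop)
    (by fun_prop) (fun p hp => side_aux (Δ₂.sum p) (minCoord_le_cases hp.le)) h₀ hy).trans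
    (IsInsertion.homotopicRel_transport (v := stdSimplex.vertex 1) (fun t => ?_) ?_
      (isInsertion_bubbleTriangle _ x.Q))
  · rw [x.Q.2.1 _ (by simp [lerp_apply])]
    refine loop_inv_apply s g ?_
    simp [coord, lerp_apply]
  · intro p
    refine (hy p).trans ?_
    simp only [bubbleSquare_eq_sq, symmAt_zero_sq]
    ring_nf

/-- After the rotation the sphere sits at the vertex [2] with coordinates 0 and 1. Two replacements
of coordinates by complements turn it into the half-turn of the sphere in the standard position.
Since a half-turn consists of two reflections, no sign remains, in contrast to the case of Q; moving
the sphere back to [0] contributes the action of `g`. -/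
theorem bubbleTriangle_P {g h : FundamentalGroup M m₀} (a : Ω^ (Fin 2) M m₀)
    (x : Triangle s g h) : (bubbleTriangle a x).P.1.HomotopicRel
      (bubbleTriangle (transportLoop (s.loop g) (GenLoop.symmAt 1 (GenLoop.symmAt 0 a))) x.P).1
      bdry := by
  have h₀ : IsInsertion (bubbleTriangle a x).P.1 x.P.1 (stdSimplex.vertex 2)
      fun p => a (sq (4 * p 0 - 1 / 2) (4 * p 1 - 1 / 2)) := by
    intro p
    refine ((isInsertion_bubbleTriangle a x).comp_face minCoord_rotate (j := 2) rfl p).trans ?_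
    simp only [bubbleSquare_eq_sq]
    simp [face_apply, Triangle.P]
  have hv : x.P.1 (stdSimplex.vertex 2) = m₀ := by
    change x.1 (face _ _) = _
    rw [face_vertex]
    exact x.vertex_zero
  have s₁ : ∀ p : Δ₂, minCoord p = 1 / 8 → Side (4 * p 0 - 1 / 2) (4 * p 1 - 1 / 2)
      (4 * p 0 - 1 / 2) (3 / 2 - 4 * p 2) := fun p hp => by
    have := minCoord_le_cases hp.le
    exact (side_aux (x := p 1) (y := p 2) (z := p 0) (by linarith [Δ₂.sum p]) (by tauto)).swap
  have s₂ : ∀ p : Δ₂, minCoord p = 1 / 8 → Side (4 * p 0 - 1 / 2) (3 / 2 - 4 * p 2)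
      (3 / 2 - 4 * p 1) (3 / 2 - 4 * p 2) := fun p hp => by
    have h := (side_aux (Δ₂.sum p) (minCoord_le_cases hp.le)).swap.flip.swap
    rwa [show 1 - (4 * p 2 - 1 / 2) = 3 / 2 - 4 * p 2 by ring] at h
  obtain ⟨y₁, hy₁⟩ := exists_insertion (x := x.P.1) (v := stdSimplex.vertex 2)
    (F := fun p => a (sq (4 * p 0 - 1 / 2) (3 / 2 - 4 * p 2)))
    (continuous_genLoop_sq a (by fun_prop) (by fun_prop)) fun p hp => by
      rw [hv]
      have h := (s₂ p hp).mem_boundary 0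
      simp only [Set.Icc.coe_zero, sub_zero, zero_mul, one_mul, add_zero] at h
      exact GenLoop.boundary a _ h
  obtain ⟨y₂, hy₂⟩ := exists_insertion (x := x.P.1) (v := stdSimplex.vertex 2)
    (F := fun p => a (sq (3 / 2 - 4 * p 1) (3 / 2 - 4 * p 2)))
    (continuous_genLoop_sq a (by fun_prop) (by fun_prop)) fun p hp => by
      rw [hv]
      have h := (s₂ p hp).mem_boundary 1
      simp only [Set.Icc.coe_one, sub_self, zero_mul, one_mul, zero_add] at h
      exact GenLoop.boundary a _ h
  refine ((IsInsertion.homotopicRel_of_side hv (by fun_prop) (by fun_prop) (by fun_prop)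
    (by fun_prop) s₁ h₀ hy₁).trans (IsInsertion.homotopicRel_of_side hv (by fun_prop)
    (by fun_prop) (by fun_prop) (by fun_prop) s₂ hy₁ hy₂)).trans
    (IsInsertion.homotopicRel_transport (v := stdSimplex.vertex 2) (fun t => ?_) ?_
      (isInsertion_bubbleTriangle _ x.P))
  · rw [x.P.2.2.2 _ (by simp [lerp_apply]), inv_mul_cancel_right]
    refine loop_inv_apply s g ?_
    simp [coord, lerp_apply]
  · intro p
    refine (hy₂ p).trans ?_
    simp only [bubbleSquare_eq_sq, symmAt_one_sq, symmAt_zero_sq]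
    ring_nf

theorem smul_mk (g : FundamentalGroup M m₀) (a : Ω^ (Fin 2) M m₀) :
    g • PiTwo.mk a = PiTwo.mk (transportLoop (s.loop g) a) := by
  rw [smul_def, ← s.class_loop g, transport_mk]

theorem bubble_P {g h : FundamentalGroup M m₀} (a : PiTwo M m₀) (x : Gamma s g h) :
    (bubble a x).P = bubble (g • a) x.P := by
  obtain ⟨a, rfl⟩ := PiTwo.mk_surjective a
  obtain ⟨x, rfl⟩ := Gamma.exists_rep x
  have e : PiTwo.mk a = PiTwo.mk (GenLoop.symmAt 1 (GenLoop.symmAt 0 a)) := by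
    rw [PiTwo.mk_symmAt, PiTwo.mk_symmAt, neg_neg]
  refine Eq.trans ?_ (congrArg (bubble · (Gamma.mk x).P)
    ((congrArg (g • ·) e).trans (smul_mk (s := s) g _)).symm)
  exact Quotient.sound (bubbleTriangle_P a x)

theorem bubble_Q {g h : FundamentalGroup M m₀} (a : PiTwo M m₀) (x : Gamma s g h) :
    (bubble a x).Q = bubble (-(g • a)) x.Q := by
  obtain ⟨a, rfl⟩ := PiTwo.mk_surjective a
  obtain ⟨x, rfl⟩ := Gamma.exists_rep x
  rw [← smul_neg, ← PiTwo.mk_symmAt 0]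
  refine Eq.trans ?_ (congrArg (bubble · (Gamma.mk x).Q) (smul_mk (s := s) g _).symm)
  exact Quotient.sound (bubbleTriangle_Q a x)

end Rotate

/-! ### Gluing spheres is a simply transitive action -/

section Torsor

variable {M : Type u} [TopologicalSpace M] {m₀ : M} {s : LoopSection M m₀}

theorem Rep.congr {g h : FundamentalGroup M m₀} {x : Gamma s g h} {t t' : C(Δ₂, M)} (hx : Rep x t)
    (ht : t.HomotopicRel t' bdry) : Rep x t' := by
  obtain ⟨a, rfl, rfl⟩ := hx
  have e : ∀ p ∈ bdry, t' p = a.1 p := fun p hp => (ht.some.eq_snd 0 hp).symm.trans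
    (ht.some.apply_zero p)
  refine ⟨⟨t', fun p hp => (e p ⟨2, hp⟩).trans (a.2.1 p hp),
    fun p hp => (e p ⟨0, hp⟩).trans (a.2.2.1 p hp),
    fun p hp => (e p ⟨1, hp⟩).trans (a.2.2.2 p hp)⟩, Quotient.sound ht.symm, rfl⟩

/-- The degenerate singular 2-simplex with edges labelled `1`, `l` and `l`. -/
def degen (s : LoopSection M m₀) (l : FundamentalGroup M m₀) : Triangle s 1 l :=
  ⟨⟨fun p => s.loop l (coord p 2), by fun_prop⟩, fun p hp => by
    have e : coord p 2 = 0 := Subtype.ext hp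
    change s.loop l (coord p 2) = _
    rw [e, Path.source, s.loop_one, Path.refl_apply], fun p _ => rfl, fun p _ => by
    rw [mul_one]; rfl⟩

/-- The degenerate singular 2-simplex with edges labelled `g`, `g⁻¹` and `1`. -/
def degen' (s : LoopSection M m₀) (g : FundamentalGroup M m₀) : Triangle s g g⁻¹ :=
  ⟨⟨fun p => s.loop g (coord p 1), by fun_prop⟩, fun p _ => rfl, fun p hp => by
    change s.loop g (coord p 1) = _
    refine (loop_inv_apply s g ?_).symm
    change p 2 + p 1 = 1
    linarith [Δ₂.sum p], fun p hp => by
    have e : coord p 1 = 0 := Subtype.ext hp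
    change s.loop g (coord p 1) = _
    rw [e, Path.source, inv_mul_cancel, s.loop_one, Path.refl_apply]⟩

theorem degen_one_apply (p : Δ₂) : (degen s 1).1 p = m₀ := by
  change s.loop 1 _ = _
  rw [s.loop_one, Path.refl_apply]

/-- The composition of a map of the square with a map to the square. -/
def sqMap {X : Type*} [TopologicalSpace X] (a : Ω^ (Fin 2) M m₀) (f g : X → ℝ)
    (cf : Continuous f) (cg : Continuous g) : C(X, M) :=
  ⟨fun x => a (sq (f x) (g x)), continuous_genLoop_sq a cf cg⟩

theorem sqMap_homotopicRel {X : Type*} [TopologicalSpace X] {S : Set X} (a : Ω^ (Fin 2) M m₀)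
    {f g f' g' : X → ℝ} (cf : Continuous f) (cg : Continuous g) (cf' : Continuous f')
    (cg' : Continuous g') (hs : ∀ x ∈ S, Side (f x) (g x) (f' x) (g' x)) :
    (sqMap a f g cf cg).HomotopicRel (sqMap a f' g' cf' cg') S := by
  refine ⟨⟨⟨⟨fun w => a (sq ((1 - w.1) * f w.2 + w.1 * f' w.2) ((1 - w.1) * g w.2 + w.1 * g' w.2)),
    continuous_genLoop_sq a (by fun_prop) (by fun_prop)⟩, fun x => ?_, fun x => ?_⟩,
    fun t x hx => ?_⟩⟩
  · simp [sqMap]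
  · simp [sqMap]
  · have h0 := (hs x hx).mem_boundary 0
    simp only [Set.Icc.coe_zero, sub_zero, zero_mul, one_mul, add_zero] at h0
    exact (GenLoop.boundary a _ ((hs x hx).mem_boundary t)).trans (GenLoop.boundary a _ h0).symm

/-- Since the simplex is constant, the collar is constant as well, and `bubbleSquare` maps the
collar to the boundary of the square. So no case distinction is needed: the formula for the inserted
sphere holds on the whole triangle. -/
theorem rep_bubble_degen_one (a : Ω^ (Fin 2) M m₀) :
    Rep (bubble (PiTwo.mk a) (Gamma.mk (degen s 1)))
      (sqMap a (fun p : Δ₂ => 4 * p 1 - 1 / 2) (fun p => 4 * p 2 - 1 / 2) (by fun_prop)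
        (by fun_prop)) := by
  refine (rep_mk (degen s 1)).bubble fun p => ?_
  change a (sq _ _) = _
  rw [degen_one_apply, ← bubbleSquare_eq_sq]
  split_ifs with h
  · rfl
  · have := minCoord_le_cases (not_le.1 h).le
    have h := (side_aux (x := p 1) (y := p 0) (z := p 2) (by linarith [Δ₂.sum p])
      (by tauto)).mem_boundary 0
    simp only [Set.Icc.coe_zero, sub_zero, zero_mul, one_mul, add_zero] at h
    rw [bubbleSquare_eq_sq]
    exact GenLoop.boundary a _ h

/-- A homeomorphism of the square with the 2-simplex. -/
def squareToSimplex (z : Fin 2 → I) : Δ₂ :=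
  pt (1 - max (z 0 : ℝ) (z 1)) (z 0 - min (z 0 : ℝ) (z 1) / 2) (z 1 - min (z 0 : ℝ) (z 1) / 2)
    (sub_nonneg.2 (max_le (z 0).2.2 (z 1).2.2))
    (by linarith [min_le_left (z 0 : ℝ) (z 1), (z 0).2.1])
    (by linarith [min_le_right (z 0 : ℝ) (z 1), (z 1).2.1])
    (by linarith [max_add_min (z 0 : ℝ) (z 1)])

theorem continuous_squareToSimplex : Continuous squareToSimplex :=
  continuous_pt _ _ _ _ (by fun_prop) (by fun_prop) (by fun_prop)

theorem squareToSimplex_zero {z : Fin 2 → I} (h : z 0 = 1 ∨ z 1 = 1) : squareToSimplex z 0 = 0 := by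
  change 1 - max (z 0 : ℝ) (z 1) = 0
  rcases h with h | h <;> rw [h, Set.Icc.coe_one]
  · rw [max_eq_left (z 1).2.2]; simp
  · rw [max_eq_right (z 0).2.2]; simp

theorem squareToSimplex_one {z : Fin 2 → I} (h : z 0 = 0) : squareToSimplex z 1 = 0 := by
  change (z 0 : ℝ) - min (z 0 : ℝ) (z 1) / 2 = 0
  rw [h, Set.Icc.coe_zero, min_eq_left (z 1).2.1]; simp

theorem squareToSimplex_two {z : Fin 2 → I} (h : z 1 = 0) : squareToSimplex z 2 = 0 := by
  change (z 1 : ℝ) - min (z 0 : ℝ) (z 1) / 2 = 0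
  rw [h, Set.Icc.coe_zero, min_eq_right (z 0).2.1]; simp

theorem squareToSimplex_mem_bdry {z : Fin 2 → I} (h : z ∈ Cube.boundary (Fin 2)) :
    squareToSimplex z ∈ bdry := by
  obtain ⟨i, h⟩ := h
  fin_cases i <;> rcases h with h | h
  · exact ⟨1, squareToSimplex_one h⟩
  · exact ⟨0, squareToSimplex_zero (.inl h)⟩
  · exact ⟨2, squareToSimplex_two h⟩
  · exact ⟨0, squareToSimplex_zero (.inr h)⟩

theorem sq_coe (z : Fin 2 → I) : sq (z 0) (z 1) = z := by
  ext i; fin_cases i <;> simp [sq]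

/-- Going from the square to the triangle and back by truncated coordinates maps each side of the
square to itself, so straight lines connect the composite with the identity. This recovers a sphere
from its gluing to the constant triangle. -/
theorem genLoop_homotopic_squareToSimplex (a : Ω^ (Fin 2) M m₀) :
    a.1.HomotopicRel ((sqMap a (fun p : Δ₂ => 4 * p 1 - 1 / 2) (fun p => 4 * p 2 - 1 / 2)
      (by fun_prop) (by fun_prop)).comp ⟨squareToSimplex, continuous_squareToSimplex⟩)
      (Cube.boundary (Fin 2)) := by
  have h := sqMap_homotopicRel (S := Cube.boundary (Fin 2)) a (f := fun z => z 0)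
    (g := fun z => z 1) (f' := fun z => 4 * squareToSimplex z 1 - 1 / 2)
    (g' := fun z => 4 * squareToSimplex z 2 - 1 / 2) (by fun_prop) (by fun_prop)
    (by have := continuous_squareToSimplex; fun_prop)
    (by have := continuous_squareToSimplex; fun_prop) (by
      rintro z ⟨i, h⟩
      have h1 : squareToSimplex z 1 = z 0 - min (z 0 : ℝ) (z 1) / 2 := rfl
      have h2 : squareToSimplex z 2 = z 1 - min (z 0 : ℝ) (z 1) / 2 := rfl
      have l0 := min_le_left (z 0 : ℝ) (z 1)
      have l1 := min_le_right (z 0 : ℝ) (z 1)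
      have k0 := (z 0).2.2
      have k1 := (z 1).2.2
      fin_cases i <;> rcases h with h | h
      · have e : (z 0 : ℝ) = 0 := congrArg Subtype.val h
        exact .inl ⟨e.le, by rw [squareToSimplex_one h]; norm_num⟩
      · have e : (z 0 : ℝ) = 1 := congrArg Subtype.val h
        exact .inr (.inl ⟨e.ge, by rw [h1]; linarith⟩)
      · have e : (z 1 : ℝ) = 0 := congrArg Subtype.val h
        exact .inr (.inr (.inl ⟨e.le, by rw [squareToSimplex_two h]; norm_num⟩))
      · have e : (z 1 : ℝ) = 1 := congrArg Subtype.val h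
        exact .inr (.inr (.inr ⟨e.ge, by rw [h2]; linarith⟩)))
  have e : sqMap a (fun z => (z 0 : ℝ)) (fun z => (z 1 : ℝ)) (by fun_prop) (by fun_prop) = a.1 :=
    ContinuousMap.ext fun z => congrArg a (sq_coe z)
  rw [e] at h
  exact h

theorem HomotopicRel_comp_squareToSimplex {t t' : C(Δ₂, M)} (h : t.HomotopicRel t' bdry) :
    (t.comp ⟨squareToSimplex, continuous_squareToSimplex⟩).HomotopicRel
      (t'.comp ⟨squareToSimplex, continuous_squareToSimplex⟩) (Cube.boundary (Fin 2)) := by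
  obtain ⟨H⟩ := h
  have c := continuous_squareToSimplex
  exact ⟨⟨⟨⟨fun w => H (w.1, squareToSimplex w.2), by fun_prop⟩, fun z => H.apply_zero _,
    fun z => H.apply_one _⟩, fun r z hz => H.eq_fst r (squareToSimplex_mem_bdry hz)⟩⟩

theorem Triangle.apply_of_mem_bdry (b : Triangle s 1 1) {p : Δ₂} (hp : p ∈ bdry) : b.1 p = m₀ := by
  obtain ⟨i, hi⟩ := hp
  fin_cases i
  · rw [b.2.2.1 _ hi, s.loop_one]; rfl
  · rw [b.2.2.2 _ hi, mul_one, s.loop_one]; rfl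
  · rw [b.2.1 _ hi, s.loop_one]; rfl

/-- The singular 2-simplices with constant boundary as maps of the square. -/
def Triangle.toLoop (b : Triangle s 1 1) : Ω^ (Fin 2) M m₀ :=
  ⟨b.1.comp ⟨squareToSimplex, continuous_squareToSimplex⟩, fun _ hz =>
    b.apply_of_mem_bdry (squareToSimplex_mem_bdry hz)⟩

/-- Conversely, the composite of triangle, square and triangle preserves each edge, and straight
lines to the identity stay in that edge, where the triangle takes the constant value `m₀`. -/
theorem Triangle.mk_eq_bubble (b : Triangle s 1 1) :
    Gamma.mk b = bubble (PiTwo.mk b.toLoop) (Gamma.mk (degen s 1)) := by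
  refine (rep_mk b).eq_of_homotopicRel (rep_bubble_degen_one b.toLoop) ?_
  have c := continuous_squareToSimplex
  have cs : Continuous fun p : Δ₂ => squareToSimplex (sq (4 * p 1 - 1 / 2) (4 * p 2 - 1 / 2)) := by
    fun_prop
  refine ⟨⟨⟨⟨fun w => b.1 (lerp w.1 w.2
    (squareToSimplex (sq (4 * w.2 1 - 1 / 2) (4 * w.2 2 - 1 / 2)))),
    b.1.continuous.comp (by fun_prop)⟩, fun p => ?_, fun p => ?_⟩, fun r p hp => ?_⟩⟩
  · simp only [lerp_zero]
  · simp only [lerp_one]; rfl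
  · rw [b.apply_of_mem_bdry hp]
    refine b.apply_of_mem_bdry ?_
    obtain ⟨i, hi⟩ := hp
    refine ⟨i, ?_⟩
    rw [lerp_apply, hi]
    suffices h : squareToSimplex (sq (4 * p 1 - 1 / 2) (4 * p 2 - 1 / 2)) i = 0 by
      change _ + (r : ℝ) * squareToSimplex (sq (4 * p 1 - 1 / 2) (4 * p 2 - 1 / 2)) i = 0
      rw [h]; ring
    have hs := Δ₂.sum p
    fin_cases i
    · replace hi : p 0 = 0 := hi
      refine squareToSimplex_zero ?_
      rcases le_total (p 1) (p 2) with h | h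
      · exact .inr (trunc_of_ge (by linarith))
      · exact .inl (trunc_of_ge (by linarith))
    · replace hi : p 1 = 0 := hi
      exact squareToSimplex_one (trunc_of_le (by linarith))
    · replace hi : p 2 = 0 := hi
      exact squareToSimplex_two (trunc_of_le (by linarith))

theorem bubble_degen_one_injective {a b : PiTwo M m₀}
    (h : bubble a (Gamma.mk (degen s 1)) = bubble b (Gamma.mk (degen s 1))) : a = b := by
  obtain ⟨a, rfl⟩ := PiTwo.mk_surjective a
  obtain ⟨b, rfl⟩ := PiTwo.mk_surjective b
  obtain ⟨ta, ha, ha'⟩ := rep_bubble_degen_one (s := s) a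
  obtain ⟨tb, hb, hb'⟩ := rep_bubble_degen_one (s := s) b
  rw [← ha, ← hb] at h
  have h' : ta.1.HomotopicRel tb.1 bdry := Quotient.exact h
  rw [ha', hb'] at h'
  exact PiTwo.mk_eq.2 (((genLoop_homotopic_squareToSimplex a).trans
    (HomotopicRel_comp_squareToSimplex h')).trans (genLoop_homotopic_squareToSimplex b).symm)

theorem exists_bubble_degen_one (x : Gamma s 1 1) : ∃ a, bubble a (Gamma.mk (degen s 1)) = x := by
  obtain ⟨b, rfl⟩ := Gamma.exists_rep x
  exact ⟨_, b.mk_eq_bubble.symm⟩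

theorem transAt_sq_of_le (a b : Ω^ (Fin 2) M m₀) {r : ℝ} (t : ℝ) (h : r ≤ 1 / 2) :
    GenLoop.transAt 0 a b (sq r t) = a (sq (2 * r) t) := by
  have h' : ((trunc r : I) : ℝ) ≤ 1 / 2 := by
    rw [trunc, Set.coe_projIcc]
    exact max_le (by norm_num) ((min_le_right _ _).trans h)
  change (if ((trunc r : I) : ℝ) ≤ 1 / 2 then
    a (Function.update (sq r t) 0 (trunc (2 * (trunc r : I)))) else _) = _
  rw [if_pos h']
  congr 1
  funext i
  fin_cases i
  · change trunc (2 * (trunc r : I)) = trunc (2 * r)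
    rcases le_total r 0 with h0 | h0
    · rw [trunc_of_le h0, trunc_of_le (by simp), trunc_of_le (by linarith)]
    · rw [show ((trunc r : I) : ℝ) = r from congrArg Subtype.val
        (Set.projIcc_of_mem zero_le_one ⟨h0, by linarith⟩)]
  · rfl

theorem transAt_sq_of_ge (a b : Ω^ (Fin 2) M m₀) {r : ℝ} (t : ℝ) (h : 1 / 2 ≤ r) :
    GenLoop.transAt 0 a b (sq r t) = b (sq (2 * r - 1) t) := by
  rcases h.eq_or_lt with rfl | h
  · rw [transAt_sq_of_le a b t le_rfl, GenLoop.boundary a _ ⟨0, .inr (trunc_of_ge (by norm_num))⟩,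
      GenLoop.boundary b _ ⟨0, .inl (trunc_of_le (by norm_num))⟩]
  have h' : ¬ ((trunc r : I) : ℝ) ≤ 1 / 2 := by
    rw [trunc, Set.coe_projIcc, not_le]
    exact lt_max_of_lt_right (lt_min (by norm_num) h)
  change (if ((trunc r : I) : ℝ) ≤ 1 / 2 then _ else
    b (Function.update (sq r t) 0 (trunc (2 * (trunc r : I) - 1)))) = _
  rw [if_neg h']
  congr 1
  funext i
  fin_cases i
  · change trunc (2 * (trunc r : I) - 1) = trunc (2 * r - 1)
    rcases le_total 1 r with h0 | h0
    · rw [trunc_of_ge h0, trunc_of_ge (by simp; norm_num), trunc_of_ge (by linarith)]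
    · rw [show ((trunc r : I) : ℝ) = r from congrArg Subtype.val
        (Set.projIcc_of_mem zero_le_one ⟨by linarith, h0⟩)]
  · rfl

end Torsor

/-! ### From the constant triangle to all triangles -/

section Action

variable {M : Type u} [TopologicalSpace M] {m₀ : M} {s : LoopSection M m₀}

theorem mem_bdry_cases {p : Δ₂} (hp : p ∈ bdry) : p 0 = 0 ∨ p 1 = 0 ∨ p 2 = 0 := by
  obtain ⟨i, hi⟩ := hp
  fin_cases i
  · exact .inl hi
  · exact .inr (.inl hi)
  · exact .inr (.inr hi)

/-- The product of two spheres, as the fourth face of a singular 3-simplex. -/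
theorem m_degen_one_bubble (a b : Ω^ (Fin 2) M m₀) :
    gmul (s := s) (g := 1) (h' := 1) (h := 1) (k' := 1) (p := 1) (q := 1) inv_one.symm
      (by rw [inv_one, mul_one]) (mul_one 1).symm (bubble (PiTwo.mk a) (Gamma.mk (degen s 1)))
      (bubble (PiTwo.mk b) (Gamma.mk (degen s 1))) (Gamma.mk (degen s 1)) =
    bubble (PiTwo.mk (GenLoop.transAt 0 a b)) (Gamma.mk (degen s 1)) := by
  have rho : ∀ p : Δ₂, p ∈ bdry → Side (4 * p 1 - 1 / 2) (4 * p 2 - 1 / 2) (3 / 2 - 4 * p 0)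
      (4 * p 2 - 1 / 2) := fun p hp =>
    side_aux (x := p 1) (y := p 0) (z := p 2) (by linarith [Δ₂.sum p]) (by
      rcases mem_bdry_cases hp with h | h | h
      · exact .inr (.inl (by linarith))
      · exact .inl (by linarith)
      · exact .inr (.inr (by linarith)))
  let L := GenLoop.transAt 0 a b
  -- The first coordinate is at most 1/2 on the face `q 3 = 0` and at least 1/2 on the face `q 1 =
  -- 0`, so that these faces see only `a` and only `b`. The second coordinate is chosen such that
  -- the face `q 2 = 0` goes to the boundary of the square, while the face `q 0 = 0` sees the whole
  -- concatenation.
  refine m_eq_of_rep _ _ _ (sqMap L (fun q : Δ₃ => 1 / 2 + 8 * (q 3 - q 1))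
    (fun q => 8 * q 3 + 4 * q 0 - 1 / 2) (by fun_prop) (by fun_prop)) ?_ ?_ ?_ ?_
  · have e : (sqMap L (fun q : Δ₃ => 1 / 2 + 8 * (q 3 - q 1)) (fun q => 8 * q 3 + 4 * q 0 - 1 / 2)
        (by fun_prop) (by fun_prop)).comp (face ![1, 2, 0]) = sqMap a (fun r : Δ₂ => 1 - 16 * r 0)
        (fun r => 4 * r 2 - 1 / 2) (by fun_prop) (by fun_prop) := by
      ext r
      change L (sq (1 / 2 + 8 * (face ![1, 2, 0] r 3 - face ![1, 2, 0] r 1))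
        (8 * face ![1, 2, 0] r 3 + 4 * face ![1, 2, 0] r 0 - 1 / 2)) = a _
      have h0 := stdSimplex.zero_le r 0
      simp only [face_apply]
      simp
      rw [transAt_sq_of_le a b _ (by norm_num)]
      ring_nf
    rw [e]
    refine ((rep_bubble_degen_one a).congr (sqMap_homotopicRel a _ _ (by fun_prop) (by fun_prop)
      rho)).congr (sqMap_homotopicRel a _ _ _ _ fun r hr => ?_)
    have hs := Δ₂.sum r
    rcases mem_bdry_cases hr with h | h | h
    · exact .inr (.inl ⟨by linarith, by linarith⟩)
    · rcases le_total (3 / 8) (r 2) with h' | h'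
      · exact .inr (.inr (.inr ⟨by linarith, by linarith⟩))
      · exact .inl ⟨by linarith, by linarith⟩
    · exact .inr (.inr (.inl ⟨by linarith, by linarith⟩))
  · have e : (sqMap L (fun q : Δ₃ => 1 / 2 + 8 * (q 3 - q 1)) (fun q => 8 * q 3 + 4 * q 0 - 1 / 2)
        (by fun_prop) (by fun_prop)).comp (face ![0, 2, 3]) = sqMap b (fun r : Δ₂ => 16 * r 2)
        (fun r => 8 * r 2 + 4 * r 0 - 1 / 2) (by fun_prop) (by fun_prop) := by
      ext r
      change L (sq (1 / 2 + 8 * (face ![0, 2, 3] r 3 - face ![0, 2, 3] r 1))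
        (8 * face ![0, 2, 3] r 3 + 4 * face ![0, 2, 3] r 0 - 1 / 2)) = b _
      have h0 := stdSimplex.zero_le r 2
      simp only [face_apply]
      simp
      rw [transAt_sq_of_ge a b _ (by norm_num)]
      ring_nf
    rw [e]
    -- On this face the square appears turned by a half-turn, which does not change its class. The
    -- five moves `s₁` to `s₅` then change one coordinate at a time, each within common sides of the
    -- square on the boundary of the triangle.
    have e' : PiTwo.mk b = PiTwo.mk (GenLoop.symmAt 1 (GenLoop.symmAt 0 b)) := by
      rw [PiTwo.mk_symmAt, PiTwo.mk_symmAt, neg_neg]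
    have e'' : sqMap (GenLoop.symmAt 1 (GenLoop.symmAt 0 b)) (fun p : Δ₂ => 4 * p 1 - 1 / 2)
        (fun p => 4 * p 2 - 1 / 2) (by fun_prop) (by fun_prop) =
        sqMap b (fun p : Δ₂ => 1 - (4 * p 1 - 1 / 2)) (fun p => 1 - (4 * p 2 - 1 / 2))
          (by fun_prop) (by fun_prop) := by
      ext r
      change GenLoop.symmAt 1 (GenLoop.symmAt 0 b) (sq _ _) = _
      rw [symmAt_one_sq, symmAt_zero_sq]
      rfl
    have r0 := rep_bubble_degen_one (s := s) (GenLoop.symmAt 1 (GenLoop.symmAt 0 b))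
    rw [← e', e''] at r0
    have hc : ∀ {r : Δ₂}, r ∈ bdry → r 0 ≤ 1 / 8 ∨ r 1 ≤ 1 / 8 ∨ r 2 ≤ 1 / 8 := fun hr => by
      rcases mem_bdry_cases hr with h | h | h
      · exact .inl (by linarith)
      · exact .inr (.inl (by linarith))
      · exact .inr (.inr (by linarith))
    have s₁ : ∀ r : Δ₂, r ∈ bdry → Side (1 - (4 * r 1 - 1 / 2)) (1 - (4 * r 2 - 1 / 2))
        (1 - (4 * r 1 - 1 / 2)) (4 * r 0 - 1 / 2) := fun r hr => by
      have := hc hr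
      have h := (side_aux (x := r 0) (y := r 2) (z := r 1) (by linarith [Δ₂.sum r])
        (by tauto)).swap.flip.symm
      rwa [show 1 - (4 * r 2 - 1 / 2) = 3 / 2 - 4 * r 2 by ring]
    have s₂ : ∀ r : Δ₂, r ∈ bdry → Side (1 - (4 * r 1 - 1 / 2)) (4 * r 0 - 1 / 2)
        (4 * r 2 - 1 / 2) (4 * r 0 - 1 / 2) := fun r hr => by
      have := hc hr
      have h := (side_aux (x := r 2) (y := r 1) (z := r 0) (by linarith [Δ₂.sum r])
        (by tauto)).symm
      rwa [show 1 - (4 * r 1 - 1 / 2) = 3 / 2 - 4 * r 1 by ring]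
    have s₃ : ∀ r : Δ₂, r ∈ bdry → Side (4 * r 2 - 1 / 2) (4 * r 0 - 1 / 2)
        (4 * r 2 - 1 / 2) (3 / 2 - 4 * r 1) := fun r hr => by
      have := hc hr
      exact (side_aux (x := r 0) (y := r 1) (z := r 2) (by linarith [Δ₂.sum r]) (by tauto)).swap
    have s₄ : ∀ r : Δ₂, r ∈ bdry → Side (4 * r 2 - 1 / 2) (3 / 2 - 4 * r 1)
        (16 * r 2) (3 / 2 - 4 * r 1) := fun r hr => by
      have hs := Δ₂.sum r
      rcases mem_bdry_cases hr with h | h | h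
      · rcases le_total (3 / 8) (r 2) with h' | h'
        · exact .inr (.inl ⟨by linarith, by linarith⟩)
        · exact .inr (.inr (.inl ⟨by linarith, by linarith⟩))
      · exact .inr (.inr (.inr ⟨by linarith, by linarith⟩))
      · exact .inl ⟨by linarith, by linarith⟩
    have s₅ : ∀ r : Δ₂, r ∈ bdry → Side (16 * r 2) (3 / 2 - 4 * r 1)
        (16 * r 2) (8 * r 2 + 4 * r 0 - 1 / 2) := fun r hr => by
      have hs := Δ₂.sum r
      have := stdSimplex.zero_le r 2
      rcases mem_bdry_cases hr with h | h | h
      · rcases le_total (1 / 16) (r 2) with h' | h'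
        · exact .inr (.inl ⟨by linarith, by linarith⟩)
        · exact .inr (.inr (.inl ⟨by linarith, by linarith⟩))
      · exact .inr (.inr (.inr ⟨by linarith, by linarith⟩))
      · exact .inl ⟨by linarith, by linarith⟩
    exact ((((r0.congr (sqMap_homotopicRel b _ _ (by fun_prop) (by fun_prop) s₁)).congr
      (sqMap_homotopicRel b _ _ (by fun_prop) (by fun_prop) s₂)).congr
      (sqMap_homotopicRel b _ _ (by fun_prop) (by fun_prop) s₃)).congr
      (sqMap_homotopicRel b _ _ (by fun_prop) (by fun_prop) s₄)).congr
      (sqMap_homotopicRel b _ _ _ _ s₅)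
  · refine ⟨degen s 1, rfl, ContinuousMap.ext fun r => ?_⟩
    rw [degen_one_apply]
    change _ = L (sq (1 / 2 + 8 * (face ![1, 0, 3] r 3 - face ![1, 0, 3] r 1))
        (8 * face ![1, 0, 3] r 3 + 4 * face ![1, 0, 3] r 0 - 1 / 2))
    have hs := Δ₂.sum r
    have e3 : face ![(1 : Fin 4), 0, 3] r 3 = r 2 := by simp [face_apply]
    have e1 : face ![(1 : Fin 4), 0, 3] r 1 = r 0 := by simp [face_apply]
    have e0 : face ![(1 : Fin 4), 0, 3] r 0 = r 1 := by simp [face_apply]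
    rw [e3, e1, e0]
    rcases le_total (r 2 - r 0) (-(5 / 8)) with h | h
    · exact (GenLoop.boundary L _ ⟨0, .inl (trunc_of_le (by linarith))⟩).symm
    · exact (GenLoop.boundary L _ ⟨1, .inr (trunc_of_ge (by linarith))⟩).symm
  · have e : (sqMap L (fun q : Δ₃ => 1 / 2 + 8 * (q 3 - q 1)) (fun q => 8 * q 3 + 4 * q 0 - 1 / 2)
        (by fun_prop) (by fun_prop)).comp (face ![1, 2, 3]) =
        sqMap L (fun r : Δ₂ => 1 / 2 + 8 * (r 2 - r 0))
        (fun r => 8 * r 2 - 1 / 2) (by fun_prop) (by fun_prop) := by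
      ext r
      change L (sq (1 / 2 + 8 * (face ![1, 2, 3] r 3 - face ![1, 2, 3] r 1))
        (8 * face ![1, 2, 3] r 3 + 4 * face ![1, 2, 3] r 0 - 1 / 2)) = L _
      simp only [face_apply]
      simp
    rw [e]
    refine ((rep_bubble_degen_one L).congr (sqMap_homotopicRel L _ _ (by fun_prop) (by fun_prop)
      rho)).congr (sqMap_homotopicRel L _ _ _ _ fun r hr => ?_)
    have hs := Δ₂.sum r
    rcases mem_bdry_cases hr with h | h | h
    · rcases le_total (1 / 16) (r 2) with h' | h'
      · exact .inr (.inl ⟨by linarith, by linarith⟩)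
      · exact .inr (.inr (.inl ⟨by linarith, by linarith⟩))
    · rcases le_total (3 / 8) (r 2) with h' | h'
      · exact .inr (.inr (.inr ⟨by linarith, by linarith⟩))
      · exact .inl ⟨by linarith, by linarith⟩
    · exact .inr (.inr (.inl ⟨by linarith, by linarith⟩))

theorem Gamma.P_P_P {g h : FundamentalGroup M m₀} (x : Gamma s g h) : x.P.P.P ≍ x :=
  (gammaData_isDeltaGroup s).P_P_P x

theorem gmul_P {g h' h k' p q : FundamentalGroup M m₀} (e₁ : h' = h⁻¹) (e₂ : p = h⁻¹ * g)
    (e₃ : q = k' * h) (a : Gamma s g h') (b : Gamma s h k') (c : Gamma s p q) :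
    (gmul e₁ e₂ e₃ a b c).P ≍ gmul (by rw [e₃]; group) (by rw [e₁, e₃]; group)
      (by rw [e₁, e₂]; group) b.P c.P a.P :=
  (gammaData_isDeltaGroup s).P_m e₁ e₂ e₃ a b c

theorem Gamma.P_injective {g h : FundamentalGroup M m₀} {x y : Gamma s g h} (hxy : x.P = y.P) :
    x = y := by
  have hx := x.P_P_P
  have hy := y.P_P_P
  refine eq_of_heq (hx.symm.trans (HEq.trans (heq_of_eq ?_) hy))
  exact congrArg (fun z : Gamma s h (g⁻¹ * h⁻¹) => z.P.P) hxy

theorem bubble_heq {g h g' h' : FundamentalGroup M m₀} {x : Gamma s g h} {y : Gamma s g' h'}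
    (hg : g = g') (hh : h = h') (hxy : x ≍ y) (a : PiTwo M m₀) : bubble a x ≍ bubble a y := by
  subst hg hh
  rw [eq_of_heq hxy]

/-- By `gmul_P` the rotation makes the middle factor the first one, where `m_bubble_left` applies.
Rotating the middle factor acts by `h` and rotating the product acts by `g`, whence the coefficient
`g⁻¹ * h`. -/
theorem m_bubble_middle {g h' h k' p q : FundamentalGroup M m₀} (e₁ : h' = h⁻¹)
    (e₂ : p = h⁻¹ * g) (e₃ : q = k' * h) (a : PiTwo M m₀) (x : Gamma s g h') (y : Gamma s h k')
    (z : Gamma s p q) : gmul e₁ e₂ e₃ x (bubble a y) z =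
      bubble ((g⁻¹ * h) • a) (gmul e₁ e₂ e₃ x y z) := by
  refine Gamma.P_injective (eq_of_heq ?_)
  rw [bubble_P, ← mul_smul, mul_inv_cancel_left]
  refine (gmul_P e₁ e₂ e₃ x (bubble a y) z).trans ?_
  rw [bubble_P, m_bubble_left]
  exact bubble_heq rfl (by rw [e₂, e₃]; group) (gmul_P e₁ e₂ e₃ x y z).symm _

theorem Rep.exists_cast {g h g' h' : FundamentalGroup M m₀} {x : Gamma s g h} {t : C(Δ₂, M)}
    (hx : Rep x t) (hg : g = g') (hh : h = h') : ∃ y : Gamma s g' h', Rep y t := by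
  subst hg hh
  exact ⟨x, hx⟩

/-- The third factor of a product is determined by the others. -/
theorem m_right_injective {g h' h k' p q : FundamentalGroup M m₀} (e₁ : h' = h⁻¹)
    (e₂ : p = h⁻¹ * g) (e₃ : q = k' * h) {x : Gamma s g h'} {y : Gamma s h k'} {z z' : Gamma s p q}
    (H : gmul e₁ e₂ e₃ x y z = gmul e₁ e₂ e₃ x y z') : z = z' := by
  -- Exchanging the vertices [0] and [2] of a filler interchanges the roles of the third factor and
  -- the product, so the third factor is itself a product.
  have key : ∀ z, z ≍ gmul (g := h' * g) (h' := g⁻¹⁻¹ * (h' * g)⁻¹) (h := h⁻¹)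
      (k' := k' * h) (p := g) (q := k') (by rw [e₁]; group) (by rw [e₁]; group) (by group)
      x.Q.P y.Q (gmul e₁ e₂ e₃ x y z) := fun z => by
    obtain ⟨ω, hx, hy, hz, hd⟩ := exists_fill_m e₁ e₂ e₃ x y z
    exact m_heq_of_rep _ _ _ ω ![2, 1, 0, 3] hx.Q'.P' hy.Q' hd hz (by rw [e₂, e₁]) e₃
  refine eq_of_heq ((key z).trans (HEq.trans ?_ (key z').symm))
  rw [H]

/-- The first factor of a product is determined by the others. -/
theorem m_left_injective {g h' h k' p q : FundamentalGroup M m₀} (e₁ : h' = h⁻¹)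
    (e₂ : p = h⁻¹ * g) (e₃ : q = k' * h) {x x' : Gamma s g h'} {y : Gamma s h k'} {z : Gamma s p q}
    (H : gmul e₁ e₂ e₃ x y z = gmul e₁ e₂ e₃ x' y z) : x = x' := by
  have key : ∀ x, gmul (by group) (by rw [e₂, e₃]; group) (by rw [e₂, e₃]; group)
      (gmul e₁ e₂ e₃ x y z) y.Q.P.P z.Q.P ≍ x := fun x =>
    (gammaData_isDeltaGroup s).m_m_cancel e₁ e₂ e₃ x y z
  refine eq_of_heq ((key x).symm.trans (HEq.trans ?_ (key x')))
  rw [H]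

/-- The horn is filled with `d` in the position of the third face; after the exchange of the
vertices [0] and [2], the new fourth face is the required factor. -/
theorem exists_m_right {g h' h k' p q : FundamentalGroup M m₀} (e₁ : h' = h⁻¹)
    (e₂ : p = h⁻¹ * g) (e₃ : q = k' * h) (x : Gamma s g h') (y : Gamma s h k') (d : Gamma s g k') :
    ∃ z, gmul e₁ e₂ e₃ x y z = d := by
  subst e₁ e₂ e₃
  obtain ⟨x, rfl⟩ := Gamma.exists_rep x
  obtain ⟨y, rfl⟩ := Gamma.exists_rep y
  obtain ⟨d, rfl⟩ := Gamma.exists_rep d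
  obtain ⟨ω, z, hx, hy, hd, hz⟩ := exists_fill (g := h⁻¹ * g) (h' := g⁻¹⁻¹ * (h⁻¹ * g)⁻¹)
    (h := h⁻¹) (k' := k' * h) (p := g) (q := k') (by group) (by group) (by group) x.Q.P y.Q d
  have hx' : ω.comp (face ![1, 0, 2]) = x.1 := by
    have h1 := congrArg (fun t : C(Δ₂, M) => t.comp (face ![0, 2, 1])) hx
    have h2 : x.Q.P.1 = x.1.comp (face ![0, 2, 1]) := by
      change (x.1.comp (face ![1, 0, 2])).comp (face ![1, 2, 0]) = _
      rw [comp_face_comp_face]; rfl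
    simp only [comp_face_comp_face, h2] at h1
    exact h1.trans (ContinuousMap.ext fun p => congrArg x.1 (face_id p))
  have hy' : ω.comp (face ![2, 0, 3]) = y.1 := by
    have h1 := congrArg (fun t : C(Δ₂, M) => t.comp (face ![1, 0, 2])) hy
    simp only [comp_face_comp_face, y.Q_comp_face] at h1
    exact h1
  exact ⟨Gamma.mk z, (eq_of_heq (m_heq_of_rep rfl rfl rfl ω ![2, 1, 0, 3] ⟨x, rfl, hx'.symm⟩
    ⟨y, rfl, hy'.symm⟩ ⟨z, rfl, hz.symm⟩ ⟨d, rfl, hd.symm⟩ rfl rfl)).symm⟩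

/-- As for the third factor, now with the vertices [0] and [3] exchanged. The new face has an index
that equals `h⁻¹` only after a computation in the group, hence the cast. -/
theorem exists_m_left {g h' h k' p q : FundamentalGroup M m₀} (e₁ : h' = h⁻¹)
    (e₂ : p = h⁻¹ * g) (e₃ : q = k' * h) (y : Gamma s h k') (z : Gamma s p q) (d : Gamma s g k') :
    ∃ x, gmul e₁ e₂ e₃ x y z = d := by
  subst e₁ e₂ e₃
  obtain ⟨y, rfl⟩ := Gamma.exists_rep y
  obtain ⟨z, rfl⟩ := Gamma.exists_rep z
  obtain ⟨d, rfl⟩ := Gamma.exists_rep d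
  obtain ⟨ω, x, hd, hy, hz, hx⟩ := exists_fill (h' := k') (by group) (by group) (by group)
    d y.Q.P.P z.Q.P
  have hy' : ω.comp (face ![3, 2, 0]) = y.1 := by
    have h1 := congrArg (fun t : C(Δ₂, M) => t.comp (face ![2, 1, 0])) hy
    have h2 : y.Q.P.P.1 = y.1.comp (face ![2, 1, 0]) := by
      change ((y.1.comp (face ![1, 0, 2])).comp (face ![1, 2, 0])).comp (face ![1, 2, 0]) = _
      rw [comp_face_comp_face, comp_face_comp_face]; rfl
    simp only [comp_face_comp_face, h2] at h1
    exact h1.trans (ContinuousMap.ext fun p => congrArg y.1 (face_id p))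
  have hz' : ω.comp (face ![1, 3, 0]) = z.1 := by
    have h1 := congrArg (fun t : C(Δ₂, M) => t.comp (face ![0, 2, 1])) hz
    have h2 : z.Q.P.1 = z.1.comp (face ![0, 2, 1]) := by
      change (z.1.comp (face ![1, 0, 2])).comp (face ![1, 2, 0]) = _
      rw [comp_face_comp_face]; rfl
    simp only [comp_face_comp_face, h2] at h1
    exact h1.trans (ContinuousMap.ext fun p => congrArg z.1 (face_id p))
  obtain ⟨x', hx'⟩ := Rep.exists_cast (g' := g) (h' := h⁻¹)
    (⟨x, rfl, hx.symm⟩ : Rep (Gamma.mk x) (ω.comp (face ![1, 2, 3]))) rfl (by group)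
  exact ⟨x', (eq_of_heq (m_heq_of_rep rfl rfl rfl ω ![3, 1, 2, 0] hx' ⟨y, rfl, hy'.symm⟩
    ⟨z, rfl, hz'.symm⟩ ⟨d, rfl, hd.symm⟩ rfl rfl)).symm⟩

/-- The product with degenerate factors `degen' s g` and `degen s (k' * g)`. -/
theorem gmul_degen'_degen {g k' : FundamentalGroup M m₀} (x : Gamma s g k') :
    gmul rfl (inv_mul_cancel g).symm rfl (Gamma.mk (degen' s g)) x (Gamma.mk (degen s (k' * g))) =
      x := by
  obtain ⟨x, rfl⟩ := Gamma.exists_rep x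
  have e : ∀ f : Fin 3 → Fin 4, (x.1.comp (smap ![0, 0, 1, 2])).comp (face f) =
      x.1.comp (face (![0, 0, 1, 2] ∘ f)) := fun f => by
    rw [ContinuousMap.comp_assoc, smap_comp_face]
  have hx : Rep (Gamma.mk x) (x.1.comp (face ![0, 1, 2])) := x.rep_face
  -- The 3-simplex is `x` composed with the collapse of the edge [0,1]; two faces are `x` and two
  -- are degenerate.
  refine m_eq_of_rep _ _ _ (x.1.comp (smap ![0, 0, 1, 2])) ⟨degen' s g, rfl, ?_⟩ ?_
    ⟨degen s (k' * g), rfl, ?_⟩ ?_ <;> rw [e]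
  · ext p
    refine ((x.2.1 _ ?_).trans (congrArg _ ?_)).symm
    · simp [face_apply]
    · exact coord_congr (by simp [face_apply])
  · convert hx using 3
    decide
  · ext p
    refine ((x.2.2.2 _ ?_).trans (congrArg _ ?_)).symm
    · simp [face_apply]
    · exact coord_congr (by simp [face_apply])
  · convert hx using 3
    decide

theorem gmul_degen_one (l : FundamentalGroup M m₀) :
    gmul inv_one.symm (by rw [inv_one, mul_one]) (mul_one l).symm (Gamma.mk (degen s 1))
      (Gamma.mk (degen s l)) (Gamma.mk (degen s l)) = Gamma.mk (degen s l) := by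
  refine m_eq_of_rep _ _ _ (⟨fun q => s.loop l (coord q 3), by fun_prop⟩ : C(Δ₃, M))
    ⟨degen s 1, rfl, ?_⟩ ⟨degen s l, rfl, ?_⟩ ⟨degen s l, rfl, ?_⟩ ⟨degen s l, rfl, ?_⟩
  · ext p
    rw [degen_one_apply]
    change _ = s.loop l (coord (face _ p) 3)
    have : coord (face ![(1 : Fin 4), 2, 0] p) 3 = 0 := Subtype.ext (by simp [coord, face_apply])
    rw [this, Path.source]
  all_goals
    ext p
    refine congrArg (s.loop l) (coord_congr ?_)
    simp [face_apply]

/-- First half of the reduction to Γ(1, 1): a sphere on a degenerate triangle can be moved to the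
constant triangle, since degenerate factors reproduce the degenerate triangle. -/
theorem bubble_degen (a : PiTwo M m₀) (l : FundamentalGroup M m₀) :
    bubble a (Gamma.mk (degen s l)) = gmul inv_one.symm (by rw [inv_one, mul_one]) (mul_one l).symm
      (bubble a (Gamma.mk (degen s 1))) (Gamma.mk (degen s l)) (Gamma.mk (degen s l)) := by
  rw [m_bubble_left, gmul_degen_one]

/-- Second half of the reduction: a sphere on an arbitrary triangle can be moved to a degenerate
factor. Together with cancellation and solvability of products, this transfers injectivity,
transitivity and additivity from the constant triangle. -/
theorem bubble_eq_gmul {g k' : FundamentalGroup M m₀} (a : PiTwo M m₀) (x : Gamma s g k') :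
    bubble a x = gmul rfl (inv_mul_cancel g).symm rfl (Gamma.mk (degen' s g)) x
      (bubble a (Gamma.mk (degen s (k' * g)))) := by
  rw [m_bubble_right, gmul_degen'_degen]

theorem bubble_injective {g k' : FundamentalGroup M m₀} (x : Gamma s g k') {a b : PiTwo M m₀}
    (h : bubble a x = bubble b x) : a = b := by
  rw [bubble_eq_gmul a, bubble_eq_gmul b] at h
  have h := m_right_injective _ _ _ h
  rw [bubble_degen a, bubble_degen b] at h
  exact bubble_degen_one_injective (m_left_injective _ _ _ h)

theorem exists_bubble {g k' : FundamentalGroup M m₀} (x y : Gamma s g k') :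
    ∃ a, bubble a x = y := by
  obtain ⟨c, rfl⟩ := exists_m_right rfl (inv_mul_cancel g).symm rfl (Gamma.mk (degen' s g)) x y
  obtain ⟨c', rfl⟩ := exists_m_left inv_one.symm (by rw [inv_one, mul_one]) (mul_one (k' * g)).symm
    (Gamma.mk (degen s (k' * g))) (Gamma.mk (degen s (k' * g))) c
  obtain ⟨a, rfl⟩ := exists_bubble_degen_one c'
  exact ⟨a, by rw [bubble_eq_gmul, bubble_degen]⟩

/-- On the constant triangle, a concatenation of spheres is the product of the two triangles
carrying them, and each sphere can be pulled out of that product with trivial coefficient. The order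
of concatenation is immaterial because π₂ is commutative. -/
theorem bubble_add {g k' : FundamentalGroup M m₀} (a b : PiTwo M m₀) (x : Gamma s g k') :
    bubble (a + b) x = bubble a (bubble b x) := by
  have h1 : bubble (a + b) (Gamma.mk (degen s 1)) = bubble a (bubble b (Gamma.mk (degen s 1))) := by
    obtain ⟨a, rfl⟩ := PiTwo.mk_surjective a
    obtain ⟨b, rfl⟩ := PiTwo.mk_surjective b
    rw [add_comm, PiTwo.mk_add, ← m_degen_one_bubble, m_bubble_left, m_bubble_middle,
      gmul_degen_one, inv_one, mul_one, one_smul]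
  have h2 : ∀ l, bubble (a + b) (Gamma.mk (degen s l)) =
      bubble a (bubble b (Gamma.mk (degen s l))) := fun l => by
    rw [bubble_degen, h1, m_bubble_left, m_bubble_left, gmul_degen_one]
  rw [bubble_eq_gmul, h2, m_bubble_right, m_bubble_right, gmul_degen'_degen]

theorem gmul_bubble {g h' h k' p q : FundamentalGroup M m₀} (e₁ : h' = h⁻¹)
    (e₂ : p = h⁻¹ * g) (e₃ : q = k' * h) (a b c : PiTwo M m₀) (x : Gamma s g h') (y : Gamma s h k')
    (z : Gamma s p q) : gmul e₁ e₂ e₃ (bubble a x) (bubble b y) (bubble c z) =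
      bubble (a + (g⁻¹ * h) • b + c) (gmul e₁ e₂ e₃ x y z) := by
  rw [m_bubble_left, m_bubble_middle, m_bubble_right, bubble_add, bubble_add]

end Action

/-! ### Existence of sections and base elements -/

section Existence

variable {M : Type u} [TopologicalSpace M] {m₀ : M} {s : LoopSection M m₀}

/-- The quotient map from the square to the 2-simplex that collapses the sides over the end points
of `I` and maps the bottom to the edges `[0, 1]`, `[1, 2]` and the top to the edge `[0, 2]`. -/
def bigonToSimplex (w : I × I) : Δ₂ :=
  lerp w.1 (pt (max (1 - 2 * (w.2 : ℝ)) 0) (1 - |2 * (w.2 : ℝ) - 1|) (max (2 * (w.2 : ℝ) - 1) 0)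
      (le_max_right _ _)
      (sub_nonneg.2 (abs_le.2 ⟨by linarith [w.2.2.1], by linarith [w.2.2.2]⟩)) (le_max_right _ _)
      (by
        rcases le_total (2 * (w.2 : ℝ)) 1 with h | h
        · rw [max_eq_left (by linarith), max_eq_right (by linarith), abs_of_nonpos (by linarith)]
          ring
        · rw [max_eq_right (by linarith), max_eq_left (by linarith), abs_of_nonneg (by linarith)]
          ring))
    (pt (1 - w.2) 0 w.2 (by linarith [w.2.2.2]) le_rfl w.2.2.1 (by ring))

theorem continuous_bigonToSimplex : Continuous bigonToSimplex := by
  refine continuous_lerp continuous_fst (continuous_pt _ _ _ _ ?_ ?_ ?_)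
    (continuous_pt _ _ _ _ ?_ ?_ ?_) <;> fun_prop

theorem bigonToSimplex_one (w : I × I) :
    bigonToSimplex w 1 = (1 - w.1) * (1 - |2 * (w.2 : ℝ) - 1|) := by
  change (1 - (w.1 : ℝ)) * (1 - |2 * (w.2 : ℝ) - 1|) + w.1 * 0 = _
  ring

/-- The parameter `w.2` is recovered from the image as coordinate 2 plus half of coordinate 1. This
gives surjectivity explicitly and shows that only the two sides over the end points are collapsed.
-/
theorem bigonToSimplex_two (w : I × I) :
    bigonToSimplex w 2 = w.2 - bigonToSimplex w 1 / 2 := by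
  rw [bigonToSimplex_one]
  change (1 - (w.1 : ℝ)) * max (2 * (w.2 : ℝ) - 1) 0 + w.1 * w.2 = _
  rcases le_total (2 * (w.2 : ℝ)) 1 with h | h
  · rw [max_eq_right (by linarith), abs_of_nonpos (by linarith)]; ring
  · rw [max_eq_left (by linarith), abs_of_nonneg (by linarith)]; ring

theorem bigonToSimplex_eq {w : I × I} {p : Δ₂}
    (h1 : (1 - w.1) * (1 - |2 * (w.2 : ℝ) - 1|) = p 1) (h2 : (w.2 : ℝ) = p 2 + p 1 / 2) :
    bigonToSimplex w = p := by
  have e1 : bigonToSimplex w 1 = p 1 := (bigonToSimplex_one w).trans h1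
  have e2 : bigonToSimplex w 2 = p 2 := by rw [bigonToSimplex_two, e1, h2]; ring
  exact Δ₂_ext (by linarith [Δ₂.sum p, Δ₂.sum (bigonToSimplex w)]) e1 e2

theorem surjective_bigonToSimplex : Function.Surjective bigonToSimplex := by
  intro p
  have h0 := stdSimplex.zero_le p 0
  have h1 := stdSimplex.zero_le p 1
  have h2 := stdSimplex.zero_le p 2
  have hs := Δ₂.sum p
  set D : ℝ := 1 - |2 * (p 2 + p 1 / 2) - 1| with hD
  have hD' : p 1 ≤ D := by
    have : |2 * (p 2 + p 1 / 2) - 1| ≤ 1 - p 1 := abs_le.2 ⟨by linarith, by linarith⟩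
    linarith
  have hr : p 1 / D ≤ 1 := div_le_one_of_le₀ hD' (h1.trans hD')
  refine ⟨(⟨1 - p 1 / D, by linarith, by linarith [div_nonneg h1 (h1.trans hD')]⟩,
    ⟨p 2 + p 1 / 2, by linarith, by linarith⟩), bigonToSimplex_eq ?_ rfl⟩
  change (1 - (1 - p 1 / D)) * D = p 1
  rcases eq_or_ne D 0 with h | h
  · rw [h] at hD' ⊢; linarith
  · field_simp; ring

theorem bigonToSimplex_eq_iff {w w' : I × I} (h : bigonToSimplex w = bigonToSimplex w') :
    w = w' ∨ w.2 = w'.2 ∧ (w.2 = 0 ∨ w.2 = 1) := by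
  have h2 : w.2 = w'.2 := by
    have e := bigonToSimplex_two w
    have e' := bigonToSimplex_two w'
    rw [h] at e
    exact Subtype.ext (by linarith)
  have h1 : (1 - (w.1 : ℝ)) * (1 - |2 * (w.2 : ℝ) - 1|) =
      (1 - w'.1) * (1 - |2 * (w.2 : ℝ) - 1|) := by
    rw [← bigonToSimplex_one, h, bigonToSimplex_one, h2]
  rcases mul_eq_mul_right_iff.1 h1 with h | h
  · exact .inl (Prod.ext (Subtype.ext (by linarith)) h2)
  · refine .inr ⟨h2, ?_⟩
    rcases abs_cases (2 * (w.2 : ℝ) - 1) with ⟨h', -⟩ | ⟨h', -⟩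
    · exact .inr (Subtype.ext (by rw [Set.Icc.coe_one]; linarith))
    · exact .inl (Subtype.ext (by rw [Set.Icc.coe_zero]; linarith))

/-- Paths `a`, `b`, `c` such that `c` is homotopic to `a` followed by `b` bound a singular
2-simplex. -/
theorem exists_simplex_of_homotopic {X : Type*} [TopologicalSpace X] {x y z : X} {a : Path x y}
    {b : Path y z} {c : Path x z} (h : (a.trans b).Homotopic c) :
    ∃ F : C(Δ₂, X), (∀ p, p 2 = 0 → F p = a (coord p 1)) ∧ (∀ p, p 0 = 0 → F p = b (coord p 2)) ∧
      ∀ p, p 1 = 0 → F p = c (coord p 2) := by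
  obtain ⟨K⟩ := h
  -- A continuous surjection from a compact space to a Hausdorff space is a quotient map. A homotopy
  -- of paths is constant on the two collapsed sides, so it descends to the triangle.
  have hq : Topology.IsQuotientMap (⟨bigonToSimplex, continuous_bigonToSimplex⟩ : C(I × I, Δ₂)) :=
    (continuous_bigonToSimplex.isClosedMap).isQuotientMap continuous_bigonToSimplex
      surjective_bigonToSimplex
  have hK : Function.FactorsThrough K.toContinuousMap
      (⟨bigonToSimplex, continuous_bigonToSimplex⟩ : C(I × I, Δ₂)) := by
    intro w w' hw
    rcases bigonToSimplex_eq_iff hw with h | ⟨h, h0 | h0⟩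
    · rw [h]
    · obtain ⟨τ, u⟩ := w
      obtain ⟨τ', u'⟩ := w'
      simp only at h h0
      subst h h0
      exact (K.source τ).trans (K.source τ').symm
    · obtain ⟨τ, u⟩ := w
      obtain ⟨τ', u'⟩ := w'
      simp only at h h0
      subst h h0
      exact (K.target τ).trans (K.target τ').symm
  let F : C(Δ₂, X) := hq.lift K.toContinuousMap hK
  have hF : ∀ w, F (bigonToSimplex w) = K w := fun w => DFunLike.congr_fun (hq.lift_comp _ hK) w
  have key : ∀ (w : I × I) (p : Δ₂), (1 - w.1) * (1 - |2 * (w.2 : ℝ) - 1|) = p 1 →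
      (w.2 : ℝ) = p 2 + p 1 / 2 → F p = K w := fun w p h1 h2 => by
    rw [← bigonToSimplex_eq h1 h2, hF]
  refine ⟨F, fun p hp => ?_, fun p hp => ?_, fun p hp => ?_⟩
  · have h1 := stdSimplex.zero_le p 1
    have h1' := stdSimplex.le_one p 1
    rw [key (0, ⟨p 1 / 2, by linarith, by linarith⟩) p, K.apply_zero]
    · change a.trans b ⟨p 1 / 2, _⟩ = _
      rw [Path.trans_apply, dif_pos (by change p 1 / 2 ≤ 1 / 2; linarith)]
      congr 1
      exact Subtype.ext (by change 2 * (p 1 / 2) = p 1; ring)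
    · change (1 - (0 : ℝ)) * (1 - |2 * (p 1 / 2) - 1|) = p 1
      rw [abs_of_nonpos (by linarith)]; ring
    · change p 1 / 2 = _
      rw [hp]; ring
  · have h1 := stdSimplex.zero_le p 2
    have h1' := stdSimplex.le_one p 2
    have hs := Δ₂.sum p
    rw [key (0, ⟨(1 + p 2) / 2, by linarith, by linarith⟩) p, K.apply_zero]
    · change a.trans b ⟨(1 + p 2) / 2, _⟩ = _
      rw [Path.trans_apply]
      split_ifs with hh
      · have e : p 2 = 0 := by
          change (1 + p 2) / 2 ≤ 1 / 2 at hh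
          linarith
        have e2 : coord p 2 = 0 := Subtype.ext e
        rw [e2, Path.source]
        refine Eq.trans (congrArg a ?_) a.target
        exact Subtype.ext (by change 2 * ((1 + p 2) / 2) = 1; rw [e]; ring)
      · congr 1
        exact Subtype.ext (by change 2 * ((1 + p 2) / 2) - 1 = p 2; ring)
    · change (1 - (0 : ℝ)) * (1 - |2 * ((1 + p 2) / 2) - 1|) = p 1
      rw [abs_of_nonneg (by linarith)]; linarith
    · change (1 + p 2) / 2 = _
      linarith
  · rw [key (1, coord p 2) p, K.apply_one]
    · rfl
    · simp [hp]
    · change p 2 = _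
      rw [hp]; ring

theorem nonempty_triangle (s : LoopSection M m₀) (g h : FundamentalGroup M m₀) :
    Nonempty (Triangle s g h) := by
  obtain ⟨F, hF⟩ := exists_simplex_of_homotopic (a := s.loop g) (b := s.loop h)
    (c := s.loop (h * g)) (by
      refine Path.Homotopic.Quotient.eq.1 ?_
      rw [s.class_loop, Path.Homotopic.Quotient.mk_trans, s.class_loop, s.class_loop]
      rfl)
  exact ⟨⟨F, hF⟩⟩

/-- Choices for the elements of a group without elements of order two that are compatible with
inversion. -/
theorem exists_involutive_choice {G X : Type*} [Group G] (h₂ : ∀ g : G, g⁻¹ = g → g = 1)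
    {R : G → X → Prop} {r : X → X} (hr : ∀ x, r (r x) = x) (hR : ∀ g x, R g x → R g⁻¹ (r x))
    {x₁ : X} (h₁ : R 1 x₁) (hx₁ : r x₁ = x₁) (hX : ∀ g, ∃ x, R g x) :
    ∃ c : G → X, (∀ g, R g (c g)) ∧ (∀ g, c g⁻¹ = r (c g)) ∧ c 1 = x₁ := by
  classical
  obtain ⟨lo, -⟩ := exists_wellFoundedLT G
  choose x hx using hX
  -- An arbitrary linear order picks one element from each pair of inverse elements; the other
  -- receives the reversed choice. Only 1 is its own inverse, and it has a prescribed choice fixed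
  -- by `r`.
  refine ⟨fun g => if g = 1 then x₁ else if g < g⁻¹ then x g else r (x g⁻¹), fun g => ?_,
    fun g => ?_, by simp⟩
  · dsimp only
    split_ifs with h h'
    · rw [h]; exact h₁
    · exact hx g
    · have := hR _ _ (hx g⁻¹)
      rwa [inv_inv] at this
  · by_cases h : g = 1
    · simp [h, hx₁]
    · simp only [inv_eq_one, if_neg h, inv_inv]
      rcases lt_trichotomy g g⁻¹ with h' | h' | h'
      · rw [if_neg h'.not_gt, if_pos h']
      · exact absurd (h₂ g h'.symm) h
      · rw [if_pos h', if_neg h'.not_gt, hr]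

theorem nonempty_loopSection (h₂ : ∀ g : FundamentalGroup M m₀, g⁻¹ = g → g = 1) :
    Nonempty (LoopSection M m₀) := by
  obtain ⟨c, h, hi, h1⟩ := exists_involutive_choice (X := Path m₀ m₀) h₂
    (R := fun g p => Path.Homotopic.Quotient.mk p = g.toPath) (r := Path.symm) Path.symm_symm
    (fun g p h => by rw [Path.Homotopic.Quotient.mk_symm, h]; rfl) (x₁ := Path.refl m₀) rfl
    Path.refl_symm (fun g => Path.Homotopic.Quotient.mk_surjective g.toPath)
  exact ⟨⟨c, h, hi, h1⟩⟩

/-- Choices for the points of a set with a group action that are equivariant. -/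
theorem exists_equivariant_choice {S B X : Type*} [Group S] [MulAction S B] [MulAction S X]
    {R : B → X → Prop} (hR : ∀ (ζ : S) b x, R b x → R (ζ • b) (ζ • x))
    (h : ∀ b, ∃ x, R b x ∧ ∀ ζ : S, ζ • b = b → ζ • x = x) :
    ∃ c : B → X, (∀ b, R b (c b)) ∧ ∀ (ζ : S) b, c (ζ • b) = ζ • c b := by
  choose x hx hζ using h
  -- One point is chosen over a representative of each orbit and carried along the orbit. Two
  -- elements that carry the representative to the same place differ by a stabilising element, which
  -- fixes the chosen point.
  let rep : B → B := fun b => (Quotient.mk (MulAction.orbitRel S B) b).out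
  have hrep : ∀ b, ∃ ζ : S, ζ • rep b = b := fun b =>
    MulAction.orbitRel_apply.1 ((MulAction.orbitRel S B).symm (Quotient.mk_out (s := MulAction.orbitRel S B) b))
  have hrep' : ∀ (ζ : S) b, rep (ζ • b) = rep b := fun ζ b =>
    congrArg Quotient.out (Quotient.sound (s := MulAction.orbitRel S B) ⟨ζ, rfl⟩)
  choose τ hτ using hrep
  refine ⟨fun b => τ b • x (rep b), fun b => ?_, fun ζ b => ?_⟩
  · have := hR (τ b) _ _ (hx (rep b))
    rwa [hτ] at this
  · dsimp only
    rw [hrep']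
    have e := hτ (ζ • b)
    rw [hrep'] at e
    have e' : ((τ (ζ • b))⁻¹ * ζ * τ b) • rep b = rep b := by
      rw [mul_smul, mul_smul, hτ, inv_smul_eq_iff, e]
    have := hζ _ _ e'
    rw [mul_smul, mul_smul, inv_smul_eq_iff] at this
    exact this.symm

/-! ### Symmetric choices of triangles with labelled edges -/

/-- Labels of the edges of a 2-simplex by elements of a group that are compatible with
composition. -/
def Labels (G : Type*) [Group G] : Type _ :=
  {L : Fin 3 → Fin 3 → G // ∀ i j k, L j k * L i j = L i k}

namespace Labels

variable {G : Type*} [Group G]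

theorem self (L : Labels G) (i : Fin 3) : L.1 i i = 1 := by
  have := L.2 i i i
  rwa [mul_eq_left] at this

theorem swap (L : Labels G) (i j : Fin 3) : L.1 j i = (L.1 i j)⁻¹ :=
  eq_inv_of_mul_eq_one_left ((L.2 i j i).trans (L.self i))

instance : MulAction (Equiv.Perm (Fin 3)) (Labels G) where
  smul ζ L := ⟨fun i j => L.1 (ζ⁻¹ i) (ζ⁻¹ j), fun i j k => L.2 _ _ _⟩
  one_smul L := rfl
  mul_smul ζ τ L := by
    refine Subtype.ext (funext fun i => funext fun j => ?_)
    change L.1 ((ζ * τ)⁻¹ i) ((ζ * τ)⁻¹ j) = L.1 (τ⁻¹ (ζ⁻¹ i)) (τ⁻¹ (ζ⁻¹ j))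
    rw [mul_inv_rev]; rfl

theorem smul_apply (ζ : Equiv.Perm (Fin 3)) (L : Labels G) (i j : Fin 3) :
    (ζ • L).1 (ζ i) (ζ j) = L.1 i j := by
  change L.1 (ζ⁻¹ (ζ i)) (ζ⁻¹ (ζ j)) = _
  simp

/-- In a group without elements of order two or three, a permutation can fix labels only if it
moves vertices along edges with label `1`. -/
theorem eq_one_of_smul_eq (h₂ : ∀ g : G, orderOf g ≠ 2) (h₃ : ∀ g : G, orderOf g ≠ 3)
    {L : Labels G} {ζ : Equiv.Perm (Fin 3)} (h : ζ • L = L) (i : Fin 3) : L.1 i (ζ i) = 1 := by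
  have e : ∀ i j, L.1 (ζ i) (ζ j) = L.1 i j := fun i j => by
    conv_lhs => rw [← h]
    exact smul_apply ζ L i j
  by_cases h1 : ζ i = i
  · rw [h1, L.self]
  by_contra hne
  by_cases h2 : ζ (ζ i) = i
  · have e1 := e i (ζ i)
    rw [h2, L.swap i] at e1
    refine h₂ _ (orderOf_eq_prime (p := 2) ?_ hne)
    rw [pow_two]
    nth_rewrite 1 [← e1]
    exact inv_mul_cancel _
  · have h3 : ζ (ζ (ζ i)) = i := by
      revert h1 h2; clear e h hne; revert i; revert ζ; decide
    -- The three edges are permuted cyclically, so they have a common label; going around the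
    -- triangle, its cube is 1.
    have e1 := e i (ζ i)
    have e2 := e (ζ i) (ζ (ζ i))
    rw [h3, e1] at e2
    refine h₃ _ (orderOf_eq_prime (p := 3) ?_ hne)
    have := L.2 i (ζ i) (ζ (ζ i))
    rw [L.swap (ζ (ζ i)) i, e2, e1] at this
    rw [pow_succ, pow_two, this, inv_mul_cancel]

end Labels

/-- The action of the permutations of the vertices on singular 2-simplices. -/
instance permSimplex : MulAction (Equiv.Perm (Fin 3)) C(Δ₂, M) where
  smul ζ t := t.comp (face ⇑ζ⁻¹)
  one_smul t := ContinuousMap.ext fun p => congrArg t (stdSimplex.map_id_apply p)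
  mul_smul ζ τ t := by
    change t.comp (face ⇑(ζ * τ)⁻¹) = (t.comp (face ⇑τ⁻¹)).comp (face ⇑ζ⁻¹)
    rw [ContinuousMap.comp_assoc, face_comp_face, mul_inv_rev]; rfl

theorem perm_smul_apply (ζ : Equiv.Perm (Fin 3)) (t : C(Δ₂, M)) (p : Δ₂) :
    (ζ • t) p = t (face ⇑ζ⁻¹ p) := rfl

theorem face_perm_apply (ζ : Equiv.Perm (Fin 3)) (p : Δ₂) (i : Fin 3) :
    face ⇑ζ⁻¹ p i = p (ζ i) := by
  change smap ⇑ζ⁻¹ p i = _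
  rw [smap_apply, Finset.sum_eq_single (ζ i)]
  · simp
  · intro j _ hj
    refine if_neg fun h => hj ?_
    rw [← h]; simp
  · simp

/-- The singular 2-simplices with given labels of the edges. -/
def HasLabels (s : LoopSection M m₀) (L : Labels (FundamentalGroup M m₀)) (t : C(Δ₂, M)) : Prop :=
  ∀ i j p, (∀ k, k ≠ i → k ≠ j → p k = 0) → t p = s.loop (L.1 i j) (coord p j)

theorem HasLabels.smul {L : Labels (FundamentalGroup M m₀)} {t : C(Δ₂, M)} (h : HasLabels s L t)
    (ζ : Equiv.Perm (Fin 3)) : HasLabels s (ζ • L) (ζ • t) := by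
  intro i j p hp
  rw [perm_smul_apply, h (ζ⁻¹ i) (ζ⁻¹ j) (face ⇑ζ⁻¹ p) fun k hki hkj => ?_]
  · congr 1
    refine coord_congr ?_
    rw [face_perm_apply]; simp
  · rw [face_perm_apply]
    refine hp _ (fun e => hki ?_) (fun e => hkj ?_) <;> rw [← e] <;> simp

theorem coord_add_eq_one {p : Δ₂} {i j : Fin 3} (hij : i ≠ j)
    (hp : ∀ k, k ≠ i → k ≠ j → p k = 0) : p i + p j = 1 := by
  rw [← stdSimplex.sum_eq_one p]
  exact (Finset.sum_eq_add i j hij (fun k _ hk => hp k hk.1 hk.2) (by simp) (by simp)).symm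

/-- The labels of the edges of a singular 2-simplex in `Γ(g, h)`. -/
def labels {G : Type*} [Group G] (g h : G) : Labels G :=
  ⟨fun i j => ![1, g, h * g] j * (![1, g, h * g] i)⁻¹, fun i j k => by group⟩

theorem labels_edges {G : Type*} [Group G] (g h : G) :
    (labels g h).1 0 1 = g ∧ (labels g h).1 1 2 = h ∧ (labels g h).1 0 2 = h * g := by
  simp [labels]

theorem rotate_smul_labels {G : Type*} [Group G] (g h : G) :
    (finRotate 3)⁻¹ • labels g h = labels h (g⁻¹ * h⁻¹) := by
  refine Subtype.ext (funext fun i => funext fun j => ?_)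
  change (labels g h).1 ((finRotate 3)⁻¹⁻¹ i) ((finRotate 3)⁻¹⁻¹ j) = _
  fin_cases i <;> fin_cases j <;> simp [labels]

theorem swap_smul_labels {G : Type*} [Group G] (g h : G) :
    Equiv.swap (0 : Fin 3) 1 • labels g h = labels g⁻¹ (h * g) := by
  refine Subtype.ext (funext fun i => funext fun j => ?_)
  change (labels g h).1 ((Equiv.swap 0 1)⁻¹ i) ((Equiv.swap 0 1)⁻¹ j) = _
  have e0 : (Equiv.swap (0 : Fin 3) 1)⁻¹ 0 = 1 := by decide
  have e1 : (Equiv.swap (0 : Fin 3) 1)⁻¹ 1 = 0 := by decide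
  have e2 : (Equiv.swap (0 : Fin 3) 1)⁻¹ 2 = 2 := by decide
  fin_cases i <;> fin_cases j <;> simp only [Fin.zero_eta, Fin.mk_one, Fin.reduceFinMk, e0, e1, e2]
    <;> simp [labels]

theorem HasLabels.exists_triangle {g h : FundamentalGroup M m₀} {t : C(Δ₂, M)}
    (ht : HasLabels s (labels g h) t) : ∃ a : Triangle s g h, a.1 = t := by
  refine ⟨⟨t, fun p hp => ?_, fun p hp => ?_, fun p hp => ?_⟩, rfl⟩
  · rw [ht 0 1 p (fun k h0 h1 => by fin_cases k <;> simp_all)]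
    rw [(labels_edges g h).1]
  · rw [ht 1 2 p (fun k h0 h1 => by fin_cases k <;> simp_all)]
    rw [(labels_edges g h).2.1]
  · rw [ht 0 2 p (fun k h0 h1 => by fin_cases k <;> simp_all)]
    rw [(labels_edges g h).2.2]

/-- A singular 2-simplex that maps the edges `[0, 1]`, `[1, 2]`, `[0, 2]` as prescribed by labels
maps all edges as prescribed. -/
theorem hasLabels_of_triangle {L : Labels (FundamentalGroup M m₀)}
    (a : Triangle s (L.1 0 1) (L.1 1 2)) : HasLabels s L a.1 := by
  have key : ∀ i j p, i < j → (∀ k, k ≠ i → k ≠ j → p k = 0) →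
      a.1 p = s.loop (L.1 i j) (coord p j) := by
    intro i j p hij hp
    obtain ⟨rfl, rfl⟩ | ⟨rfl, rfl⟩ | ⟨rfl, rfl⟩ :
        i = 0 ∧ j = 1 ∨ i = 1 ∧ j = 2 ∨ i = 0 ∧ j = 2 := by
      clear hp; revert hij; revert i j; decide
    · exact a.2.1 p (hp 2 (by decide) (by decide))
    · exact a.2.2.1 p (hp 0 (by decide) (by decide))
    · rw [a.2.2.2 p (hp 1 (by decide) (by decide)), L.2]
  intro i j p hp
  rcases lt_trichotomy i j with h | rfl | h
  · exact key i j p h hp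
  · obtain ⟨j, hj⟩ : ∃ j, j ≠ i := exists_ne i
    have hpi : p i = 1 := by
      rw [← stdSimplex.sum_eq_one p]
      exact (Finset.sum_eq_single i (fun k _ hk => hp k hk hk) (by simp)).symm
    have e1 : coord p i = 1 := Subtype.ext hpi
    have e0 : coord p j = 0 := Subtype.ext (hp j hj hj)
    rw [L.self, s.loop_one, Path.refl_apply]
    rcases lt_or_gt_of_ne hj with h | h
    · rw [key j i p h fun k _ hk => hp k hk hk, e1, Path.target]
    · rw [key i j p h fun k hk _ => hp k hk hk, e0, Path.source]
  · rw [key j i p h fun k h1 h2 => hp k h2 h1, L.swap j i]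
    refine (loop_inv_apply s _ ?_).symm
    exact coord_add_eq_one h.ne fun k h1 h2 => hp k h2 h1

/-- If the edge opposite to `k` has label 1, the two edges into `k` have the same label, so a map
that depends on coordinate `k` only has the right boundary. -/
theorem hasLabels_degenerate {L : Labels (FundamentalGroup M m₀)} {k l : Fin 3} (hl : l ≠ k)
    (hk : ∀ i j, i ≠ k → j ≠ k → L.1 i j = 1) {t : C(Δ₂, M)}
    (ht : ∀ p, t p = s.loop (L.1 l k) (coord p k)) : HasLabels s L t := by
  have hlk : ∀ i, i ≠ k → L.1 i k = L.1 l k := fun i hi => by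
    rw [← L.2 i l k, hk i l hi hl, mul_one]
  intro i j p hp
  rw [ht]
  by_cases hi : i = k
  · by_cases hj : j = k
    · obtain rfl : j = i := hj.trans hi.symm
      subst hi
      have hpi : coord p j = 1 := Subtype.ext (by
        change p j = 1
        rw [← stdSimplex.sum_eq_one p]
        exact (Finset.sum_eq_single j (fun k _ hk => hp k hk hk) (by simp)).symm)
      rw [hpi, L.self, Path.target, Path.target]
    · subst hi
      rw [L.swap j i, hlk j hj]
      refine (loop_inv_apply s _ ?_).symm
      change p j + p i = 1
      rw [add_comm]
      exact coord_add_eq_one (Ne.symm hj) hp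
  · by_cases hj : j = k
    · subst hj
      rw [hlk i hi]
    · have e : coord p k = 0 := Subtype.ext (hp k (Ne.symm hi) (Ne.symm hj))
      rw [e, Path.source, hk i j hi hj, s.loop_one, Path.refl_apply]

/-- If some edge has label 1, the triangle is taken degenerate, depending only on the coordinate of
the opposite vertex `k`. A permutation that fixes `k` preserves it; one that fixes the labels but
moves `k` forces all labels to be 1, and the triangle is constant. If no edge has label 1, only the
identity fixes the labels, and any triangle will do. -/
theorem exists_hasLabels (h₂ : ∀ g : FundamentalGroup M m₀, orderOf g ≠ 2)
    (h₃ : ∀ g : FundamentalGroup M m₀, orderOf g ≠ 3) (L : Labels (FundamentalGroup M m₀)) :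
    ∃ t : C(Δ₂, M), HasLabels s L t ∧ ∀ ζ : Equiv.Perm (Fin 3), ζ • L = L → ζ • t = t := by
  by_cases hL : ∃ k, ∀ i j, i ≠ k → j ≠ k → L.1 i j = 1
  · obtain ⟨k, hk⟩ := hL
    obtain ⟨l, hl⟩ : ∃ l, l ≠ k := exists_ne k
    refine ⟨⟨fun p => s.loop (L.1 l k) (coord p k), by fun_prop⟩,
      hasLabels_degenerate hl hk fun _ => rfl, fun ζ h => ContinuousMap.ext fun p => ?_⟩
    change s.loop (L.1 l k) (coord (face ⇑ζ⁻¹ p) k) = s.loop (L.1 l k) (coord p k)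
    by_cases hζ : ζ k = k
    · congr 1
      refine coord_congr ?_
      rw [face_perm_apply, hζ]
    · have e : L.1 l k = 1 := by
        rw [← L.2 l (ζ k) k, hk l (ζ k) hl hζ, L.swap k, L.eq_one_of_smul_eq h₂ h₃ h, inv_one,
          mul_one]
      rw [e, s.loop_one]; rfl
  · obtain ⟨a⟩ := nonempty_triangle s (L.1 0 1) (L.1 1 2)
    refine ⟨a.1, hasLabels_of_triangle a, fun ζ h => ?_⟩
    have e : ζ = 1 := by
      ext1 i
      by_contra hi
      replace hi : ζ i ≠ i := hi
      refine hL ?_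
      have h1 := L.eq_one_of_smul_eq h₂ h₃ h i
      obtain ⟨k, hk⟩ : ∃ k, ∀ j, j ≠ k → j = i ∨ j = ζ i := by
        generalize ζ i = i' at hi
        clear * - hi
        revert hi; revert i i'; decide
      refine ⟨k, fun i' j' hi' hj' => ?_⟩
      rcases hk i' hi' with rfl | rfl <;> rcases hk j' hj' with rfl | rfl
      · exact L.self _
      · exact h1
      · rw [L.swap, h1, inv_one]
      · exact L.self _
    rw [e, one_smul]

/-- P and Q are the actions of the inverse rotation and of a transposition, so an equivariant choice
of triangles is compatible with both. The compatibility holds for the maps themselves and not only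
for their classes. -/
theorem nonempty_baseElements (h₂ : ∀ g : FundamentalGroup M m₀, orderOf g ≠ 2)
    (h₃ : ∀ g : FundamentalGroup M m₀, orderOf g ≠ 3) (s : LoopSection M m₀) :
    Nonempty (BaseElements s) := by
  obtain ⟨c, hc, hζ⟩ := exists_equivariant_choice (S := Equiv.Perm (Fin 3))
    (R := HasLabels (m₀ := m₀) s) (fun ζ L t h => h.smul ζ) (exists_hasLabels h₂ h₃)
  choose a ha using fun g h => (hc (labels g h)).exists_triangle
  have key : ∀ (ζ : Equiv.Perm (Fin 3)) (g h g' h' : FundamentalGroup M m₀),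
      ζ • labels g h = labels g' h' → (a g h).1.comp (face ⇑ζ⁻¹) = (a g' h').1 := by
    intro ζ g h g' h' e
    rw [ha, ha, ← e, hζ]; rfl
  refine ⟨⟨fun g h => Gamma.mk (a g h), fun g h => ?_, fun g h => ?_⟩⟩
  · refine congrArg Gamma.mk (Subtype.ext ?_)
    refine Eq.trans ?_ (key (finRotate 3)⁻¹ g h h (g⁻¹ * h⁻¹) ?_)
    · change (a g h).1.comp (face ![1, 2, 0]) = _
      congr 2
      decide
    · exact rotate_smul_labels g h
  · refine congrArg Gamma.mk (Subtype.ext ?_)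
    refine Eq.trans ?_ (key (Equiv.swap 0 1) g h g⁻¹ (h * g) ?_)
    · change (a g h).1.comp (face ![1, 0, 2]) = _
      congr 2
      decide
    · exact swap_smul_labels g h

end Existence

/-! ### The cocycle of a Δ-group with base elements -/

section Cocycle

namespace DeltaData.Iso

variable {G : Type u} [Group G] {D : DeltaData.{u, v} G} {E : DeltaData.{u, w} G}

theorem heq_of_heq (Φ : D.Iso E) {g h g' h' : G} {x : D.T g h} {y : D.T g' h'} (hg : g = g')
    (hh : h = h') (hxy : Φ.toEquiv g h x ≍ Φ.toEquiv g' h' y) : x ≍ y := by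
  subst hg hh
  exact heq_of_eq ((Φ.toEquiv g h).injective (eq_of_heq hxy))

/-- The axioms of a Δ-group are invariant under isomorphism. -/
theorem isDeltaGroup (Φ : D.Iso E) (hE : E.IsDeltaGroup) : D.IsDeltaGroup where
  P_P_P a := Φ.heq_of_heq (by group) (by group) (by
    rw [Φ.map_P, Φ.map_P, Φ.map_P]; exact hE.P_P_P _)
  Q_Q a := Φ.heq_of_heq (by group) (by group) (by
    rw [Φ.map_Q, Φ.map_Q]; exact hE.Q_Q _)
  P_P_Q a := Φ.heq_of_heq (by group) (by group) (by
    rw [Φ.map_P, Φ.map_P, Φ.map_Q, Φ.map_Q, Φ.map_P]; exact hE.P_P_Q _)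
  P_m e₁ e₂ e₃ a b c := Φ.heq_of_heq rfl (by rw [e₂, e₃]; group) (by
    rw [Φ.map_P, Φ.map_m, Φ.map_m, Φ.map_P, Φ.map_P, Φ.map_P]; exact hE.P_m _ _ _ _ _ _)
  Q_m e₁ e₂ e₃ a b c := Φ.heq_of_heq rfl (by rw [e₂, e₃]; group) (by
    rw [Φ.map_Q, Φ.map_m, Φ.map_m, Φ.map_Q, Φ.map_Q, Φ.map_Q]; exact hE.Q_m _ _ _ _ _ _)
  m_m e₁ e₂ e₃ e₄ e₅ e₆ a b c d e f := (Φ.toEquiv _ _).injective (by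
    rw [Φ.map_m, Φ.map_m, Φ.map_m, Φ.map_m, Φ.map_m, Φ.map_Q]
    exact hE.m_m _ _ _ _ _ _ _ _ _ _ _ _)
  m_m_cancel e₁ e₂ e₃ f a b := Φ.heq_of_heq rfl (by rw [e₁]; group) (by
    rw [Φ.map_m, Φ.map_m, Φ.map_P, Φ.map_P, Φ.map_Q, Φ.map_P, Φ.map_Q]
    exact hE.m_m_cancel _ _ _ _ _ _)

end DeltaData.Iso

/-- All axioms are evaluated on zero elements, so only the values of α remain. The axioms
`m_m_cancel`, `Q_m` and `P_m` give permutations of the four vertices that generate all symmetries,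
and `m_m` gives the cocycle identity up to such a symmetry. -/
theorem mem_ZS₃_of_isDeltaGroup {G : Type u} [Group G] {A : Type v} [AddCommGroup A]
    [DistribMulAction G A] {α : G → G → G → A} (h : (twisted G A α).IsDeltaGroup) :
    α ∈ ZS₃ G A := by
  -- Attaching α(x, y, z) to the vertices 1, x, xy, xyz numbered 0 to 3, the names `t` record the
  -- transposition of two vertices, and `c032` records a 3-cycle. The indices `g = (x * y * z)⁻¹`,
  -- `h = (y * z)⁻¹`, `k' = z` make the arguments of α equal to x, y, z.
  have t12 : ∀ x y z, α x y z = -α (x * y) y⁻¹ (y * z) := fun x y z => by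
    have H : ((0 : A) + _ • (0 : A) + 0 + α _ _ _) + _ • _ + _ + α _ _ _ = (0 : A) :=
      eq_of_heq (h.m_m_cancel (g := (x * y * z)⁻¹) (h := (y * z)⁻¹) (k' := z) rfl rfl rfl
        (0 : A) (0 : A) (0 : A))
    simp only [twisted, smul_zero, neg_zero, add_zero, zero_add] at H
    rw [eq_neg_iff_add_eq_zero]
    convert H using 2 <;> congr 1 <;> group
  have t03 : ∀ x y z, α x y z = -((x * y * z) • α (y * z)⁻¹ y (x * y)⁻¹) := fun x y z => by
    have H : -(_ • ((0 : A) + _ • (0 : A) + 0 + α _ _ _)) = _ + _ • _ + _ + α _ _ _ :=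
      eq_of_heq (h.Q_m (g := (x * y * z)⁻¹) (h := (y * z)⁻¹) (k' := z) rfl rfl rfl
        (0 : A) (0 : A) (0 : A))
    simp only [twisted, smul_zero, neg_zero, add_zero, zero_add] at H
    rw [eq_neg_iff_add_eq_zero, ← neg_eq_iff_add_eq_zero, ← inv_smul_eq_iff, smul_neg]
    convert H using 2
    · congr 2 <;> group
    · group
    · group
    · group
  have c032 : ∀ x y z, α x y z = (x * y * z) • α (y * z)⁻¹ x⁻¹ (x * y) := fun x y z => by
    have H : (_ • ((0 : A) + _ • (0 : A) + 0 + α _ _ _)) = _ + _ • _ + _ + α _ _ _ :=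
      eq_of_heq (h.P_m (g := (x * y * z)⁻¹) (h := (y * z)⁻¹) (k' := z) rfl rfl rfl
        (0 : A) (0 : A) (0 : A))
    simp only [twisted, smul_zero, add_zero, zero_add] at H
    rw [← inv_smul_eq_iff]
    convert H using 2
    · congr 1 <;> group
    · group
    · group
    · group
  have t23 : ∀ x y z, α x y z = -α x (y * z) z⁻¹ := fun x y z => by
    rw [t03, c032 (y * z)⁻¹ y (x * y)⁻¹, ← mul_smul]
    have e1 : x * y * z * ((y * z)⁻¹ * y * (x * y)⁻¹) = 1 := by group
    rw [e1, one_smul]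
    congr 2 <;> group
  have t02 : ∀ x y z, α x y z = -((x * y) • α y⁻¹ x⁻¹ (x * y * z)) := fun x y z => by
    rw [c032, t03 (y * z)⁻¹ x⁻¹ (x * y), smul_neg, ← mul_smul]
    have e1 : x * y * z * ((y * z)⁻¹ * x⁻¹ * (x * y)) = x * y := by group
    rw [e1]
    congr 3 <;> group
  have t01 : ∀ x y z, α x y z = -(x • α x⁻¹ (x * y) z) := fun x y z => by
    rw [t12, t02 (x * y), t12 y⁻¹⁻¹, smul_neg, neg_neg]
    have e1 : x * y * y⁻¹ = x := by group
    rw [e1]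
    congr 3 <;> group
  refine ⟨⟨fun x y z => (t01 x y z).symm, fun x y z => (t12 x y z).symm,
    fun x y z => (t23 x y z).symm⟩, ?_⟩
  change d₃ G A α = 0
  ext x y z t
  -- The axiom `m_m` contains one value whose vertices are a 3-cycle of those of α(x, y, z); this
  -- even permutation costs no sign.
  have even : α x y z = α (x * y) z (y * z)⁻¹ := by
    rw [t23, t12 x, t23 (x * (y * z)), t12 (x * (y * z))]
    rw [neg_neg, neg_neg]
    congr 1 <;> group
  have H : ((0 : A) + _ • (0 : A) + 0 + α _ _ _) + _ • (0 : A) + 0 + α _ _ _ =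
      0 + _ • (0 + _ • (0 : A) + 0 + α _ _ _) + (0 + _ • _ + 0 + α _ _ _) + α _ _ _ :=
    h.m_m (g := (x * y * z * t)⁻¹) (h := (y * z * t)⁻¹) (k := (z * t)⁻¹) (l' := t)
      rfl rfl rfl rfl rfl rfl (0 : A) (0 : A) (0 : A) (0 : A) (0 : A) (0 : A)
  simp only [twisted, smul_zero, neg_zero, add_zero, zero_add] at H
  have H' : α x y (z * t) + α (x * y) z t =
      x • α y z t + α (x * y) z (y * z)⁻¹ + α x (y * z) t := by
    convert H using 2
    · congr 1 <;> group
    · congr 1 <;> group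
    · congr 1
      · congr 1
        · group
        · congr 1 <;> group
      · congr 1 <;> group
    · congr 1 <;> group
  rw [← even] at H'
  change x • α y z t - α (x * y) z t + α x (y * z) t - α x y (z * t) + α x y z = 0
  have : x • α y z t - α (x * y) z t + α x (y * z) t - α x y (z * t) + α x y z =
      (x • α y z t + α x y z + α x (y * z) t) - (α x y (z * t) + α (x * y) z t) := by abel
  rw [this, H', sub_self]

end Cocycle

/-! ### The cochain of base elements -/

section Cochain

variable {M : Type u} [TopologicalSpace M] {m₀ : M} {s : LoopSection M m₀}

theorem BaseElements.IsCochain.gmul_elt {x : BaseElements s}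
    {α : FundamentalGroup M m₀ → FundamentalGroup M m₀ → FundamentalGroup M m₀ → PiTwo M m₀}
    (hα : x.IsCochain α) {g h' h k' p q : FundamentalGroup M m₀} (e₁ : h' = h⁻¹)
    (e₂ : p = h⁻¹ * g) (e₃ : q = k' * h) :
    gmul e₁ e₂ e₃ (x.elt g h') (x.elt h k') (x.elt p q) =
      bubble (α (g⁻¹ * h) (h⁻¹ * k'⁻¹) k') (x.elt g k') := by
  subst e₁ e₂ e₃
  obtain ⟨k, rfl⟩ : ∃ k, k' = k⁻¹ := ⟨k'⁻¹, (inv_inv k').symm⟩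
  refine (hα g h k).trans ?_
  rw [inv_inv]

/-- The triples (g⁻¹h, h⁻¹k, k⁻¹) run through all triples exactly once, with `g = (a * b * c)⁻¹`, `h
= (b * c)⁻¹`, `k = c⁻¹`. So each value of α is prescribed by one product, and it exists uniquely
because π₂ acts simply transitively. -/
theorem BaseElements.existsUnique_cochain (x : BaseElements s) : ∃! α, x.IsCochain α := by
  choose α hα using fun a b c : FundamentalGroup M m₀ =>
    exists_bubble (x.elt (a * b * c)⁻¹ c) (gmul rfl rfl rfl (x.elt (a * b * c)⁻¹ (b * c)⁻¹⁻¹)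
      (x.elt (b * c)⁻¹ c) (x.elt ((b * c)⁻¹⁻¹ * (a * b * c)⁻¹) (c * (b * c)⁻¹)))
  have key : ∀ a b c g h k' : FundamentalGroup M m₀, g = (a * b * c)⁻¹ → h = (b * c)⁻¹ → k' = c →
      gmul rfl rfl rfl (x.elt g h⁻¹) (x.elt h k') (x.elt (h⁻¹ * g) (k' * h)) =
        bubble (α a b c) (x.elt g k') := by
    rintro a b c _ _ _ rfl rfl rfl
    exact (hα _ _ _).symm
  refine ⟨α, fun g h k => key _ _ _ _ _ _ (by group) (by group) rfl, fun β hβ => ?_⟩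
  funext a b c
  have h1 := hβ.gmul_elt (g := (a * b * c)⁻¹) (h := (b * c)⁻¹) (k' := c) rfl rfl rfl
  have e1 : (a * b * c)⁻¹⁻¹ * (b * c)⁻¹ = a := by group
  have e2 : (b * c)⁻¹⁻¹ * c⁻¹ = b := by group
  rw [e1, e2, ← hα] at h1
  exact (bubble_injective _ h1).symm

/-- The isomorphism of `Γ(M)` with the Δ-group of the cochain of base elements. -/
def BaseElements.IsCochain.iso {x : BaseElements s}
    {α : FundamentalGroup M m₀ → FundamentalGroup M m₀ → FundamentalGroup M m₀ → PiTwo M m₀}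
    (hα : x.IsCochain α) :
    (twisted (FundamentalGroup M m₀) (PiTwo M m₀) α).Iso (gammaData s) where
  toEquiv g h := Equiv.ofBijective (fun a : PiTwo M m₀ => bubble a (x.elt g h))
    ⟨fun _ _ h => bubble_injective _ h, fun y => exists_bubble _ y⟩
  map_m {g h' h k' p q} e₁ e₂ e₃ (a b c : PiTwo M m₀) := by
    change bubble (a + (g⁻¹ * h) • b + c + α (g⁻¹ * h) (h⁻¹ * k'⁻¹) k') (x.elt g k') =
      gmul e₁ e₂ e₃ (bubble a (x.elt g h')) (bubble b (x.elt h k')) (bubble c (x.elt p q))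
    rw [gmul_bubble, hα.gmul_elt, ← bubble_add]
  map_P {g h} (a : PiTwo M m₀) := by
    change bubble (g • a) (x.elt h (g⁻¹ * h⁻¹)) = (bubble a (x.elt g h)).P
    rw [bubble_P, x.P_elt]
  map_Q {g h} (a : PiTwo M m₀) := by
    change bubble (-(g • a)) (x.elt g⁻¹ (h * g)) = (bubble a (x.elt g h)).Q
    rw [bubble_Q, x.Q_elt]

end Cochain

/-! ### Naturality -/

section Shrink

theorem minCoord_le (p : Δ₂) (i : Fin 3) : minCoord p ≤ p i := by
  fin_cases i
  · exact min_le_left _ _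
  · exact (min_le_right _ _).trans (min_le_left _ _)
  · exact (min_le_right _ _).trans (min_le_right _ _)

theorem exists_eq_minCoord (p : Δ₂) : ∃ i, p i = minCoord p := by
  rcases min_cases (p 0) (min (p 1) (p 2)) with h | h
  · exact ⟨0, h.1.symm⟩
  · rcases min_cases (p 1) (p 2) with h' | h'
    · exact ⟨1, (h.1.trans h'.1).symm⟩
    · exact ⟨2, (h.1.trans h'.1).symm⟩

/-- The expansion of the 2-simplex from its centre that maps the points with smallest coordinate at
most `t / 6` to the boundary. -/
def stretch (t : I) (p : Δ₂) : Δ₂ :=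
  ⟨fun i => (p i - min ((t : ℝ) / 6) (minCoord p)) / (1 - 3 * min ((t : ℝ) / 6) (minCoord p)), fun i =>
    div_nonneg (sub_nonneg.2 ((min_le_right _ _).trans (minCoord_le p i)))
      (by linarith [min_le_left ((t : ℝ) / 6) (minCoord p), t.2.2]), by
    change ∑ i, (p i - min ((t : ℝ) / 6) (minCoord p)) / (1 - 3 * min ((t : ℝ) / 6) (minCoord p)) = 1
    rw [← Finset.sum_div, div_eq_one_iff_eq
      (by linarith [min_le_left ((t : ℝ) / 6) (minCoord p), t.2.2]), Finset.sum_sub_distrib,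
      stdSimplex.sum_eq_one]
    simp⟩

theorem stretch_apply (t : I) (p : Δ₂) (i : Fin 3) : stretch t p i =
    (p i - min ((t : ℝ) / 6) (minCoord p)) / (1 - 3 * min ((t : ℝ) / 6) (minCoord p)) := rfl

@[fun_prop]
theorem continuous_stretch {Z : Type*} [TopologicalSpace Z] {t : Z → I} {p : Z → Δ₂}
    (ht : Continuous t) (hp : Continuous p) : Continuous fun z => stretch (t z) (p z) := by
  refine continuous_simplex_mk fun i => ?_
  simp only [stretch_apply]
  refine Continuous.div (by fun_prop) (by fun_prop) fun z => ?_
  linarith [min_le_left ((t z : ℝ) / 6) (minCoord (p z)), (t z).2.2]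

theorem stretch_eq {t : I} {p : Δ₂} (h : min ((t : ℝ) / 6) (minCoord p) = 0) : stretch t p = p := by
  ext i
  rw [stretch_apply, h]
  simp

theorem stretch_zero (p : Δ₂) : stretch 0 p = p :=
  stretch_eq (by simpa using minCoord_nonneg p)

theorem stretch_of_mem_bdry (t : I) {p : Δ₂} (hp : p ∈ bdry) : stretch t p = p :=
  stretch_eq (by rw [minCoord_eq_zero hp]; exact min_eq_right (div_nonneg t.2.1 (by norm_num)))

theorem stretch_mem_bdry {t : I} {p : Δ₂} (h : 6 * minCoord p ≤ t) : stretch t p ∈ bdry := by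
  obtain ⟨i, hi⟩ := exists_eq_minCoord p
  refine ⟨i, ?_⟩
  rw [stretch_apply, min_eq_right (by linarith), hi, sub_self, zero_div]

end Shrink

/-! ### Homotopies of triangles with moving edges -/

section EdgeMap

variable {G : Type*} [Group G] {Z : Type*} {N : Type*}

open Classical in
/-- The map of the boundary of the 2-simplex with given edges; the values at other points are
irrelevant. -/
def edgeMap (e : G → Z → I → N) (g h : G) (z : Z) (p : Δ₂) : N :=
  if p 2 = 0 then e g z (coord p 1) else if p 0 = 0 then e h z (coord p 2)
  else e (h * g) z (coord p 2)

/-- The edges of a family begin and end at points that depend on the parameter only. -/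
def IsClosedFamily (e : G → Z → I → N) : Prop :=
  ∀ g h z, e g z 0 = e h z 0 ∧ e g z 1 = e h z 0

theorem edgeMap_two {e : G → Z → I → N} (g h : G) (z : Z) {p : Δ₂} (hp : p 2 = 0) :
    edgeMap e g h z p = e g z (coord p 1) :=
  if_pos hp

theorem edgeMap_zero {e : G → Z → I → N} (he : IsClosedFamily e) (g h : G) (z : Z) {p : Δ₂}
    (hp : p 0 = 0) : edgeMap e g h z p = e h z (coord p 2) := by
  unfold edgeMap
  split_ifs with h2
  · have e1 : coord p 1 = 1 := Subtype.ext (by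
      change p 1 = 1
      linarith [Δ₂.sum p])
    have e2 : coord p 2 = 0 := Subtype.ext h2
    rw [e1, e2, (he g h z).2]
  · rfl

theorem edgeMap_one {e : G → Z → I → N} (he : IsClosedFamily e) (g h : G) (z : Z) {p : Δ₂}
    (hp : p 1 = 0) : edgeMap e g h z p = e (h * g) z (coord p 2) := by
  unfold edgeMap
  split_ifs with h2 h0
  · have e1 : coord p 1 = 0 := Subtype.ext hp
    have e2 : coord p 2 = 0 := Subtype.ext h2
    rw [e1, e2, (he g (h * g) z).1]
  · have e2 : coord p 2 = 1 := Subtype.ext (by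
      change p 2 = 1
      linarith [Δ₂.sum p])
    rw [e2, (he h h z).2, (he (h * g) h z).2]
  · rfl

variable [TopologicalSpace Z] [TopologicalSpace N]

theorem isTri_iff {e : G → Z → I → N} (he : IsClosedFamily e) {g h : G} {A : C(Z × Δ₂, N)} :
    IsTri e g h A ↔ ∀ z, ∀ p ∈ bdry, A (z, p) = edgeMap e g h z p := by
  constructor
  · rintro ⟨h2, h0, h1⟩ z p hp
    rcases mem_bdry_cases hp with hp | hp | hp
    · rw [h0 z p hp, edgeMap_zero he g h z hp]
    · rw [h1 z p hp, edgeMap_one he g h z hp]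
    · rw [h2 z p hp, edgeMap_two g h z hp]
  · intro H
    exact ⟨fun z p hp => (H z p ⟨2, hp⟩).trans (edgeMap_two g h z hp),
      fun z p hp => (H z p ⟨0, hp⟩).trans (edgeMap_zero he g h z hp),
      fun z p hp => (H z p ⟨1, hp⟩).trans (edgeMap_one he g h z hp)⟩

/-- A continuous map that agrees with maps of edges can be extended by them. -/
theorem exists_extension_edgeMap {e : G → Z → I → N} (he : IsClosedFamily e)
    (hc : ∀ g, Continuous fun w : Z × I => e g w.1 w.2) (g h : G) {X : Type*} [TopologicalSpace X]
    {S S' : Set X} (hS : IsClosed S) (hS' : IsClosed S') (hSS : ∀ x, x ∈ S ∨ x ∈ S') (J : C(X, N))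
    {T : X → Z} (hT : Continuous T) {D : X → Δ₂} (cD : Continuous D) (hD : ∀ x ∈ S', D x ∈ bdry)
    (hJ : ∀ x ∈ S, x ∈ S' → J x = edgeMap e g h (T x) (D x)) :
    ∃ F : C(X, N), (∀ x ∈ S, F x = J x) ∧ ∀ x ∈ S', F x = edgeMap e g h (T x) (D x) := by
  classical
  let F : X → N := fun x => if x ∈ S then J x else edgeMap e g h (T x) (D x)
  have h1 : ∀ x ∈ S, F x = J x := fun x hx => if_pos hx
  have h2 : ∀ x ∈ S', F x = edgeMap e g h (T x) (D x) := fun x hx => by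
    by_cases hx' : x ∈ S
    · rw [h1 x hx', hJ x hx' hx]
    · exact if_neg hx'
  have hcl : ∀ i, IsClosed (S' ∩ {x | D x i = 0}) := fun i =>
    hS'.inter (isClosed_eq (by fun_prop) continuous_const)
  have hcont : ∀ g i, Continuous fun x => e g (T x) (coord (D x) i) := fun g i =>
    (hc g).comp (hT.prodMk (by fun_prop))
  have c1 : ContinuousOn F S := J.continuous.continuousOn.congr h1
  have c2 : ContinuousOn F (S' ∩ {x | D x 2 = 0}) := (hcont g 1).continuousOn.congr fun x hx =>
    (h2 x hx.1).trans (edgeMap_two g h _ hx.2)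
  have c3 : ContinuousOn F (S' ∩ {x | D x 0 = 0}) := (hcont h 2).continuousOn.congr fun x hx =>
    (h2 x hx.1).trans (edgeMap_zero he g h _ hx.2)
  have c4 : ContinuousOn F (S' ∩ {x | D x 1 = 0}) := (hcont (h * g) 2).continuousOn.congr
    fun x hx => (h2 x hx.1).trans (edgeMap_one he g h _ hx.2)
  have c := c1.union_of_isClosed (c2.union_of_isClosed (c3.union_of_isClosed c4 (hcl 0) (hcl 1))
    (hcl 2) ((hcl 0).union (hcl 1))) hS ((hcl 2).union ((hcl 0).union (hcl 1)))
  refine ⟨⟨F, continuousOn_univ.1 (c.mono fun x _ => ?_)⟩, h1, h2⟩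
  rcases hSS x with hx | hx
  · exact .inl hx
  · rcases mem_bdry_cases (hD x hx) with h0 | h0 | h0
    · exact .inr (.inr (.inl ⟨hx, h0⟩))
    · exact .inr (.inr (.inr ⟨hx, h0⟩))
    · exact .inr (.inl ⟨hx, h0⟩)

theorem IsTri.P {e : G → Z → I → N} (he : IsReversible e) {g h : G} {A : C(Z × Δ₂, N)}
    (hA : IsTri e g h A) : IsTri e h (g⁻¹ * h⁻¹) (faceFamily A ![1, 2, 0]) := by
  obtain ⟨h01, h12, h02⟩ := hA
  have e0 : ∀ p, face ![(1 : Fin 3), 2, 0] p 0 = p 2 := fun p => by simp [face_apply]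
  have e1 : ∀ p, face ![(1 : Fin 3), 2, 0] p 1 = p 0 := fun p => by simp [face_apply]
  have e2 : ∀ p, face ![(1 : Fin 3), 2, 0] p 2 = p 1 := fun p => by simp [face_apply]
  refine ⟨fun z p hp => ?_, fun z p hp => ?_, fun z p hp => ?_⟩
  · rw [faceFamily_apply, h12 _ _ ((e0 p).trans hp), coord_congr (e2 p)]
  · rw [faceFamily_apply, h02 _ _ ((e1 p).trans hp), coord_congr (e2 p), ← mul_inv_rev]
    refine (he _ _ _ _ ?_).symm
    simp only [coord]; linarith [Δ₂.sum p]
  · rw [faceFamily_apply, h01 _ _ ((e2 p).trans hp), coord_congr (e1 p), inv_mul_cancel_right]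
    refine (he _ _ _ _ ?_).symm
    simp only [coord]; linarith [Δ₂.sum p]

theorem IsTri.Q {e : G → Z → I → N} (he : IsReversible e) {g h : G} {A : C(Z × Δ₂, N)}
    (hA : IsTri e g h A) : IsTri e g⁻¹ (h * g) (faceFamily A ![1, 0, 2]) := by
  obtain ⟨h01, h12, h02⟩ := hA
  have e0 : ∀ p, face ![(1 : Fin 3), 0, 2] p 0 = p 1 := fun p => by simp [face_apply]
  have e1 : ∀ p, face ![(1 : Fin 3), 0, 2] p 1 = p 0 := fun p => by simp [face_apply]
  have e2 : ∀ p, face ![(1 : Fin 3), 0, 2] p 2 = p 2 := fun p => by simp [face_apply]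
  refine ⟨fun z p hp => ?_, fun z p hp => ?_, fun z p hp => ?_⟩
  · rw [faceFamily_apply, h01 _ _ ((e2 p).trans hp), coord_congr (e1 p)]
    refine (he _ _ _ _ ?_).symm
    simp only [coord]; linarith [Δ₂.sum p]
  · rw [faceFamily_apply, h02 _ _ ((e1 p).trans hp), coord_congr (e2 p)]
  · rw [faceFamily_apply, h12 _ _ ((e0 p).trans hp), coord_congr (e2 p), mul_inv_cancel_right]

end EdgeMap

/-! ### Prisms between triangles of two spaces -/

section Prism

variable {M : Type u} [TopologicalSpace M] {m₀ : M} {N : Type v} [TopologicalSpace N] {n₀ : N}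
variable {s : LoopSection M m₀} {s' : LoopSection N n₀} {f : C(M, N)} {γ : Path (f m₀) n₀}
variable {φ : FundamentalGroup M m₀ ≃* FundamentalGroup N n₀}
variable {e : FundamentalGroup M m₀ → I → I → N}

/-- Homotopies from the images of the loops of `s` under `f` to the loops of `s'` under which the
base point travels along `γ`. -/
structure IsSquareFamily (f : C(M, N)) (γ : Path (f m₀) n₀) (s : LoopSection M m₀)
    (s' : LoopSection N n₀) (φ : FundamentalGroup M m₀ ≃* FundamentalGroup N n₀)
    (e : FundamentalGroup M m₀ → I → I → N) : Prop where
  continuous : ∀ g, Continuous fun w : I × I => e g w.1 w.2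
  zero : ∀ g t, e g 0 t = f (s.loop g t)
  one : ∀ g t, e g 1 t = s'.loop (φ g) t
  left : ∀ g τ, e g τ 0 = γ τ
  right : ∀ g τ, e g τ 1 = γ τ
  reversible : IsReversible e

theorem IsSquareFamily.isClosedFamily (he : IsSquareFamily f γ s s' φ e) : IsClosedFamily e :=
  fun g h z => ⟨by rw [he.left, he.left], by rw [he.right, he.left]⟩

/-- The square is cut along its diagonal, on which the map is `c` followed by `d`. One half is a
triangle from the given homotopy, the other a triangle from the constant homotopy of the diagonal
path. -/
theorem exists_square {X : Type*} [TopologicalSpace X] {x y z t : X} {a : Path x y} {b : Path y t}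
    {c : Path x z} {d : Path z t} (h : (a.trans b).Homotopic (c.trans d)) :
    ∃ H : C(I × I, X), (∀ r, H (0, r) = a r) ∧ (∀ r, H (1, r) = d r) ∧ (∀ r, H (r, 0) = c r) ∧
      ∀ r, H (r, 1) = b r := by
  obtain ⟨F, F2, F0, F1⟩ := exists_simplex_of_homotopic h
  obtain ⟨F', F2', F0', F1'⟩ := exists_simplex_of_homotopic (Path.Homotopic.refl (c.trans d))
  have l : ∀ r : I, (0 : ℝ) ≤ r := fun r => r.2.1
  have l' : ∀ r : I, (r : ℝ) ≤ 1 := fun r => r.2.2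
  let q : I × I → Δ₂ := fun w => pt (1 - max (w.1 : ℝ) w.2) (|(w.1 : ℝ) - w.2|) (min (w.1 : ℝ) w.2)
    (sub_nonneg.2 (max_le (l' _) (l' _))) (abs_nonneg _) (le_min (l _) (l _))
    (by rcases le_total (w.1 : ℝ) w.2 with h | h
        · rw [max_eq_right h, min_eq_left h, abs_of_nonpos (by linarith)]; ring
        · rw [max_eq_left h, min_eq_right h, abs_of_nonneg (by linarith)]; ring)
  have cq : Continuous q := continuous_pt _ _ _ _ (by fun_prop) (by fun_prop) (by fun_prop)
  have q0 : ∀ w, q w 0 = 1 - max (w.1 : ℝ) w.2 := fun w => rfl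
  have q1 : ∀ w, q w 1 = |(w.1 : ℝ) - w.2| := fun w => rfl
  have q2 : ∀ w, q w 2 = min (w.1 : ℝ) w.2 := fun w => rfl
  have hd : ∀ w : I × I, (w.1 : ℝ) = w.2 → F (q w) = F' (q w) := fun w hw => by
    have : q w 1 = 0 := by rw [q1, hw, sub_self, abs_zero]
    rw [F1 _ this, F1' _ this]
  let H : C(I × I, X) := ⟨fun w => if (w.1 : ℝ) ≤ w.2 then F (q w) else F' (q w),
    Continuous.if_le (by fun_prop) (by fun_prop) (by fun_prop) (by fun_prop) hd⟩
  have H1 : ∀ w : I × I, (w.1 : ℝ) ≤ w.2 → H w = F (q w) := fun w hw => if_pos hw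
  have H2 : ∀ w : I × I, (w.2 : ℝ) ≤ w.1 → H w = F' (q w) := fun w hw => by
    rcases hw.eq_or_lt with h | h
    · rw [H1 w h.ge, hd w h.symm]
    · exact if_neg h.not_ge
  refine ⟨H, fun r => ?_, fun r => ?_, fun r => ?_, fun r => ?_⟩
  · rw [H1 _ (l r), F2 _ (by rw [q2]; exact min_eq_left (l r))]
    congr 1
    exact Subtype.ext (by change |(0 : ℝ) - r| = r; rw [zero_sub, abs_neg, abs_of_nonneg (l r)])
  · rw [H2 _ (l' r), F0' _ (by rw [q0]; exact sub_eq_zero.2 (max_eq_left (l' r)).symm)]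
    congr 1
    exact Subtype.ext (min_eq_right (l' r))
  · rw [H2 _ (l r), F2' _ (by rw [q2]; exact min_eq_right (l r))]
    congr 1
    exact Subtype.ext (by change |(r : ℝ) - 0| = r; rw [sub_zero, abs_of_nonneg (l r)])
  · rw [H1 _ (l' r), F0 _ (by rw [q0]; exact sub_eq_zero.2 (max_eq_right (l' r)).symm)]
    congr 1
    exact Subtype.ext (min_eq_left (l' r))

/-- The hypothesis on `φ` says that the image of the loop of `g` followed by γ is homotopic to γ
followed by the loop of `φ g`, so a square exists for each `g`. Reversing the loop direction is an
involution on squares, and the square for 1 depends on time only. -/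
theorem exists_squareFamily (h₂ : ∀ g : FundamentalGroup M m₀, g⁻¹ = g → g = 1)
    (f : C(M, N)) (γ : Path (f m₀) n₀) (s : LoopSection M m₀) (s' : LoopSection N n₀)
    (φ : FundamentalGroup M m₀ ≃* FundamentalGroup N n₀)
    (hφ : ∀ g, (φ g).toPath = (Path.Homotopic.Quotient.mk γ).symm.trans
      ((Path.Homotopic.Quotient.map g.toPath f).trans (Path.Homotopic.Quotient.mk γ))) :
    ∃ e, IsSquareFamily f γ s s' φ e := by
  obtain ⟨c, hc, hi, -⟩ := exists_involutive_choice (X := C(I × I, N)) h₂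
    (R := fun g H => (∀ t, H (0, t) = f (s.loop g t)) ∧ (∀ t, H (1, t) = s'.loop (φ g) t) ∧
      (∀ τ, H (τ, 0) = γ τ) ∧ ∀ τ, H (τ, 1) = γ τ)
    (r := fun H => H.comp ⟨fun w => (w.1, unitInterval.symm w.2), by fun_prop⟩)
    (fun H => ContinuousMap.ext fun w => by simp)
    (fun g H h => by
      refine ⟨fun t => ?_, fun t => ?_, fun τ => ?_, fun τ => ?_⟩
      · refine (h.1 _).trans ?_
        rw [s.loop_inv]; rfl
      · refine (h.2.1 _).trans ?_
        rw [map_inv, s'.loop_inv]; rfl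
      · simpa using h.2.2.2 τ
      · simpa using h.2.2.1 τ)
    (x₁ := ⟨fun w => γ w.1, by fun_prop⟩)
    ⟨fun t => by rw [s.loop_one]; exact γ.source, fun t => by
      rw [map_one, s'.loop_one]; exact γ.target, fun _ => rfl, fun _ => rfl⟩
    rfl (fun g => by
      obtain ⟨H, h0, h1, h2, h3⟩ := exists_square (a := (s.loop g).map f.continuous) (b := γ)
        (c := γ) (d := s'.loop (φ g)) (by
          refine Path.Homotopic.Quotient.eq.1 ?_
          rw [Path.Homotopic.Quotient.mk_trans, Path.Homotopic.Quotient.mk_trans, s'.class_loop, hφ,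
            ← Path.Homotopic.Quotient.trans_assoc, Path.Homotopic.Quotient.trans_symm,
            Path.Homotopic.Quotient.refl_trans, ← s.class_loop g]
          rfl)
      exact ⟨H, h0, h1, h2, h3⟩)
  refine ⟨fun g τ t => c g (τ, t), fun g => (c g).continuous, fun g => (hc g).1,
    fun g => (hc g).2.1, fun g => (hc g).2.2.1, fun g => (hc g).2.2.2, fun g τ t t' h => ?_⟩
  rw [hi]
  refine congrArg (fun r => c g (τ, r)) (Subtype.ext ?_)
  rw [unitInterval.coe_symm_eq]
  linarith

/-- The class `v` is obtained from the image of the class `x` under `f` by a homotopy that moves the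
edges along `e`. -/
def Prism (f : C(M, N)) (e : FundamentalGroup M m₀ → I → I → N) {g h : FundamentalGroup M m₀}
    (x : Gamma s g h) {g' h' : FundamentalGroup N n₀} (v : Gamma s' g' h') : Prop :=
  ∃ (K : C(I × Δ₂, N)) (a : C(Δ₂, M)) (b : C(Δ₂, N)), Rep x a ∧ Rep v b ∧
    (∀ p, K (0, p) = f (a p)) ∧ (∀ p, K (1, p) = b p) ∧ IsTri e g h K

theorem Prism.P (he : IsReversible e) {g h : FundamentalGroup M m₀} {x : Gamma s g h}
    {g' h' : FundamentalGroup N n₀} {v : Gamma s' g' h'} (hx : Prism f e x v) :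
    Prism f e x.P v.P := by
  obtain ⟨K, a, b, ha, hb, h0, h1, hK⟩ := hx
  exact ⟨_, _, _, ha.P, hb.P, fun p => h0 _, fun p => h1 _, hK.P he⟩

theorem Prism.Q (he : IsReversible e) {g h : FundamentalGroup M m₀} {x : Gamma s g h}
    {g' h' : FundamentalGroup N n₀} {v : Gamma s' g' h'} (hx : Prism f e x v) :
    Prism f e x.Q v.Q := by
  obtain ⟨K, a, b, ha, hb, h0, h1, hK⟩ := hx
  exact ⟨_, _, _, ha.Q, hb.Q, fun p => h0 _, fun p => h1 _, hK.Q he⟩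

/-- Three prisms form a homotopy of horns. Filling it over the time interval gives a prism over the
fourth face, whose two ends compute the two products. -/
theorem Prism.gmul (he : IsSquareFamily f γ s s' φ e) {g h' h k' p q : FundamentalGroup M m₀}
    (e₁ : h' = h⁻¹) (e₂ : p = h⁻¹ * g) (e₃ : q = k' * h) (e₁' : φ h' = (φ h)⁻¹)
    (e₂' : φ p = (φ h)⁻¹ * φ g) (e₃' : φ q = φ k' * φ h) {x : Gamma s g h'} {y : Gamma s h k'}
    {z : Gamma s p q} {x' : Gamma s' (φ g) (φ h')} {y' : Gamma s' (φ h) (φ k')}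
    {z' : Gamma s' (φ p) (φ q)} (hx : Prism f e x x') (hy : Prism f e y y')
    (hz : Prism f e z z') :
    Prism f e (gmul e₁ e₂ e₃ x y z) (DeltaGrp.gmul e₁' e₂' e₃' x' y' z') := by
  obtain ⟨A, _, _, ⟨a, rfl, rfl⟩, hA, A0, A1, tA⟩ := hx
  obtain ⟨B, _, _, ⟨b, rfl, rfl⟩, hB, B0, B1, tB⟩ := hy
  obtain ⟨C, _, _, ⟨c, rfl, rfl⟩, hC, C0, C1, tC⟩ := hz
  obtain ⟨Ψ, hΨ, ΨA, ΨB, ΨC, ΨD⟩ := exists_fill_family he.reversible e₁ e₂ e₃ tA tB tC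
  obtain ⟨Ψ₀, hΨ₀, Ψ₀A, Ψ₀B, Ψ₀C, Ψ₀D⟩ := exists_fill_family (isReversible_loop (Y := Unit) s)
    e₁ e₂ e₃ a.isTri b.isTri c.isTri
  let ω : C(Δ₃, M) := Ψ₀.comp ((ContinuousMap.const _ ()).prodMk (ContinuousMap.id _))
  let ω' : C(Δ₃, N) := Ψ.comp ((ContinuousMap.const _ 1).prodMk (ContinuousMap.id _))
  -- Both fillings factor through the retraction onto the horn, so the agreement on the three given
  -- faces implies agreement on the whole simplex.
  have h0 : ∀ x, Ψ (0, x) = f (ω x) := fun x => by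
    rw [← hΨ]
    refine (eq_hornRetract (ω := fun x => Ψ (0, x)) (ω' := fun x => f (ω x)) (fun p => ?_)
      (fun p => ?_) (fun p => ?_) x).trans (congrArg f (hΨ₀ () x))
    · exact (DFunLike.congr_fun ΨA (0, p)).trans ((A0 p).trans
        (congrArg f (DFunLike.congr_fun Ψ₀A ((), p)).symm))
    · exact (DFunLike.congr_fun ΨB (0, p)).trans ((B0 p).trans
        (congrArg f (DFunLike.congr_fun Ψ₀B ((), p)).symm))
    · exact (DFunLike.congr_fun ΨC (0, p)).trans ((C0 p).trans
        (congrArg f (DFunLike.congr_fun Ψ₀C ((), p)).symm))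
  let d' : Triangle s' (φ g) (φ k') := ⟨ω'.comp (face ![1, 2, 3]),
    fun p hp => (ΨD.1 1 p hp).trans (he.one _ _), fun p hp => (ΨD.2.1 1 p hp).trans (he.one _ _),
    fun p hp => (ΨD.2.2 1 p hp).trans ((he.one _ _).trans (by rw [map_mul]))⟩
  have hd : DeltaGrp.gmul e₁ e₂ e₃ (Gamma.mk a) (Gamma.mk b) (Gamma.mk c) =
      Gamma.mk (Ψ₀D.triangle (z := ())) :=
    m_eq_of_rep e₁ e₂ e₃ ω
      ⟨a, rfl, ContinuousMap.ext fun p => (DFunLike.congr_fun Ψ₀A ((), p)).symm⟩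
      ⟨b, rfl, ContinuousMap.ext fun p => (DFunLike.congr_fun Ψ₀B ((), p)).symm⟩
      ⟨c, rfl, ContinuousMap.ext fun p => (DFunLike.congr_fun Ψ₀C ((), p)).symm⟩
      ⟨_, rfl, rfl⟩
  have hd' : DeltaGrp.gmul e₁' e₂' e₃' x' y' z' = Gamma.mk d' := by
    refine m_eq_of_rep e₁' e₂' e₃' ω' ?_ ?_ ?_ ⟨d', rfl, rfl⟩
    · convert hA using 1
      exact ContinuousMap.ext fun p => (DFunLike.congr_fun ΨA (1, p)).trans (A1 p)
    · convert hB using 1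
      exact ContinuousMap.ext fun p => (DFunLike.congr_fun ΨB (1, p)).trans (B1 p)
    · convert hC using 1
      exact ContinuousMap.ext fun p => (DFunLike.congr_fun ΨC (1, p)).trans (C1 p)
  rw [hd, hd']
  exact ⟨faceFamily Ψ ![1, 2, 3], _, _, ⟨_, rfl, rfl⟩, ⟨_, rfl, rfl⟩, fun p => h0 _, fun p => rfl,
    ΨD⟩

/-- In a prism the corner [0] travels along γ. The homotopy from the image of the sphere to its
transport along γ can therefore be inserted at that corner throughout. -/
theorem Prism.bubble (he : IsSquareFamily f γ s s' φ e) {g h : FundamentalGroup M m₀}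
    {x : Gamma s g h} {g' h' : FundamentalGroup N n₀} {v : Gamma s' g' h'} (hx : Prism f e x v)
    (a : PiTwo M m₀) : Prism f e (bubble a x) (DeltaGrp.bubble
      (transport (Path.Homotopic.Quotient.mk γ) (mapPiTwo f m₀ a)) v) := by
  obtain ⟨a, rfl⟩ := PiTwo.mk_surjective a
  obtain ⟨K, u, w, hu, hw, h0, h1, hK⟩ := hx
  obtain ⟨F, F0, F1, Fb⟩ := freeHomotopic_transportLoop γ (mapLoop f a)
  have c2 := continuous_pinch
  have hv : ∀ τ, K (τ, stdSimplex.vertex 0) = γ τ := fun τ => by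
    rw [hK.1 τ _ (by simp), ← he.left g]
    congr 1
  let K' : C(I × Δ₂, N) := ⟨fun w => if 1 / 8 ≤ minCoord w.2 then F (w.1, bubbleSquare w.2)
      else K (w.1, pinch w.2), by
    refine Continuous.if_le (by fun_prop) (by fun_prop) (by fun_prop) (by fun_prop) fun w hw => ?_
    rw [pinch_of_le hw.le, hv, Fb _ _ (bubbleSquare_mem hw.symm)]⟩
  have hK' : ∀ τ p, K' (τ, p) = if 1 / 8 ≤ minCoord p then F (τ, bubbleSquare p)
    else K (τ, pinch p) := fun τ p => rfl
  have hb : ∀ τ, ∀ p ∈ bdry, K' (τ, p) = K (τ, p) := fun τ p hp => by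
    rw [hK', if_neg (by rw [minCoord_eq_zero hp]; norm_num), pinch_of_mem_bdry hp]
  obtain ⟨u', hu'⟩ := exists_insertion (x := u) (v := stdSimplex.vertex 0)
    (F := fun p => a (bubbleSquare p)) (a.1.continuous.comp continuous_bubbleSquare)
    (fun p hp => by rw [hu.vertex_zero]; exact GenLoop.boundary a _ (bubbleSquare_mem hp))
  refine ⟨K', u', K'.comp ((ContinuousMap.const _ 1).prodMk (ContinuousMap.id _)), hu.bubble hu',
    hw.bubble (a := transportLoop γ (mapLoop f a)) fun p => ?_, fun p => ?_, fun p => rfl,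
    fun z p hp => (hb z p ⟨2, hp⟩).trans (hK.1 z p hp),
    fun z p hp => (hb z p ⟨0, hp⟩).trans (hK.2.1 z p hp),
    fun z p hp => (hb z p ⟨1, hp⟩).trans (hK.2.2 z p hp)⟩
  · change K' (1, p) = _
    rw [hK', F1, h1, pinch_eq_lerp]
  · rw [hK', hu' p, F0, h0, pinch_eq_lerp]
    split_ifs <;> rfl

/-- The triangle shrinks with time, and the growing collar is filled by the moving edges. -/
theorem Prism.exists (he : IsSquareFamily f γ s s' φ e) {g h : FundamentalGroup M m₀}
    (x : Gamma s g h) : ∃ v : Gamma s' (φ g) (φ h), Prism f e x v := by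
  obtain ⟨u, rfl⟩ := Gamma.exists_rep x
  have hc := he.isClosedFamily
  have hu : ∀ p ∈ bdry, f (u.1 p) = edgeMap e g h 0 p := fun p hp => by
    rcases mem_bdry_cases hp with hp | hp | hp
    · rw [edgeMap_zero hc g h _ hp, he.zero, u.2.2.1 p hp]
    · rw [edgeMap_one hc g h _ hp, he.zero, u.2.2.2 p hp]
    · rw [edgeMap_two g h _ hp, he.zero, u.2.1 p hp]
  -- The smallest coordinate is at most 1/3, so the factor 6 leaves an inner triangle at time 1.
  -- Across the collar at time `w.1`, the time of the edges decreases from `w.1` on the outer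
  -- boundary to 0 on the inner one.
  obtain ⟨K, hK, hK'⟩ := exists_extension_edgeMap hc he.continuous g h (X := I × Δ₂)
    (S := {w | (w.1 : ℝ) ≤ 6 * minCoord w.2}) (S' := {w | 6 * minCoord w.2 ≤ w.1})
    (isClosed_le (by fun_prop) (by fun_prop)) (isClosed_le (by fun_prop) (by fun_prop))
    (fun w => le_total (w.1 : ℝ) (6 * minCoord w.2)) ⟨fun w => f (u.1 (stretch w.1 w.2)), by fun_prop⟩
    (T := fun w => trunc (w.1 - 6 * minCoord w.2)) (by fun_prop)
    (D := fun w => stretch w.1 w.2) (by fun_prop) (fun w hw => stretch_mem_bdry hw)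
    (fun w hw hw' => by
      rw [trunc_of_le (sub_nonpos.2 hw)]
      exact hu _ (stretch_mem_bdry hw'))
  have tK : IsTri e g h K := (isTri_iff hc).2 fun z p hp => by
    have := minCoord_eq_zero hp
    rw [hK' (z, p) (by change 6 * minCoord p ≤ (z : ℝ); rw [this, mul_zero]; exact z.2.1),
      stretch_of_mem_bdry z hp, this, mul_zero, sub_zero, trunc_coe]
  refine ⟨Gamma.mk ⟨K.comp ((ContinuousMap.const _ 1).prodMk (ContinuousMap.id _)),
    fun p hp => (tK.1 1 p hp).trans (he.one _ _), fun p hp => (tK.2.1 1 p hp).trans (he.one _ _),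
    fun p hp => (tK.2.2 1 p hp).trans ((he.one _ _).trans (by rw [map_mul]))⟩, K, u.1, _,
    rep_mk u, rep_mk _, fun p => ?_, fun p => rfl, tK⟩
  rw [hK (0, p) (by simpa using minCoord_nonneg p)]
  exact congrArg (fun q => f (u.1 q)) (stretch_zero p)

/-- The end of a homotopy with prescribed edges is homotopic to its beginning with a collar. -/
theorem exists_collar (he : IsSquareFamily f γ s s' φ e) {g h : FundamentalGroup M m₀}
    {K : C(I × Δ₂, N)} (hK : IsTri e g h K) {a : C(Δ₂, N)} (ha : ∀ p, K (1, p) = a p) :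
    ∃ c : C(Δ₂, N), a.HomotopicRel c bdry ∧ (∀ p, 1 ≤ 6 * minCoord p → c p = K (0, stretch 1 p)) ∧
      ∀ p, 6 * minCoord p ≤ 1 → c p = edgeMap e g h (trunc (1 - 6 * minCoord p)) (stretch 1 p) := by
  have hc := he.isClosedFamily
  have eK := (isTri_iff hc).1 hK
  -- The inner triangle runs through `K` backwards while the collar fills with the edges passed
  -- over, so that the outer boundary stays at time 1.
  obtain ⟨F, hF, hF'⟩ := exists_extension_edgeMap hc he.continuous g h (X := I × Δ₂)
    (S := {w | 1 ≤ 6 * minCoord w.2}) (S' := {w | 6 * minCoord w.2 ≤ 1})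
    (isClosed_le (by fun_prop) (by fun_prop)) (isClosed_le (by fun_prop) (by fun_prop))
    (fun w => le_total 1 (6 * minCoord w.2))
    ⟨fun w => K (unitInterval.symm w.1, stretch 1 w.2), by fun_prop⟩
    (T := fun w => trunc (1 - 6 * minCoord w.2 * w.1)) (by fun_prop)
    (D := fun w => stretch 1 w.2) (by fun_prop) (fun w hw => stretch_mem_bdry hw)
    (fun w hw hw' => by
      have e1 : 6 * minCoord w.2 = 1 := le_antisymm hw' hw
      have e2 : trunc (1 - 6 * minCoord w.2 * w.1) = unitInterval.symm w.1 := by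
        rw [e1, one_mul, ← trunc_coe (unitInterval.symm w.1), unitInterval.coe_symm_eq]
      rw [e2]
      exact eK _ _ (stretch_mem_bdry hw'))
  have h1 : a.HomotopicRel (a.comp ⟨stretch 1, by fun_prop⟩) bdry :=
    homotopicRel_comp_of_eqOn a (f := ContinuousMap.id _) fun p hp =>
      (stretch_of_mem_bdry 1 hp).symm
  have h2 : ∀ p, F (0, p) = a (stretch 1 p) := fun p => by
    rcases le_total 1 (6 * minCoord p) with hp | hp
    · rw [hF (0, p) hp]
      change K (unitInterval.symm 0, stretch 1 p) = _
      rw [unitInterval.symm_zero, ha]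
    · rw [hF' (0, p) hp, ← ha, eK _ _ (stretch_mem_bdry hp)]
      congr 1
      exact trunc_of_ge (by simp)
  refine ⟨F.comp ((ContinuousMap.const _ 1).prodMk (ContinuousMap.id _)),
    h1.trans ⟨⟨⟨F, h2, fun p => rfl⟩, fun t p hp => ?_⟩⟩, fun p hp => ?_, fun p hp => ?_⟩
  · have e0 := minCoord_eq_zero hp
    change F (t, p) = a (stretch 1 p)
    rw [hF' (t, p) (by change 6 * minCoord p ≤ 1; rw [e0]; norm_num), e0, ← ha,
      stretch_of_mem_bdry 1 hp, eK 1 p hp]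
    congr 1
    exact trunc_of_ge (by simp)
  · change F (1, p) = _
    rw [hF (1, p) hp]
    change K (unitInterval.symm 1, stretch 1 p) = _
    rw [unitInterval.symm_one]
  · change F (1, p) = _
    rw [hF' (1, p) hp, Set.Icc.coe_one, mul_one]

/-- The end of a homotopy with prescribed edges is determined by its beginning up to homotopy. -/
theorem homotopicRel_of_isTri (he : IsSquareFamily f γ s s' φ e) {g h : FundamentalGroup M m₀}
    {K L : C(I × Δ₂, N)} (hK : IsTri e g h K) (hL : IsTri e g h L)
    (H : C(I × Δ₂, N)) (h0 : ∀ p, H (0, p) = K (0, p)) (h1 : ∀ p, H (1, p) = L (0, p))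
    (hH : ∀ t, ∀ p ∈ bdry, H (t, p) = K (0, p)) {a b : C(Δ₂, N)} (ha : ∀ p, K (1, p) = a p)
    (hb : ∀ p, L (1, p) = b p) : a.HomotopicRel b bdry := by
  have hc := he.isClosedFamily
  have eK := (isTri_iff hc).1 hK
  obtain ⟨c, hac, ci, co⟩ := exists_collar he hK ha
  obtain ⟨d, hbd, di, d_o⟩ := exists_collar he hL hb
  -- Both ends have the same collar, built from the edges alone; the given homotopy of the
  -- beginnings is placed on the inner triangle.
  obtain ⟨F, hF, hF'⟩ := exists_extension_edgeMap hc he.continuous g h (X := I × Δ₂)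
    (S := {w | 1 ≤ 6 * minCoord w.2}) (S' := {w | 6 * minCoord w.2 ≤ 1})
    (isClosed_le (by fun_prop) (by fun_prop)) (isClosed_le (by fun_prop) (by fun_prop))
    (fun w => le_total 1 (6 * minCoord w.2)) ⟨fun w => H (w.1, stretch 1 w.2), by fun_prop⟩
    (T := fun w => trunc (1 - 6 * minCoord w.2)) (by fun_prop)
    (D := fun w => stretch 1 w.2) (by fun_prop) (fun w hw => stretch_mem_bdry hw)
    (fun w hw hw' => by
      rw [trunc_of_le (sub_nonpos.2 hw)]
      have hs : stretch 1 w.2 ∈ bdry := stretch_mem_bdry hw'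
      exact (hH _ _ hs).trans (eK _ _ hs))
  refine (hac.trans (g := c) (h := d) ⟨⟨⟨F, fun p => ?_, fun p => ?_⟩, fun t p hp => ?_⟩⟩).trans hbd.symm
  · rcases le_total 1 (6 * minCoord p) with hp | hp
    · exact (hF (0, p) hp).trans ((h0 _).trans (ci p hp).symm)
    · exact (hF' (0, p) hp).trans (co p hp).symm
  · rcases le_total 1 (6 * minCoord p) with hp | hp
    · exact (hF (1, p) hp).trans ((h1 _).trans (di p hp).symm)
    · exact (hF' (1, p) hp).trans (d_o p hp).symm
  · have hp' : 6 * minCoord p ≤ 1 := by rw [minCoord_eq_zero hp]; norm_num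
    exact (hF' (t, p) hp').trans (co p hp').symm

/-- The end of a prism depends only on the class of its beginning. So prisms define a map on
classes, and compatibility with the operations can be read off by comparing ends. -/
theorem Prism.unique (he : IsSquareFamily f γ s s' φ e) {g h : FundamentalGroup M m₀}
    {x : Gamma s g h} {g' h' g'' h'' : FundamentalGroup N n₀} {v : Gamma s' g' h'}
    {v' : Gamma s' g'' h''} (hv : Prism f e x v) (hv' : Prism f e x v') (hg : g' = g'')
    (hh : h' = h'') : v ≍ v' := by
  subst hg hh
  obtain ⟨K, _, w, ⟨u, rfl, rfl⟩, hw, K0, K1, hK⟩ := hv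
  obtain ⟨L, _, w', ⟨u', hu, rfl⟩, hw', L0, L1, hL⟩ := hv'
  obtain ⟨U⟩ : u'.1.HomotopicRel u.1 bdry := Quotient.exact hu
  refine heq_of_eq (Eq.symm (hw'.eq_of_homotopicRel hw (homotopicRel_of_isTri he hL hK
    (f.comp U.toContinuousMap) (fun p => ?_) (fun p => ?_) (fun t p hp => ?_) L1 K1)))
  · exact (congrArg f (U.apply_zero p)).trans (L0 p).symm
  · exact (congrArg f (U.apply_one p)).trans (K0 p).symm
  · exact (congrArg f (U.eq_fst t hp)).trans (L0 p).symm

end Prism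

/-! ### The coboundary that compares two choices -/

section Invariance

variable {M : Type u} [TopologicalSpace M] {m₀ : M} {N : Type v} [TopologicalSpace N] {n₀ : N}
variable {s : LoopSection M m₀} {s' : LoopSection N n₀} {f : C(M, N)} {γ : Path (f m₀) n₀}
variable {φ : FundamentalGroup M m₀ ≃* FundamentalGroup N n₀}
variable {e : FundamentalGroup M m₀ → I → I → N}

theorem BaseElements.eq_of_bubble_heq (x : BaseElements s) {g h g' h' : FundamentalGroup M m₀}
    {a b : PiTwo M m₀} (hab : bubble a (x.elt g h) ≍ bubble b (x.elt g' h')) (hg : g = g')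
    (hh : h = h') : a = b := by
  subst hg hh
  exact bubble_injective _ (eq_of_heq hab)

/-- The cochains of base elements for `M` and `N` differ by a symmetric coboundary. -/
theorem cochainCongr_sub_mem_BS₃ (he : IsSquareFamily f γ s s' φ e) {ψ : PiTwo M m₀ ≃+ PiTwo N n₀}
    (hψ : ∀ a, ψ a = transport (Path.Homotopic.Quotient.mk γ) (mapPiTwo f m₀ a))
    {x : BaseElements s} {x' : BaseElements s'} {α α'} (hα : x.IsCochain α)
    (hα' : x'.IsCochain α') :
    cochainCongr φ ψ α - α' ∈ BS₃ (FundamentalGroup N n₀) (PiTwo N n₀) := by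
  -- `S g h` will be the coordinate, relative to `x'`, of the image of the base element `x(g, h)`
  -- under a prism.
  have key : ∀ g h, ∃ a, Prism f e (x.elt g h) (bubble a (x'.elt (φ g) (φ h))) := fun g h => by
    obtain ⟨v, hv⟩ := Prism.exists he (x.elt g h)
    obtain ⟨a, rfl⟩ := exists_bubble (x'.elt (φ g) (φ h)) v
    exact ⟨a, hv⟩
  choose S hS using key
  have SP : ∀ g h k, k = g⁻¹ * h⁻¹ → S h k = φ g • S g h := by
    rintro g h _ rfl
    have h1 := (hS g h).P he.reversible
    rw [bubble_P, x.P_elt, x'.P_elt] at h1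
    exact x'.eq_of_bubble_heq ((hS h (g⁻¹ * h⁻¹)).unique he h1 rfl (by simp only [map_mul, map_inv]))
      rfl (by simp only [map_mul, map_inv])
  have SQ : ∀ g h k l, k = g⁻¹ → l = h * g → S k l = -(φ g • S g h) := by
    rintro g h _ _ rfl rfl
    have h1 := (hS g h).Q he.reversible
    rw [bubble_Q, x.Q_elt, x'.Q_elt] at h1
    exact x'.eq_of_bubble_heq ((hS g⁻¹ (h * g)).unique he h1 (map_inv φ g) (map_mul φ h g))
      (map_inv φ g) (map_mul φ h g)
  -- The image of the product of three base elements is computed in two ways: as the product of the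
  -- images, and as the image of a base element with a value of α glued in.
  have Sm : ∀ g h k' : FundamentalGroup M m₀,
      ψ (α (g⁻¹ * h) (h⁻¹ * k'⁻¹) k') + S g k' =
        S g h⁻¹ + φ (g⁻¹ * h) • S h k' + S (h⁻¹ * g) (k' * h) +
          α' (φ (g⁻¹ * h)) (φ (h⁻¹ * k'⁻¹)) (φ k') := fun g h k' => by
    have h1 := Prism.gmul he rfl rfl rfl (map_inv φ h) (by rw [map_mul, map_inv]) (map_mul φ k' h)
      (hS g h⁻¹) (hS h k') (hS (h⁻¹ * g) (k' * h))
    rw [hα.gmul_elt, gmul_bubble, hα'.gmul_elt, ← bubble_add] at h1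
    have h2 := (hS g k').bubble he (α (g⁻¹ * h) (h⁻¹ * k'⁻¹) k')
    rw [← hψ, ← bubble_add] at h2
    have h3 := x'.eq_of_bubble_heq (h2.unique he h1 rfl rfl) rfl rfl
    simp only [map_mul, map_inv] at h3 ⊢
    exact h3
  have c2 : ∀ a b, S a⁻¹ b⁻¹ = -S (a * b)⁻¹ b := fun a b => by
    rw [SP (a * b) a⁻¹ b⁻¹ (by group), SQ (a * b)⁻¹ b (a * b) a⁻¹ (by group) (by group), smul_neg,
      ← mul_smul, ← map_mul, mul_inv_cancel, map_one, one_smul]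
  have c1 : ∀ a b, φ a • S b⁻¹ (a * b) = -S (a * b)⁻¹ b := fun a b => by
    rw [SQ b a b⁻¹ (a * b) rfl rfl, SP (a * b)⁻¹ b a (by group), smul_neg, ← mul_smul, ← mul_smul,
      ← map_mul, ← map_mul]
    rw [mul_inv_cancel, map_one, one_smul]
  -- The 2-cochain uses the same substitution as α: `g = (a * b)⁻¹` and the last argument `b`. Then
  -- `SP` and `SQ` become its symmetries, and `Sm` becomes its coboundary formula.
  refine ⟨fun a b => S (φ.symm a * φ.symm b)⁻¹ (φ.symm b), ⟨fun a b => ?_, fun a b => ?_⟩, ?_⟩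
  · obtain ⟨a, rfl⟩ := φ.surjective a
    obtain ⟨b, rfl⟩ := φ.surjective b
    simp only [← map_mul, ← map_inv, MulEquiv.symm_apply_apply]
    rw [inv_mul_cancel_left, c1, neg_neg]
  · obtain ⟨a, rfl⟩ := φ.surjective a
    obtain ⟨b, rfl⟩ := φ.surjective b
    simp only [← map_mul, ← map_inv, MulEquiv.symm_apply_apply]
    rw [mul_inv_cancel_right, c2, neg_neg]
  · funext a b c
    obtain ⟨a, rfl⟩ := φ.surjective a
    obtain ⟨b, rfl⟩ := φ.surjective b
    obtain ⟨c, rfl⟩ := φ.surjective c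
    have h1 := Sm (a * b * c)⁻¹ (b * c)⁻¹ c
    have e1 : (a * b * c)⁻¹⁻¹ * (b * c)⁻¹ = a := by group
    have e2 : (b * c)⁻¹⁻¹ * c⁻¹ = b := by group
    have e3 : (b * c)⁻¹⁻¹ * (a * b * c)⁻¹ = a⁻¹ := by group
    have e4 : c * (b * c)⁻¹ = b⁻¹ := by group
    rw [e1, e2, e3, e4, c2 a b, inv_inv] at h1
    change φ a • S (φ.symm (φ b) * φ.symm (φ c))⁻¹ (φ.symm (φ c)) -
      S (φ.symm (φ a * φ b) * φ.symm (φ c))⁻¹ (φ.symm (φ c)) +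
      S (φ.symm (φ a) * φ.symm (φ b * φ c))⁻¹ (φ.symm (φ b * φ c)) -
      S (φ.symm (φ a) * φ.symm (φ b))⁻¹ (φ.symm (φ b)) =
      ψ (α (φ.symm (φ a)) (φ.symm (φ b)) (φ.symm (φ c))) - α' (φ a) (φ b) (φ c)
    simp only [← map_mul, MulEquiv.symm_apply_apply]
    rw [← mul_assoc, eq_sub_iff_add_eq, ← add_left_inj (S (a * b * c)⁻¹ c), h1]
    abel

theorem HS₃.mk_eq_mk {G : Type*} [Group G] {A : Type*} [AddCommGroup A] [DistribMulAction G A]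
    {α β : G → G → G → A} (hα : α ∈ ZS₃ G A) (hβ : β ∈ ZS₃ G A) (h : α - β ∈ BS₃ G A) :
    HS₃.mk α hα = HS₃.mk β hβ := by
  refine (QuotientAddGroup.eq_iff_sub_mem).2 ?_
  exact h

/-- Two choices on the same space are compared by prisms over the identity map and the constant
path, so the induced transport of cochains is trivial. -/
theorem HS₃_mk_eq_of_isCochain (h₂ : ∀ g : FundamentalGroup M m₀, g⁻¹ = g → g = 1)
    {s s' : LoopSection M m₀} {x : BaseElements s} {x' : BaseElements s'} {α α'}
    (hα : α ∈ ZS₃ (FundamentalGroup M m₀) (PiTwo M m₀))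
    (hα' : α' ∈ ZS₃ (FundamentalGroup M m₀) (PiTwo M m₀)) (h : x.IsCochain α)
    (h' : x'.IsCochain α') : HS₃.mk α hα = HS₃.mk α' hα' := by
  obtain ⟨e, he⟩ := exists_squareFamily h₂ (ContinuousMap.id M) (Path.refl m₀) s s'
    (MulEquiv.refl _) (fun g => by
      obtain ⟨p, hp⟩ := Path.Homotopic.Quotient.mk_surjective g.toPath
      change g.toPath = _
      rw [← hp]
      change _ = (Path.Homotopic.Quotient.refl m₀).symm.trans
        ((Path.Homotopic.Quotient.mk p).trans (Path.Homotopic.Quotient.refl m₀))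
      rw [Path.Homotopic.Quotient.trans_refl]
      change _ = (Path.Homotopic.Quotient.mk (Path.refl m₀).symm).trans _
      rw [Path.refl_symm]
      exact (Path.Homotopic.Quotient.refl_trans _).symm)
  refine HS₃.mk_eq_mk hα hα' ?_
  exact cochainCongr_sub_mem_BS₃ he (ψ := AddEquiv.refl _) (fun a => by
    obtain ⟨a, rfl⟩ := PiTwo.mk_surjective a
    exact (transport_refl _).symm) h h'

theorem HS₃_congr_mk_eq_of_isCochain (h₂ : ∀ g : FundamentalGroup M m₀, g⁻¹ = g → g = 1)
    (f : M ≃ₜ N) (γ : Path (f m₀) n₀) {x : BaseElements s} {x' : BaseElements s'} {α α'}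
    (hα : α ∈ ZS₃ (FundamentalGroup M m₀) (PiTwo M m₀))
    (hα' : α' ∈ ZS₃ (FundamentalGroup N n₀) (PiTwo N n₀)) (h : x.IsCochain α)
    (h' : x'.IsCochain α') :
    HS₃.congr (piOneCongr f γ) (piTwoCongr f γ) (piTwoCongr_smul f γ) (HS₃.mk α hα) =
      HS₃.mk α' hα' := by
  obtain ⟨e, he⟩ := exists_squareFamily h₂ (f : C(M, N)) γ s s' (piOneCongr f γ) fun g => rfl
  exact HS₃.mk_eq_mk (cochainCongr_mem_ZS₃ _ _ (piTwoCongr_smul f γ) hα) hα'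
    (cochainCongr_sub_mem_BS₃ he (fun a => rfl) h h')

theorem eq_one_of_inv_eq {G : Type*} [Group G] (h₂ : ∀ g : G, orderOf g ≠ 2) (g : G)
    (h : g⁻¹ = g) : g = 1 := by
  by_contra hg
  exact h₂ g (orderOf_eq_prime (by rw [pow_two, mul_eq_one_iff_eq_inv, h]) hg)

end Invariance

end DeltaGrp

end

/-! ### The main theorem -/

theorem mainTheorem4 {M : Type*} [TopologicalSpace M] [PathConnectedSpace M] (m₀ : M)
    (h₂ : ∀ g : FundamentalGroup M m₀, orderOf g ≠ 2)
    (h₃ : ∀ g : FundamentalGroup M m₀, orderOf g ≠ 3) :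
    -- sections exist, and for each of them `Γ(M)` is a well-defined Δ-group
    Nonempty (LoopSection M m₀) ∧
    (∀ s : LoopSection M m₀,
      (∀ {g h' h k' p q : FundamentalGroup M m₀} (e₁ : h' = h⁻¹) (e₂ : p = h⁻¹ * g)
        (e₃ : q = k' * h) (a : Gamma s g h') (b : Gamma s h k') (c : Gamma s p q)
        (d : Gamma s g k'), (gammaData s).m e₁ e₂ e₃ a b c = d ↔ Fills a b c d) ∧
      (gammaData s).IsDeltaGroup ∧
      -- base elements exist, and they determine the cochain `α`
      Nonempty (BaseElements s) ∧
      ∀ x : BaseElements s,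
        (∃! α : FundamentalGroup M m₀ → FundamentalGroup M m₀ → FundamentalGroup M m₀ →
          PiTwo M m₀, x.IsCochain α) ∧
        -- `α` is a symmetric cocycle and `Γ(M)` is isomorphic to `T(π₁(M), π₂(M), α)`
        ∀ α, x.IsCochain α →
          α ∈ ZS₃ (FundamentalGroup M m₀) (PiTwo M m₀) ∧
          (twisted (FundamentalGroup M m₀) (PiTwo M m₀) α).IsDeltaGroup ∧
          ∃ Φ : (twisted (FundamentalGroup M m₀) (PiTwo M m₀) α).Iso (gammaData s),
            ∀ g h (a : PiTwo M m₀), Φ.toEquiv g h a = bubble a (x.elt g h)) ∧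
    -- the class of `α` does not depend on the choices
    (∀ (s s' : LoopSection M m₀) (x : BaseElements s) (x' : BaseElements s') (α α')
      (hα : α ∈ ZS₃ (FundamentalGroup M m₀) (PiTwo M m₀))
      (hα' : α' ∈ ZS₃ (FundamentalGroup M m₀) (PiTwo M m₀)),
      x.IsCochain α → x'.IsCochain α' → HS₃.mk α hα = HS₃.mk α' hα') ∧
    -- the class of `α` is preserved by homeomorphisms and by changes of the base point
    ∀ {N : Type*} [TopologicalSpace N] (n₀ : N) (f : M ≃ₜ N) (γ : Path (f m₀) n₀)
      (s : LoopSection M m₀) (s' : LoopSection N n₀) (x : BaseElements s) (x' : BaseElements s')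
      (α α') (hα : α ∈ ZS₃ (FundamentalGroup M m₀) (PiTwo M m₀))
      (hα' : α' ∈ ZS₃ (FundamentalGroup N n₀) (PiTwo N n₀)),
      x.IsCochain α → x'.IsCochain α' →
        HS₃.congr (piOneCongr f γ) (piTwoCongr f γ) (piTwoCongr_smul f γ) (HS₃.mk α hα) =
          HS₃.mk α' hα' := by
  have h₁ := eq_one_of_inv_eq h₂
  refine ⟨nonempty_loopSection h₁, fun s => ⟨?_, gammaData_isDeltaGroup s,
    nonempty_baseElements h₂ h₃ s, fun x => ⟨x.existsUnique_cochain, fun α hα => ?_⟩⟩, ?_, ?_⟩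
  · intro g h' h k' p q e₁ e₂ e₃ a b c d
    exact gammaData_m_eq_iff e₁ e₂ e₃ a b c d
  · have hT := hα.iso.isDeltaGroup (gammaData_isDeltaGroup s)
    exact ⟨mem_ZS₃_of_isDeltaGroup hT, hT, hα.iso, fun g h a => rfl⟩
  · intro s s' x x' α α' hα hα' h h'
    exact HS₃_mk_eq_of_isCochain h₁ hα hα' h h'
  · intro N _ n₀ f γ s s' x x' α α' hα hα' h h'
    exact HS₃_congr_mk_eq_of_isCochain h₁ f γ hα hα' h h'
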